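/- **Setting.** Let $\Sigma$ be a finite alphabet, $\mathcal C=\{c_1,c_2,\dots\}$ a countable extended alphabet and $\Omega=\Sigma\sqcup\mathcal C\sqcup\{\$\}$. Inputs are finite strings $x$ over $\Omega$ whose first symbol, and no other, is the start symbol $\$$. $\mathcal F(\Omega)$ is the set of maps $f$ sending each input $x$ to an array $f(x)\in\mathbb R^{|x|\times\Omega}$. Fix $\varepsilon>0$. **Transformers.** A transformer $T$ with context width $N\in\mathbb N\cup\{\infty\}$ and residual space $\mathcal H$ (a real Hilbert space; $\mathbb R^d$ for an ordinary transformer of width $d$) has a depth $L$, a number $H$ of heads, a hidden dimension $d_{\rm ff}$, a rounding precision $r$, positional encodings $p_i\in\mathcal H$ ($1\le i<N+1$), embeddings $E_\omega\in\mathcal H$ for $\omega$ in $\Omega_N=\Sigma\cup\{\$\}\cup\{c_k:1\le k<N+1\}$ (write $c_k$ also for $E_{c_k}$), bounded operators $K_{l,h},Q_{l,h},V_{l,h}$ on $\mathcal H$, $A_l:\mathcal H\to\mathbb R^{d_{\rm ff}}$, $B_l:\mathbb R^{d_{\rm ff}}\to\mathcal H$, biases $b_l\in\mathbb R^{d_{\rm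 ff}}$, coordinatewise activations $\psi_l$, each coordinate being ReLU, Heaviside or $z\mapsto 1/(z+\varepsilon)$, and a bounded unembedding $U:\mathcal H\to\ell^\infty(\Omega_N)$ with rows $U_\omega$. On input $x$ at offsets $o_p,o_c\ge0$, $y^{(0)}_i=E_{x_i}+p_{i+o_p}$, where the embedding of an extended character $x_i=c_k$ is $c_{k+o_c}$. Layer $l$ computes, with $w_{ij}=\exp(\log|x|\cdot\langle K_{l,h}y_j^{(l-1)},Q_{l,h}y_i^{(l-1)}\rangle)$ where the inner product and the output of $\exp$ are rounded to $r$ fractional bits, $$Y_i=y^{(l-1)}_i+\sum_{h}\frac{\sum_{j\le i}w_{ij}V_{l,h}y^{(l-1)}_j}{\sum_{j\le i}w_{ij}},\qquad y_i^{(l)}=Y_i+B_l\psi_l(A_lY_i+b_l),$$ and $T(x,o_p,o_c)_i=Uy_i^{(L)}$. **Product functions.** Let $\mathcal P$ be the set of products $V_{l_k,h_k}\cdots V_{l_1,h_1}$ with $l_1<\dots<l_k$, $k\ge0$ (one formal product for each choice of the indices), and $\mathcal{VO}$ the set of all $p_i$, all $E_\omega$ and all columns of the $B_l$. The product functions are $\alpha^{\rm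 attn}_{l,h,S_1,S_2,v,w}=\langle K_{l,h}S_1v,Q_{l,h}S_2w\rangle$, $\alpha^{\rm unembed}_{S,\omega,w}=U_\omega^{T}Sw$ and $\beta^{\rm mlp}_{S,l,s,w}=(A_lSw)_s$, for $S,S_1,S_2\in\mathcal P$ and $v,w\in\mathcal{VO}$. $T$ is *translation invariant* if each product function depends on a pair of positions, or a pair of extended characters, only through the difference of the two indices (a row $U_{c_k}$ counting as the character $c_k$), and in every other case does not depend on the index of a position or extended character occurring in it. $T$ is *local* if for some $\Delta$ the $\alpha$'s of two positions, or of two extended characters, vanish when the indices differ by more than $\Delta$. A real number has $p$-bit precision if it is an integer multiple of $2^{-p}$. A **Symbolic Limit Transformer** is a transformer with $N=\infty$ whose $p_i$ and $c_k$ are bounded in norm, whose product functions and bias entries all have $p$-bit precision for one $p\in\mathbb N$, and which is translation invariant and local. $f\in\mathcal F(\Omega)$ is *expressible* if some such $T$ satisfies $T(x,0,0)=f(x)$ for all inputs $x$. **Hypothesis class and regularizer.** $\Theta_n$ is the set of translation-invariant transformers with $N=n$ and residual space $\mathbb R^d$, $d$ arbitrary, together with a $p\in\mathbb N$ such that all parameter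 entries have $p$-bit precision. For $T\in\Theta_n$, $$\mathcal R(T)=L+H+p+r+\max_{l,h}\|K_{l,h}^TQ_{l,h}\|+\max_{l,h}\|V_{l,h}\|+\max_l\|A_l\|_F+\max_l\|B_l\|_F+\max_\omega\|U_\omega\|_2+\max_i\|p_i\|_2+\max_\omega\|E_\omega\|_2+\max_l\|b_l\|_2+\zeta(T),$$ $$\zeta(T)=\sum_{\substack{1\le i,j\le n\\ \min(i,j)=1}}\Big[\sum_{l,h}\sum_{S_1,S_2\in\mathcal P}\big(|\alpha^{\rm attn}_{l,h,S_1,S_2,p_i,p_j}|^2+|\alpha^{\rm attn}_{l,h,S_1,S_2,c_i,c_j}|^2\big)+\sum_{S\in\mathcal P}|\alpha^{\rm unembed}_{S,c_i,c_j}|^2\Big].$$ Operator norms without subscript are spectral norms; maxima over empty sets are $0$. **Inference.** $T\in\Theta_n$ *matches $f$ up to size $s$* if for every input $x$ with $|x|\le s$ and every $\omega\in\Omega$ such that the indices of the extended characters among $\omega$ and the symbols of $x$ lie in $[1,n]$ and differ by at most $s$, and for all offsets at which $x$ fits into the context ($|x|+o_p\le n$, and $k+o_c\le n$ for each $c_k$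 in $x$), the logit of $\omega$ at each position $i$ of $x$ in $T(x,o_p,o_c)$ equals $f(x)_{i,\omega}$; at character offset $o_c$ the logit of $\omega=c_k$ is read at $c_{k+o_c}$ (whenever $k+o_c\le n$). For $s=n$ this says that $T$ matches $f$ at all lengths $\le n$ (on inputs over, and logits of, $\Omega_n$). A *training length* is a $t:\mathbb N\to\mathbb N$ with $t(n)\to\infty$ and $t(n)\le n$. A *run* of the $t(n)$-Inference Procedure on $f$ is a sequence $T_n\in\Theta_n$ ($n\ge1$) such that $T_n$ matches $f$ up to size $t(n)$ and $\mathcal R(T_n)\le\frac1n+\mathcal R(T)$ for every $T\in\Theta_n$ matching $f$ up to size $t(n)$. **Theorem.** Let $f\in\mathcal F(\Omega)$. The following are equivalent: 1. $f$ is expressible by a Symbolic Limit Transformer. 2. For every training length $t$, the $t(n)$-Inference Procedure has a run on $f$, and for every run $T_1,T_2,\dots$ there is $N_0$ such that for all $m>N_0$, $T_m$ matches $f$ at all lengths $\le m$. **Corollary.** If $f$ is not expressible by a Symbolic Limit Transformer, then there is a training length $t$ such that in every run of the $t(n)$-Inference Procedure on $f$ infinitely many $T_n$ fail to match $f$ at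 lengths $\le n$; and such a run exists provided that for every $n$ some element of $\Theta_n$ matches $f$ at all lengths $\le n$. -/

import Mathlib

open Filter

noncomputable section

/-! ### Vocabulary, inputs, target functions -/

/-- Indices available below a (possibly infinite) context width `N`.  Indices start at `0`:
the index `k` stands for position, resp. extended character, number `k + 1`. -/
abbrev Idx (N : ℕ∞) : Type := {k : ℕ // (k : ℕ∞) < N}

/-- A vocabulary: the start symbol, the finite alphabet `S`, and extended characters indexed
by `ι`.  The full vocabulary `Ω` is `Token S ℕ`; a transformer with context width `N` has the
vocabulary `Token S (Idx N)`. -/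
inductive Token (S : Type*) (ι : Type*)
  | start : Token S ι
  | fin (σ : S) : Token S ι
  | chr (k : ι) : Token S ι

/-- An input string is the start symbol followed by a word over `S` and the extended characters;
only that word is recorded, so that the string has length `x.length + 1`. -/
abbrev Word (S : Type*) : Type _ := List (S ⊕ ℕ)

/-- The length of the input string, the start symbol included. -/
def strLen {S : Type*} (x : Word S) : ℕ := x.length + 1

/-- The symbol at each position of the input string. -/
def symAt {S : Type*} (x : Word S) (i : Fin (strLen x)) : Token S ℕ :=
  Fin.cases Token.start
    (fun j : Fin x.length => match x.get j with
      | Sum.inl σ => Token.fin σ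
      | Sum.inr k => Token.chr k) i

/-- The set `F(Ω)`: maps sending an input `x` to an array of reals indexed by the positions of `x`
and the symbols of `Ω`. -/
abbrev Target (S : Type*) : Type _ := (x : Word S) → Fin (strLen x) → Token S ℕ → ℝ

/-! ### Scalar operations -/

/-- Activation functions that an MLP may use at a hidden coordinate. -/
inductive Activation
  | relu
  | heaviside
  | recip

/-- `ε` is the constant that keeps the reciprocal activation away from a division by zero. -/
def Activation.eval (ε : ℝ) : Activation → ℝ → ℝ
  | relu, z => max z 0
  | heaviside, z => if 0 < z then 1 else 0
  | recip, z => 1 / (z + ε)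

/-- Rounding to `r` fractional bits. -/
def roundBits (r : ℕ) (z : ℝ) : ℝ := (round (z * 2 ^ r) : ℝ) / 2 ^ r

/-- `z` is represented at `p` bits of precision: it is an integer multiple of `2⁻ᵖ`. -/
def IsDyadic (p : ℕ) (z : ℝ) : Prop := ∃ m : ℤ, z = (m : ℝ) / 2 ^ p

/-! ### Transformers -/

/-- The parameters of a transformer with context width `N` and residual stream `H`.  An ordinary
transformer of width `d` has `H = EuclideanSpace ℝ (Fin d)`.  The embeddings `E_σ` of the finite
tokens and of the start symbol, and the extended embeddings `c_k`, are all part of `emb`.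
The logits live in the space of bounded families indexed by the vocabulary, with the sup norm. -/
structure Transformer (S : Type*) (N : ℕ∞) (H : Type*)
    [NormedAddCommGroup H] [InnerProductSpace ℝ H] where
  depth : ℕ
  heads : ℕ
  dff : ℕ
  rnd : ℕ
  emb : Token S (Idx N) → H
  pos : Idx N → H
  K : Fin depth → Fin heads → H →L[ℝ] H
  Q : Fin depth → Fin heads → H →L[ℝ] H
  V : Fin depth → Fin heads → H →L[ℝ] H
  A : Fin depth → H →L[ℝ] EuclideanSpace ℝ (Fin dff)
  B : Fin depth → EuclideanSpace ℝ (Fin dff) →L[ℝ] H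
  b : Fin depth → EuclideanSpace ℝ (Fin dff)
  act : Fin depth → Fin dff → Activation
  U : H →L[ℝ] lp (fun _ : Token S (Idx N) => ℝ) ⊤

/-- Shift of a symbol of `Ω` by the character offset `o`, as a symbol of the vocabulary of a
transformer with context width `N`; `none` if it falls outside. -/
def shiftTok {S : Type*} (N : ℕ∞) (o : ℕ) : Token S ℕ → Option (Token S (Idx N))
  | .start => some .start
  | .fin σ => some (.fin σ)
  | .chr k => if h : ((k + o : ℕ) : ℕ∞) < N then some (.chr ⟨k + o, h⟩) else none

namespace Transformer

variable {S : Type*} {N : ℕ∞} {H : Type*} [NormedAddCommGroup H] [InnerProductSpace ℝ H]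

/-- Embedding of a symbol of `Ω` at character offset `o` (only used when it is available). -/
def embAt (T : Transformer S N H) (o : ℕ) (ω : Token S ℕ) : H :=
  match shiftTok N o ω with
  | some ω' => T.emb ω'
  | none => 0

/-- Positional encoding at index `i` (only used when it is available). -/
def posAt (T : Transformer S N H) (i : ℕ) : H :=
  if h : (i : ℕ∞) < N then T.pos ⟨i, h⟩ else 0

/-- The input `y⁽⁰⁾` of the first layer, at positional offset `op` and character offset `oc`. -/
def init (T : Transformer S N H) (x : Word S) (op oc : ℕ) (i : Fin (strLen x)) : H :=
  T.embAt oc (symAt x i) + T.posAt (i + op)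

/-- Attention logit of query position `i` and key position `j`, before rounding. -/
def attLogit (T : Transformer S N H) (l : Fin T.depth) (h : Fin T.heads) {m : ℕ}
    (y : Fin m → H) (i j : Fin m) : ℝ :=
  inner ℝ (T.K l h (y j)) (T.Q l h (y i))

/-- `exp (log m * logit)`, with the logit and the output of `exp` rounded; `m` is the length of the
input. -/
def attWeight (T : Transformer S N H) (l : Fin T.depth) (h : Fin T.heads) {m : ℕ}
    (y : Fin m → H) (i j : Fin m) : ℝ :=
  roundBits T.rnd (Real.exp (Real.log m * roundBits T.rnd (T.attLogit l h y i j)))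

/-- Causal attention block with residual connection. -/
def attBlock (T : Transformer S N H) (l : Fin T.depth) {m : ℕ} (y : Fin m → H) (i : Fin m) : H :=
  y i + ∑ h : Fin T.heads, (∑ j ∈ Finset.Iic i, T.attWeight l h y i j)⁻¹ •
    ∑ j ∈ Finset.Iic i, T.attWeight l h y i j • T.V l h (y j)

/-- One-layer MLP with residual connection. -/
def mlpBlock (T : Transformer S N H) (ε : ℝ) (l : Fin T.depth) (z : H) : H :=
  z + T.B l (WithLp.toLp 2 fun s => (T.act l s).eval ε ((T.A l z + T.b l) s))

/-- The activations `y⁽ˡ⁾` after `l` layers. -/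
def states (T : Transformer S N H) (ε : ℝ) (x : Word S) (op oc : ℕ) :
    ℕ → Fin (strLen x) → H
  | 0 => T.init x op oc
  | l + 1 => if hl : l < T.depth then
      fun i => T.mlpBlock ε ⟨l, hl⟩ (T.attBlock ⟨l, hl⟩ (T.states ε x op oc l) i)
    else T.states ε x op oc l

/-- The output logits `T(x, op, oc)` at a position, as a family over the vocabulary of `T`. -/
def logits (T : Transformer S N H) (ε : ℝ) (x : Word S) (op oc : ℕ) (i : Fin (strLen x)) :
    Token S (Idx N) → ℝ :=
  fun ω => T.U (T.states ε x op oc T.depth i) ω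

/-! ### Product functions -/

/-- The set `P`: choices, in each layer, of at most one value matrix. -/
abbrev Chain (T : Transformer S N H) : Type := Fin T.depth → Option (Fin T.heads)

/-- The product of the value matrices in a chain, the lowest layer at the right. -/
def chainProd (T : Transformer S N H) (C : T.Chain) : H →L[ℝ] H :=
  (List.finRange T.depth).foldl
    (fun M l => match C l with
      | none => M
      | some h => (T.V l h).comp M)
    (ContinuousLinearMap.id ℝ H)

end Transformer

/-- Labels of the vectors in `VO`: positional encodings, token embeddings, columns of `B_l`. -/
inductive OutVec (S : Type*) (N : ℕ∞) (L D : ℕ)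
  | pos (i : Idx N) : OutVec S N L D
  | emb (ω : Token S (Idx N)) : OutVec S N L D
  | mlp (l : Fin L) (s : Fin D) : OutVec S N L D

namespace OutVec

variable {S : Type*} {N : ℕ∞} {L D : ℕ}

/-- The index of a position or of an extended character; `0` for the other, fixed, vectors. -/
def idx : OutVec S N L D → ℕ
  | pos i => i
  | emb (.chr k) => k
  | _ => 0

/-- Two positions, two extended characters, or twice the same fixed vector. -/
def SameKind : OutVec S N L D → OutVec S N L D → Prop
  | pos _, pos _ => True
  | emb (.chr _), emb (.chr _) => True
  | v, w => v = w

/-- Related types: two positions or two extended characters. -/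
def Related : OutVec S N L D → OutVec S N L D → Prop
  | pos _, pos _ => True
  | emb (.chr _), emb (.chr _) => True
  | _, _ => False

/-- The pair `(v', w')` arises from `(v, w)` by changes of index that a translation-invariant
function must ignore: a common shift of both indices if `v` and `w` are of related types, and an
arbitrary change of each index if they are not. -/
def ShiftPair (v w v' w' : OutVec S N L D) : Prop :=
  SameKind v v' ∧ SameKind w w' ∧ (Related v w → v.idx + w'.idx = v'.idx + w.idx)

end OutVec

namespace Transformer

variable {S : Type*} {N : ℕ∞} {H : Type*} [NormedAddCommGroup H] [InnerProductSpace ℝ H]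

/-- Labels of the vectors in `VO` of `T`. -/
abbrev Out (T : Transformer S N H) : Type _ := OutVec S N T.depth T.dff

/-- The vector with a given label. -/
def vec (T : Transformer S N H) : T.Out → H
  | .pos i => T.pos i
  | .emb ω => T.emb ω
  | .mlp l s => T.B l (EuclideanSpace.single s 1)

/-- `vᵀ (∏ S₁)ᵀ K_{l,h}ᵀ Q_{l,h} (∏ S₂) w`. -/
def prodAttn (T : Transformer S N H) (l : Fin T.depth) (h : Fin T.heads) (C₁ C₂ : T.Chain)
    (v w : T.Out) : ℝ :=
  inner ℝ (T.K l h (T.chainProd C₁ (T.vec v))) (T.Q l h (T.chainProd C₂ (T.vec w)))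

/-- `U_ωᵀ (∏ S) w`: the pairwise potentials for a token or positional embedding `w`, and the
single-site potentials for a column `w` of some `B_l`. -/
def prodUnembed (T : Transformer S N H) (C : T.Chain) (ω : Token S (Idx N)) (w : T.Out) : ℝ :=
  T.U (T.chainProd C (T.vec w)) ω

/-- `(A_l)_{s,·} (∏ S) w`. -/
def prodMlp (T : Transformer S N H) (C : T.Chain) (l : Fin T.depth) (s : Fin T.dff)
    (w : T.Out) : ℝ :=
  T.A l (T.chainProd C (T.vec w)) s

/-- Translation invariance of all product functions.  The row of `U` that belongs to an extended
character counts as being of the type of that character. -/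
def TranslationInvariant (T : Transformer S N H) : Prop :=
  (∀ l h C₁ C₂ v w v' w', OutVec.ShiftPair v w v' w' →
    T.prodAttn l h C₁ C₂ v w = T.prodAttn l h C₁ C₂ v' w') ∧
  (∀ C ω w ω' w', OutVec.ShiftPair (.emb ω) w (.emb ω') w' →
    T.prodUnembed C ω w = T.prodUnembed C ω' w') ∧
  (∀ C l s w w', OutVec.SameKind w w' → T.prodMlp C l s w = T.prodMlp C l s w')

/-- Locality: pairwise interactions of related types vanish beyond some bandwidth `Δ`. -/
def IsLocal (T : Transformer S N H) : Prop :=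
  ∃ Δ : ℕ,
    (∀ l h C₁ C₂ v w, OutVec.Related v w → (Δ : ℤ) < |(v.idx : ℤ) - w.idx| →
      T.prodAttn l h C₁ C₂ v w = 0) ∧
    (∀ C ω w, OutVec.Related (.emb ω) w →
      (Δ : ℤ) < |((OutVec.emb ω : T.Out).idx : ℤ) - w.idx| → T.prodUnembed C ω w = 0)

/-- All product functions, and the biases, are numbers in `p`-bit precision. -/
def ProductsDyadic (T : Transformer S N H) (p : ℕ) : Prop :=
  (∀ l h C₁ C₂ v w, IsDyadic p (T.prodAttn l h C₁ C₂ v w)) ∧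
  (∀ C ω w, IsDyadic p (T.prodUnembed C ω w)) ∧
  (∀ C l s w, IsDyadic p (T.prodMlp C l s w)) ∧
  (∀ l s, IsDyadic p (T.b l s))

end Transformer

/-! ### Symbolic limit transformers -/

/-- A transformer with infinite context, over a Hilbert space, is a symbolic limit transformer.
The boundedness of the weight matrices is part of their being continuous linear maps. -/
structure IsSymbolicLimit {S : Type*} {H : Type*} [NormedAddCommGroup H] [InnerProductSpace ℝ H]
    (T : Transformer S ⊤ H) : Prop where
  bounded : ∃ C : ℝ, (∀ i, ‖T.pos i‖ ≤ C) ∧ ∀ k, ‖T.emb (.chr k)‖ ≤ C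
  dyadic : ∃ p : ℕ, T.ProductsDyadic p
  invariant : T.TranslationInvariant
  isLocal : T.IsLocal

/-- `f` is computed, at zero offsets, by some symbolic limit transformer. -/
def Expressible {S : Type*} (ε : ℝ) (f : Target S) : Prop :=
  ∃ (H : Type) (_ : NormedAddCommGroup H) (_ : InnerProductSpace ℝ H) (_ : CompleteSpace H)
    (T : Transformer S ⊤ H), IsSymbolicLimit T ∧
    ∀ (x : Word S) (i : Fin (strLen x)) (ω : Token S ℕ) (ω' : Token S (Idx ⊤)),
      shiftTok ⊤ 0 ω = some ω' → T.logits ε x 0 0 i ω' = f x i ω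

/-! ### Hypothesis classes and the regularizer -/

/-- All parameters of a transformer of finite width are represented at `p` bits of precision. -/
structure Transformer.HasPrecision {S : Type*} {N : ℕ∞} {d : ℕ}
    (T : Transformer S N (EuclideanSpace ℝ (Fin d))) (p : ℕ) : Prop where
  emb : ∀ ω a, IsDyadic p (T.emb ω a)
  pos : ∀ i a, IsDyadic p (T.pos i a)
  K : ∀ l h a a', IsDyadic p (T.K l h (EuclideanSpace.single a 1) a')
  Q : ∀ l h a a', IsDyadic p (T.Q l h (EuclideanSpace.single a 1) a')
  V : ∀ l h a a', IsDyadic p (T.V l h (EuclideanSpace.single a 1) a')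
  A : ∀ l a s, IsDyadic p (T.A l (EuclideanSpace.single a 1) s)
  B : ∀ l s a, IsDyadic p (T.B l (EuclideanSpace.single s 1) a)
  b : ∀ l s, IsDyadic p (T.b l s)
  U : ∀ a ω, IsDyadic p (T.U (EuclideanSpace.single a 1) ω)

/-- The hypothesis class `Θ_n`.  The precision `prec` used for the parameters is part of the data,
and so is the width `d`, which is not constrained. -/
structure Hypothesis (S : Type*) (n : ℕ) where
  d : ℕ
  prec : ℕ
  T : Transformer S (n : ℕ∞) (EuclideanSpace ℝ (Fin d))
  hasPrecision : T.HasPrecision prec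
  invariant : T.TranslationInvariant

namespace Hypothesis

variable {S : Type*} {n : ℕ}

/-- An index below `n`. -/
def index (i : Fin n) : Idx (n : ℕ∞) := ⟨i, by exact_mod_cast i.isLt⟩

/-- The penalty on pairwise interactions.  The pairs of indices at least one of which is the first
index represent each displacement exactly once. -/
def zeta (G : Hypothesis S n) : ℝ :=
  (∑ l : Fin G.T.depth, ∑ h : Fin G.T.heads, ∑ C₁ : G.T.Chain, ∑ C₂ : G.T.Chain,
    ∑ i : Fin n, ∑ j : Fin n, if (i : ℕ) = 0 ∨ (j : ℕ) = 0 then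
      |G.T.prodAttn l h C₁ C₂ (.pos (index i)) (.pos (index j))| ^ 2 +
      |G.T.prodAttn l h C₁ C₂ (.emb (.chr (index i))) (.emb (.chr (index j)))| ^ 2
    else 0) +
  ∑ C : G.T.Chain, ∑ i : Fin n, ∑ j : Fin n, if (i : ℕ) = 0 ∨ (j : ℕ) = 0 then
    |G.T.prodUnembed C (.chr (index i)) (.emb (.chr (index j)))| ^ 2
  else 0

/-- The regularizer.  Norms of operators on the residual stream are spectral norms, the norm of `U`
is the largest Euclidean norm of a row, and the suprema are maxima over finite families (`0` for an
empty family). -/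
def reg (G : Hypothesis S n) : ℝ :=
  (G.T.depth : ℝ) + G.T.heads + G.prec + G.T.rnd +
  (⨆ lh : Fin G.T.depth × Fin G.T.heads,
    ‖(ContinuousLinearMap.adjoint (G.T.K lh.1 lh.2)).comp (G.T.Q lh.1 lh.2)‖) +
  (⨆ lh : Fin G.T.depth × Fin G.T.heads, ‖G.T.V lh.1 lh.2‖) +
  (⨆ l : Fin G.T.depth, √(∑ a : Fin G.d, ‖G.T.A l (EuclideanSpace.single a 1)‖ ^ 2)) +
  (⨆ l : Fin G.T.depth, √(∑ s : Fin G.T.dff, ‖G.T.B l (EuclideanSpace.single s 1)‖ ^ 2)) +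
  ‖G.T.U‖ +
  (⨆ i : Idx (n : ℕ∞), ‖G.T.pos i‖) +
  (⨆ ω : Token S (Idx (n : ℕ∞)), ‖G.T.emb ω‖) +
  (⨆ l : Fin G.T.depth, ‖G.T.b l‖) +
  G.zeta

/-! ### Matching and the inference procedure -/

/-- `G` matches `f` up to size `r`: for every input of length at most `r` whose characters have
indices in the context window, at all offsets at which the input fits, and for every output symbol
`ω`, the logit of `ω` is the one prescribed by `f`; the characters involved (those of the input
and, if it is one, `ω`) lie in a range `max - min ≤ r`.  With a character offset, the logit of a
character is read at the character shifted by the same offset. -/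
def MatchesUpTo (ε : ℝ) (f : Target S) (G : Hypothesis S n) (r : ℕ) : Prop :=
  ∀ (x : Word S) (ω : Token S ℕ), strLen x ≤ r →
    (∀ k, (Sum.inr k ∈ x ∨ ω = .chr k) → k < n) →
    (∀ k k', (Sum.inr k ∈ x ∨ ω = .chr k) → (Sum.inr k' ∈ x ∨ ω = .chr k') → k ≤ k' + r) →
    ∀ op oc : ℕ, strLen x + op ≤ n → (∀ k, Sum.inr k ∈ x → k + oc < n) →
    ∀ (i : Fin (strLen x)) (ω' : Token S (Idx (n : ℕ∞))),
      shiftTok (n : ℕ∞) oc ω = some ω' → G.T.logits ε x op oc i ω' = f x i ω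

end Hypothesis

/-- A training length. -/
def IsTrainingLength (t : ℕ → ℕ) : Prop := Tendsto t atTop atTop ∧ ∀ n, t n ≤ n

/-- `G 1, G 2, …` is a possible output of the `t(n)`-inference procedure for `f`: `G n ∈ Θ_n`
matches `f` up to size `t n`, and its regularizer is within `1 / n` of the infimum over all such
elements of `Θ_n`.  (The entry `G 0` plays no role.) -/
def IsRun {S : Type*} (ε : ℝ) (f : Target S) (t : ℕ → ℕ) (G : (n : ℕ) → Hypothesis S n) : Prop :=
  ∀ n, 1 ≤ n → (G n).MatchesUpTo ε f (t n) ∧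
    ∀ G' : Hypothesis S n, G'.MatchesUpTo ε f (t n) → (G n).reg ≤ 1 / (n : ℝ) + G'.reg

end

noncomputable section

/-! ### Kinds of labels, probes and tables -/

/-! A transformer computes through scalars only. Every activation is a linear combination of vectors
`S v`, with `S` a product of value matrices and `v` in `VO`; the coefficients come from attention
weights and hidden activations, which are in turn functions of product functions and biases. Hence
two transformers give the same logits on an input as soon as their product functions agree on the
labels that occur in it, whatever their residual spaces and context widths (`run_mem_jointSpan`,
`logit_eq_of_models`). For a translation-invariant transformer the product functions form a table,
indexed by a slot (all data except the indices) and an integer displacement.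

Conversely, every local table is realized on a space with an orthonormal basis of cells (chain,
kind, optional index): value matrices extend the chain, and the query operators are finite sums of
table values times partial shifts of the basis (`realize`, `realize_eval`). The norms are controlled
by the numbers of slots, displacements and hidden units, never by the context width. A local dyadic
table therefore gives a symbolic limit transformer (`exists_isSymbolicLimit`) and also elements of
all `Θ_n` with uniformly bounded regularizer (`exists_hypothesis_of_table`).

The other ingredient is compactness. A bounded regularizer bounds depth, heads, precision, the
product functions, and the number of hidden units with a nonzero column of `B`; if the interaction
range is bounded too, only finitely many tables remain (`exists_finite_tables`). The range along a
run is bounded because of `ζ` (`IsRun.exists_local`): if `T_m` has a nonzero interaction of range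
above `n₀`, restricting it to width `n₀` saves at least a fixed quantum `η`. When `n₀` is large and
`R(T_{n₀})` is almost the supremum along the run, the restriction would beat `T_{n₀}` by more than
the permitted `1/n₀`.

If `f` is expressible, the regularizers along a run are bounded. Were infinitely many `T_m` wrong,
two of them with `t(m') ≥ m` would share a table, and `T_m` would inherit the correct logits of
`T_{m'}` (`IsRun.generalizes`). If `f` is not expressible, the regularizers of full matches tend to
infinity, since otherwise a table recurring along a run would yield a symbolic limit transformer for
`f` (`exists_lt_reg_of_not_expressible`). But when full matches exist, inputs of size at most `s`
can be matched in every context at a cost `C(s)` (`exists_bounded_of_forall_matches`). A training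
length that grows slowly enough makes the short match cheaper than any full match, which gives the
corollary and, by contraposition, the remaining implication. -/

/-- A label with its index forgotten. -/
inductive Kind (S : Type*) (L D : ℕ)
  | pos : Kind S L D
  | start : Kind S L D
  | fin (σ : S) : Kind S L D
  | chr : Kind S L D
  | mlp (l : Fin L) (s : Fin D) : Kind S L D

/-- The kinds whose labels carry an index. -/
def Kind.Indexed {S : Type*} {L D : ℕ} : Kind S L D → Prop
  | pos => True
  | chr => True
  | _ => False

instance Kind.finite {S : Type*} {L D : ℕ} [Finite S] : Finite (Kind S L D) := by
  refine Finite.of_surjective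
    (fun z : Fin 3 ⊕ S ⊕ (Fin L × Fin D) => (match z with
      | .inl 0 => .pos
      | .inl 1 => .start
      | .inl 2 => .chr
      | .inr (.inl σ) => .fin σ
      | .inr (.inr (l, s)) => .mlp l s : Kind S L D)) ?_
  rintro (_ | _ | σ | _ | ⟨l, s⟩)
  exacts [⟨.inl 0, rfl⟩, ⟨.inl 1, rfl⟩, ⟨.inr (.inl σ), rfl⟩, ⟨.inl 2, rfl⟩,
    ⟨.inr (.inr (l, s)), rfl⟩]

namespace OutVec

variable {S : Type*} {N N' : ℕ∞} {L D D' : ℕ}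

/-- The kind of a label. -/
def kind : OutVec S N L D → Kind S L D
  | pos _ => .pos
  | emb .start => .start
  | emb (.fin σ) => .fin σ
  | emb (.chr _) => .chr
  | mlp l s => .mlp l s

open Classical in
/-- The difference of the indices of two labels of related types, and `0` otherwise. -/
def disp (v w : OutVec S N L D) : ℤ :=
  if v.kind = w.kind ∧ v.kind.Indexed then (v.idx : ℤ) - w.idx else 0

/-- Change of the labels of hidden units. -/
def mapUnit (e : Fin D → Fin D') : OutVec S N L D → OutVec S N L D'
  | pos i => pos i
  | emb ω => emb ω
  | mlp l s => mlp l (e s)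

lemma related_iff (v w : OutVec S N L D) :
    Related v w ↔ v.kind = w.kind ∧ v.kind.Indexed := by
  rcases v with i | (_ | σ | k) | ⟨l, s⟩ <;> rcases w with j | (_ | σ' | k') | ⟨l', s'⟩ <;>
    simp [Related, kind, Kind.Indexed]

lemma sameKind_iff (v w : OutVec S N L D) : SameKind v w ↔ v.kind = w.kind := by
  rcases v with i | (_ | σ | k) | ⟨l, s⟩ <;> rcases w with j | (_ | σ' | k') | ⟨l', s'⟩ <;>
    simp [SameKind, kind]

lemma disp_of_related {v w : OutVec S N L D} (h : Related v w) :
    disp v w = (v.idx : ℤ) - w.idx := by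
  rw [disp, if_pos ((related_iff v w).1 h)]

lemma disp_of_not_related {v w : OutVec S N L D} (h : ¬ Related v w) : disp v w = 0 := by
  rw [disp, if_neg (fun h' => h ((related_iff v w).2 h'))]

lemma disp_pos (a b : Idx N) :
    (pos a : OutVec S N L D).disp (pos b) = ((a : ℕ) : ℤ) - (b : ℕ) := disp_of_related trivial

lemma disp_chr (a b : Idx N) :
    (emb (.chr a) : OutVec S N L D).disp (emb (.chr b)) = ((a : ℕ) : ℤ) - (b : ℕ) :=
  disp_of_related trivial

/-- Moving terms across the equation of indices turns a common shift into equality of integer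
differences; for unrelated labels both displacements are `0` by convention, so no condition is left.
This is what allows an invariant function to be stored by kinds and one integer. -/
lemma shiftPair_iff (v w v' w' : OutVec S N L D) :
    ShiftPair v w v' w' ↔ v.kind = v'.kind ∧ w.kind = w'.kind ∧ disp v w = disp v' w' := by
  rw [ShiftPair, sameKind_iff, sameKind_iff, related_iff, disp, disp]
  refine and_congr_right fun hv => and_congr_right fun hw => ?_
  rw [← hv, ← hw]
  by_cases h : v.kind = w.kind ∧ v.kind.Indexed
  · rw [if_pos h, if_pos h]
    constructor
    · intro h'; have := h' h; omega
    · intro h' _; omega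
  · simp [h]

lemma kind_mapUnit (e : Fin D → Fin D') (v w : OutVec S N L D) (h : v.kind = w.kind) :
    (v.mapUnit e).kind = (w.mapUnit e).kind := by
  rcases v with i | (_ | σ | k) | ⟨l, s⟩ <;> rcases w with j | (_ | σ' | k') | ⟨l', s'⟩ <;>
    simp_all [mapUnit, kind]

lemma disp_mapUnit (e : Fin D → Fin D') (v w : OutVec S N L D) :
    disp (v.mapUnit e) (w.mapUnit e) = disp v w := by
  have h : Related (v.mapUnit e) (w.mapUnit e) ↔ Related v w := by
    rcases v with i | (_ | σ | k) | ⟨l, s⟩ <;> rcases w with j | (_ | σ' | k') | ⟨l', s'⟩ <;>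
      simp [mapUnit, Related]
  have hi : ∀ u : OutVec S N L D, (u.mapUnit e).idx = u.idx := by
    rintro (i | (_ | σ | k) | ⟨l, s⟩) <;> rfl
  by_cases hr : Related v w
  · rw [disp_of_related hr, disp_of_related (h.2 hr), hi, hi]
  · rw [disp_of_not_related hr, disp_of_not_related (fun h' => hr (h.1 h'))]

end OutVec

/-! ### Probes, slots and tables of product functions -/

/-- A product function applied to labels, or an entry of a bias. -/
inductive Probe (L Hd D : ℕ) (α β : Type*)
  | attn (l : Fin L) (h : Fin Hd) (C₁ C₂ : Fin L → Option (Fin Hd)) (v w : α) : Probe L Hd D α β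
  | unembed (C : Fin L → Option (Fin Hd)) (ω : β) (w : α) : Probe L Hd D α β
  | mlp (C : Fin L → Option (Fin Hd)) (l : Fin L) (s : Fin D) (w : α) : Probe L Hd D α β
  | bias (l : Fin L) (s : Fin D) : Probe L Hd D α β

namespace Probe

variable {L Hd D D' : ℕ} {α β α' β' : Type*}

/-- Change of labels in a probe. -/
def map (e : Fin D → Fin D') (a : α → α') (b : β → β') : Probe L Hd D α β → Probe L Hd D' α' β'
  | attn l h C₁ C₂ v w => attn l h C₁ C₂ (a v) (a w)
  | unembed C ω w => unembed C (b ω) (a w)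
  | mlp C l s w => mlp C l (e s) (a w)
  | bias l s => bias l (e s)

instance finite [Finite α] [Finite β] : Finite (Probe L Hd D α β) := by
  refine Finite.of_surjective
    (fun z : (Fin L × Fin Hd × (Fin L → Option (Fin Hd)) × (Fin L → Option (Fin Hd)) × α × α) ⊕
        ((Fin L → Option (Fin Hd)) × β × α) ⊕
        ((Fin L → Option (Fin Hd)) × Fin L × Fin D × α) ⊕ (Fin L × Fin D) => (match z with
      | .inl (l, h, C₁, C₂, v, w) => .attn l h C₁ C₂ v w
      | .inr (.inl (C, ω, w)) => .unembed C ω w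
      | .inr (.inr (.inl (C, l, s, w))) => .mlp C l s w
      | .inr (.inr (.inr (l, s))) => .bias l s : Probe L Hd D α β)) ?_
  rintro (⟨l, h, C₁, C₂, v, w⟩ | ⟨C, ω, w⟩ | ⟨C, l, s, w⟩ | ⟨l, s⟩)
  exacts [⟨.inl (l, h, C₁, C₂, v, w), rfl⟩, ⟨.inr (.inl (C, ω, w)), rfl⟩,
    ⟨.inr (.inr (.inl (C, l, s, w))), rfl⟩, ⟨.inr (.inr (.inr (l, s))), rfl⟩]

end Probe

/-- Probes on the labels of a transformer. -/
abbrev LabelProbe (S : Type*) (N : ℕ∞) (L Hd D : ℕ) : Type _ :=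
  Probe L Hd D (OutVec S N L D) (Token S (Idx N))

/-- Probes with all indices forgotten. -/
abbrev Slot (S : Type*) (L Hd D : ℕ) : Type _ := Probe L Hd D (Kind S L D) (Kind S L D)

namespace LabelProbe

variable {S : Type*} {N : ℕ∞} {L Hd D D' : ℕ}

/-- The slot of a probe. -/
def slot (q : LabelProbe S N L Hd D) : Slot S L Hd D :=
  q.map id OutVec.kind (fun ω => (OutVec.emb ω : OutVec S N L D).kind)

/-- The displacement of a probe. -/
def disp : LabelProbe S N L Hd D → ℤ
  | .attn _ _ _ _ v w => v.disp w
  | .unembed _ ω w => (OutVec.emb ω).disp w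
  | _ => 0

end LabelProbe

/-- The weights of a transformer, with its dimensions as parameters. -/
structure Weights (S : Type*) (N : ℕ∞) (H : Type*) [NormedAddCommGroup H] [InnerProductSpace ℝ H]
    (L Hd D : ℕ) where
  rnd : ℕ
  emb : Token S (Idx N) → H
  pos : Idx N → H
  K : Fin L → Fin Hd → H →L[ℝ] H
  Q : Fin L → Fin Hd → H →L[ℝ] H
  V : Fin L → Fin Hd → H →L[ℝ] H
  A : Fin L → H →L[ℝ] EuclideanSpace ℝ (Fin D)
  B : Fin L → EuclideanSpace ℝ (Fin D) →L[ℝ] H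
  b : Fin L → EuclideanSpace ℝ (Fin D)
  act : Fin L → Fin D → Activation
  U : H →L[ℝ] lp (fun _ : Token S (Idx N) => ℝ) ⊤

/-- The transformer with given weights. -/
abbrev Weights.tr {S : Type*} {N : ℕ∞} {H : Type*} [NormedAddCommGroup H] [InnerProductSpace ℝ H]
    {L Hd D : ℕ} (W : Weights S N H L Hd D) : Transformer S N H where
  depth := L
  heads := Hd
  dff := D
  rnd := W.rnd
  emb := W.emb
  pos := W.pos
  K := W.K
  Q := W.Q
  V := W.V
  A := W.A
  B := W.B
  b := W.b
  act := W.act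
  U := W.U

/-- The weights of a transformer. -/
abbrev Transformer.weights {S : Type*} {N : ℕ∞} {H : Type*} [NormedAddCommGroup H]
    [InnerProductSpace ℝ H] (T : Transformer S N H) :
    Weights S N H T.depth T.heads T.dff where
  rnd := T.rnd
  emb := T.emb
  pos := T.pos
  K := T.K
  Q := T.Q
  V := T.V
  A := T.A
  B := T.B
  b := T.b
  act := T.act
  U := T.U

/-- Values of all product functions of a translation-invariant transformer, by slot and
displacement, together with its discrete data. -/
structure Table (S : Type*) (L Hd D : ℕ) where
  rnd : ℕ
  act : Fin L → Fin D → Activation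
  val : Slot S L Hd D → ℤ → ℝ

/-- All entries of a table have `p`-bit precision. -/
def Table.Dyadic {S : Type*} {L Hd D : ℕ} (τ : Table S L Hd D) (p : ℕ) : Prop :=
  ∀ σ δ, IsDyadic p (τ.val σ δ)

/-- The entries of a table vanish at displacements beyond `Δ`. -/
def Table.LocalTo {S : Type*} {L Hd D : ℕ} (τ : Table S L Hd D) (Δ : ℕ) : Prop :=
  ∀ σ δ, (Δ : ℤ) < |δ| → τ.val σ δ = 0

/-- The table cut off at displacements beyond `Δ`. -/
def Table.trunc {S : Type*} {L Hd D : ℕ} (τ : Table S L Hd D) (Δ : ℕ) : Table S L Hd D where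
  rnd := τ.rnd
  act := τ.act
  val σ δ := if |δ| ≤ (Δ : ℤ) then τ.val σ δ else 0

lemma isDyadic_zero (p : ℕ) : IsDyadic p 0 := ⟨0, by simp⟩

lemma Table.Dyadic.trunc {S : Type*} {L Hd D : ℕ} {τ : Table S L Hd D} {p : ℕ}
    (h : τ.Dyadic p) (Δ : ℕ) : (τ.trunc Δ).Dyadic p := by
  intro σ δ
  rw [Table.trunc]
  dsimp only
  split_ifs
  exacts [h σ δ, isDyadic_zero p]

lemma Table.localTo_trunc {S : Type*} {L Hd D : ℕ} (τ : Table S L Hd D) (Δ : ℕ) :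
    (τ.trunc Δ).LocalTo Δ := by
  intro σ δ h
  rw [Table.trunc]
  exact if_neg (not_le.2 h)

namespace Weights

variable {S : Type*} {N : ℕ∞} {H : Type*} [NormedAddCommGroup H] [InnerProductSpace ℝ H]
  {L Hd D : ℕ}

/-- The value of a probe. -/
def eval (W : Weights S N H L Hd D) : LabelProbe S N L Hd D → ℝ
  | .attn l h C₁ C₂ v w => W.tr.prodAttn l h C₁ C₂ v w
  | .unembed C ω w => W.tr.prodUnembed C ω w
  | .mlp C l s w => W.tr.prodMlp C l s w
  | .bias l s => W.b l s

/-- The product functions of `W` at displacements up to `s` are those of the table. -/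
structure Models (W : Weights S N H L Hd D) (τ : Table S L Hd D) (s : ℕ) : Prop where
  rnd : W.rnd = τ.rnd
  act : W.act = τ.act
  val : ∀ q : LabelProbe S N L Hd D, |q.disp| ≤ (s : ℤ) → W.eval q = τ.val q.slot q.disp

/-- Slot and displacement retain exactly what `ShiftPair` and `SameKind` retain. Bias probes add no
condition, since a bias slot already determines the layer and the unit. -/
lemma translationInvariant_iff (W : Weights S N H L Hd D) :
    W.tr.TranslationInvariant ↔
      ∀ q q' : LabelProbe S N L Hd D, q.slot = q'.slot → q.disp = q'.disp →
        W.eval q = W.eval q' := by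
  constructor
  · rintro ⟨h1, h2, h3⟩ q q' hs hd
    rcases q with ⟨l, h, C₁, C₂, v, w⟩ | ⟨C, ω, w⟩ | ⟨C, l, s, w⟩ | ⟨l, s⟩ <;>
    rcases q' with ⟨l', h', C₁', C₂', v', w'⟩ | ⟨C', ω', w'⟩ | ⟨C', l', s', w'⟩ | ⟨l', s'⟩ <;>
    simp only [LabelProbe.slot, Probe.map, Probe.attn.injEq, Probe.unembed.injEq,
      Probe.mlp.injEq, Probe.bias.injEq, reduceCtorEq, id] at hs
    · obtain ⟨rfl, rfl, rfl, rfl, hv, hw⟩ := hs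
      exact h1 _ _ _ _ _ _ _ _ ((OutVec.shiftPair_iff _ _ _ _).2 ⟨hv, hw, hd⟩)
    · obtain ⟨rfl, hv, hw⟩ := hs
      exact h2 _ _ _ _ _ ((OutVec.shiftPair_iff _ _ _ _).2 ⟨hv, hw, hd⟩)
    · obtain ⟨rfl, rfl, rfl, hw⟩ := hs
      exact h3 _ _ _ _ _ ((OutVec.sameKind_iff _ _).2 hw)
    · obtain ⟨rfl, rfl⟩ := hs
      rfl
  · intro h
    refine ⟨fun l a C₁ C₂ v w v' w' hp => ?_, fun C ω w ω' w' hp => ?_, fun C l s w w' hp => ?_⟩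
    · obtain ⟨hv, hw, hd⟩ := (OutVec.shiftPair_iff _ _ _ _).1 hp
      exact h (.attn l a C₁ C₂ v w) (.attn l a C₁ C₂ v' w')
        (by simp [LabelProbe.slot, Probe.map, hv, hw]) hd
    · obtain ⟨hv, hw, hd⟩ := (OutVec.shiftPair_iff _ _ _ _).1 hp
      exact h (.unembed C ω w) (.unembed C ω' w')
        (by simp [LabelProbe.slot, Probe.map, hv, hw]) hd
    · have hw := (OutVec.sameKind_iff _ _).1 hp
      exact h (.mlp C l s w) (.mlp C l s w')
        (by simp [LabelProbe.slot, Probe.map, hw]) rfl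

lemma productsDyadic_iff (W : Weights S N H L Hd D) (p : ℕ) :
    W.tr.ProductsDyadic p ↔ ∀ q, IsDyadic p (W.eval q) := by
  constructor
  · rintro ⟨h1, h2, h3, h4⟩ (⟨l, h, C₁, C₂, v, w⟩ | ⟨C, ω, w⟩ | ⟨C, l, s, w⟩ | ⟨l, s⟩)
    exacts [h1 _ _ _ _ _ _, h2 _ _ _, h3 _ _ _ _, h4 _ _]
  · intro h
    exact ⟨fun l a C₁ C₂ v w => h (.attn l a C₁ C₂ v w), fun C ω w => h (.unembed C ω w),
      fun C l s w => h (.mlp C l s w), fun l s => h (.bias l s)⟩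

/-- A displacement exceeding a natural number in absolute value is nonzero, which forces related
labels; all other probes satisfy the condition vacuously. -/
lemma isLocal_iff (W : Weights S N H L Hd D) :
    W.tr.IsLocal ↔ ∃ Δ : ℕ, ∀ q : LabelProbe S N L Hd D, (Δ : ℤ) < |q.disp| → W.eval q = 0 := by
  refine exists_congr fun Δ => ⟨?_, fun h => ⟨fun l a C₁ C₂ v w hr hd => ?_, fun C ω w hr hd => ?_⟩⟩
  · rintro ⟨h1, h2⟩ (⟨l, h, C₁, C₂, v, w⟩ | ⟨C, ω, w⟩ | ⟨C, l, s, w⟩ | ⟨l, s⟩) hd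
    · by_cases hr : OutVec.Related v w
      · exact h1 _ _ _ _ _ _ hr (by rw [← OutVec.disp_of_related hr]; exact hd)
      · have : (LabelProbe.disp (Probe.attn l h C₁ C₂ v w)) = 0 := OutVec.disp_of_not_related hr
        rw [this] at hd
        simp at hd
        omega
    · by_cases hr : OutVec.Related (.emb ω) w
      · exact h2 _ _ _ hr (by rw [← OutVec.disp_of_related hr]; exact hd)
      · have : (LabelProbe.disp (Probe.unembed C ω w : LabelProbe S N L Hd D)) = 0 :=
          OutVec.disp_of_not_related hr
        rw [this] at hd
        simp at hd
        omega
    · simp [LabelProbe.disp] at hd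
      omega
    · simp [LabelProbe.disp] at hd
      omega
  · exact h (.attn l a C₁ C₂ v w) (by rw [← OutVec.disp_of_related hr] at hd; exact hd)
  · exact h (.unembed C ω w) (by rw [← OutVec.disp_of_related hr] at hd; exact hd)

open Classical in
/-- The table of a translation-invariant transformer; entries without a probe are `0`. -/
def table (W : Weights S N H L Hd D) : Table S L Hd D where
  rnd := W.rnd
  act := W.act
  val σ δ := if h : ∃ q : LabelProbe S N L Hd D, q.slot = σ ∧ q.disp = δ then W.eval h.choose else 0

/-- Any property of `0` and of all probe values passes to the table by these two cases; this is how
precision, locality and size bounds are transferred. -/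
lemma table_val (W : Weights S N H L Hd D) (σ : Slot S L Hd D) (δ : ℤ) :
    W.table.val σ δ = 0 ∨
      ∃ q : LabelProbe S N L Hd D, q.slot = σ ∧ q.disp = δ ∧ W.table.val σ δ = W.eval q := by
  by_cases h : ∃ q : LabelProbe S N L Hd D, q.slot = σ ∧ q.disp = δ
  · right
    exact ⟨h.choose, h.choose_spec.1, h.choose_spec.2, by simp only [table]; rw [dif_pos h]⟩
  · left
    simp only [table]
    rw [dif_neg h]

/-- The table reads each entry off an arbitrarily chosen probe; invariance makes the choice
irrelevant. -/
lemma models_table (W : Weights S N H L Hd D) (hW : W.tr.TranslationInvariant) (s : ℕ) :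
    W.Models W.table s := by
  refine ⟨rfl, rfl, fun q _ => ?_⟩
  have h : ∃ q' : LabelProbe S N L Hd D, q'.slot = q.slot ∧ q'.disp = q.disp := ⟨q, rfl, rfl⟩
  simp only [table]
  rw [dif_pos h]
  exact (translationInvariant_iff W).1 hW _ _ h.choose_spec.1.symm h.choose_spec.2.symm

lemma dyadic_table (W : Weights S N H L Hd D) {p : ℕ} (h : ∀ q, IsDyadic p (W.eval q)) :
    W.table.Dyadic p := by
  intro σ δ
  rcases W.table_val σ δ with h0 | ⟨q, -, -, hq⟩
  · rw [h0]; exact isDyadic_zero p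
  · rw [hq]; exact h q

lemma localTo_table (W : Weights S N H L Hd D) {Δ : ℕ}
    (h : ∀ q : LabelProbe S N L Hd D, (Δ : ℤ) < |q.disp| → W.eval q = 0) :
    W.table.LocalTo Δ := by
  intro σ δ hδ
  rcases W.table_val σ δ with h0 | ⟨q, -, hd, hq⟩
  · exact h0
  · rw [hq]; exact h q (by rw [hd]; exact hδ)

lemma models_trunc {W : Weights S N H L Hd D} {τ : Table S L Hd D} {s : ℕ} (h : W.Models τ s) :
    W.Models (τ.trunc s) s := by
  refine ⟨h.rnd, h.act, fun q hq => ?_⟩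
  rw [h.val q hq, Table.trunc]
  exact (if_pos hq).symm

lemma translationInvariant_of_models {W : Weights S N H L Hd D} {τ : Table S L Hd D}
    (h : ∀ s, W.Models τ s) : W.tr.TranslationInvariant := by
  have hv : ∀ q : LabelProbe S N L Hd D, W.eval q = τ.val q.slot q.disp := fun q =>
    (h q.disp.natAbs).val q (by simp)
  rw [translationInvariant_iff]
  intro q q' hs hd
  rw [hv, hv, hs, hd]

end Weights

/-! ### Runs from arbitrary initial activations -/

namespace Transformer

variable {S : Type*} {N : ℕ∞} {H : Type*} [NormedAddCommGroup H] [InnerProductSpace ℝ H]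

/-- The activations after `l` layers, starting from `y`. -/
def run (T : Transformer S N H) (ε : ℝ) {m : ℕ} (y : Fin m → H) : ℕ → Fin m → H
  | 0 => y
  | l + 1 => if hl : l < T.depth then
      fun i => T.mlpBlock ε ⟨l, hl⟩ (T.attBlock ⟨l, hl⟩ (T.run ε y l) i)
    else T.run ε y l

lemma states_eq_run (T : Transformer S N H) (ε : ℝ) (x : Word S) (op oc l : ℕ) :
    T.states ε x op oc l = T.run ε (T.init x op oc) l := by
  induction l with
  | zero => rfl
  | succ l ih => simp only [states, run, ih]

lemma run_cast (T : Transformer S N H) (ε : ℝ) {m m' : ℕ} (h : m = m') (y : Fin m' → H) (l : ℕ)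
    (i : Fin m) : T.run ε (fun j => y (Fin.cast h j)) l i = T.run ε y l (Fin.cast h i) := by
  subst h; rfl

/-- A chain with one more value matrix, above those already present. -/
lemma chainProd_update (T : Transformer S N H) (C : T.Chain) (l : Fin T.depth) (h : Fin T.heads)
    (hC : ∀ l', l ≤ l' → C l' = none) (z : H) :
    T.chainProd (Function.update C l (some h)) z = T.V l h (T.chainProd C z) := by
  set g : T.Chain → (H →L[ℝ] H) → Fin T.depth → (H →L[ℝ] H) := fun C M l => match C l with
      | none => M
      | some h => (T.V l h).comp M with hg
  have hcp : ∀ C, T.chainProd C =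
      (List.finRange T.depth).foldl (g C) (ContinuousLinearMap.id ℝ H) := fun C => rfl
  -- The product is cut at layer `l`. Below the cut the updated chain agrees with `C`; above it both
  -- chains are empty, so the new matrix ends up outermost.
  have hsplit : List.finRange T.depth =
      (List.finRange T.depth).take l ++ l :: (List.finRange T.depth).drop (l + 1) := by
    have hl : (l : ℕ) < (List.finRange T.depth).length := by simp
    have h2 := List.getElem_cons_drop hl
    rw [List.getElem_finRange] at h2
    conv_lhs => rw [← List.take_append_drop (l : ℕ) (List.finRange T.depth)]
    rw [← h2]
    simp
  have htake : ∀ a ∈ (List.finRange T.depth).take l, a < l := by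
    intro a ha
    obtain ⟨k, hk, rfl⟩ := List.mem_iff_getElem.1 ha
    simp only [List.getElem_take, List.getElem_finRange]
    simp at hk
    exact Fin.lt_def.2 (by simp; omega)
  have hdrop : ∀ a ∈ (List.finRange T.depth).drop (l + 1), l < a := by
    intro a ha
    obtain ⟨k, hk, rfl⟩ := List.mem_iff_getElem.1 ha
    simp only [List.getElem_drop, List.getElem_finRange]
    exact Fin.lt_def.2 (by simp; omega)
  have hfix : ∀ (t : List (Fin T.depth)) (C : T.Chain) (M : H →L[ℝ] H), (∀ a ∈ t, C a = none) →
      t.foldl (g C) M = M := by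
    intro t C
    induction t with
    | nil => intros; rfl
    | cons a t ih =>
      intro M ht
      rw [List.foldl_cons, ih _ fun b hb => ht b (List.mem_cons_of_mem _ hb)]
      simp [hg, ht a List.mem_cons_self]
  have hcongr : ∀ (t : List (Fin T.depth)) (C C' : T.Chain) (M : H →L[ℝ] H),
      (∀ a ∈ t, C a = C' a) → t.foldl (g C) M = t.foldl (g C') M := by
    intro t C C'
    induction t with
    | nil => intros; rfl
    | cons a t ih =>
      intro M ht
      rw [List.foldl_cons, List.foldl_cons, ih _ fun b hb => ht b (List.mem_cons_of_mem _ hb)]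
      simp [hg, ht a List.mem_cons_self]
  rw [hcp, hcp, hsplit, List.foldl_append, List.foldl_append, List.foldl_cons, List.foldl_cons,
    hfix _ _ _ (fun a ha => ?_), hfix _ _ _ (fun a ha => hC a (hdrop a ha).le),
    hcongr _ (Function.update C l (some h)) C _ (fun a ha => ?_)]
  · simp [hg, hC l le_rfl]
  · rw [Function.update_of_ne (htake a ha).ne]
  · rw [Function.update_of_ne (hdrop a ha).ne', hC a (hdrop a ha).le]

lemma chainProd_none (T : Transformer S N H) (z : H) : T.chainProd (fun _ => none) z = z := by
  have : ∀ (t : List (Fin T.depth)) (M : H →L[ℝ] H), t.foldl (fun M _ => M) M = M := by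
    intro t
    induction t with
    | nil => intros; rfl
    | cons a t ih => intro M; exact ih M
  change (List.foldl _ _ _ : H →L[ℝ] H) z = z
  rw [this]
  rfl

end Transformer

/-! ### Transformers with the same table compute the same logits -/

namespace Weights

variable {S : Type*} {N N' : ℕ∞} {H H' : Type*} [NormedAddCommGroup H] [InnerProductSpace ℝ H]
  [NormedAddCommGroup H'] [InnerProductSpace ℝ H'] {L Hd D : ℕ}

/-- Joint linear combinations of the images, in two transformers, of corresponding labels under
products of value matrices from the lowest `l` layers. -/
def jointSpan (W : Weights S N H L Hd D) (W' : Weights S N' H' L Hd D)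
    (R : OutVec S N L D → OutVec S N' L D → Prop) (l : ℕ) : Submodule ℝ (H × H') :=
  Submodule.span ℝ {z | ∃ (C : Fin L → Option (Fin Hd)) (v : OutVec S N L D)
    (v' : OutVec S N' L D), R v v' ∧ (∀ l' : Fin L, l ≤ l' → C l' = none) ∧
    z = (W.tr.chainProd C (W.tr.vec v), W'.tr.chainProd C (W'.tr.vec v'))}

variable {W : Weights S N H L Hd D} {W' : Weights S N' H' L Hd D}
  {R : OutVec S N L D → OutVec S N' L D → Prop}

lemma jointSpan_mono {l m : ℕ} (h : l ≤ m) : jointSpan W W' R l ≤ jointSpan W W' R m := by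
  refine Submodule.span_mono ?_
  rintro z ⟨C, v, v', hv, hC, rfl⟩
  exact ⟨C, v, v', hv, fun l' hl' => hC l' (h.trans hl'), rfl⟩

lemma vec_mem_jointSpan {v : OutVec S N L D} {v' : OutVec S N' L D} (h : R v v') (l : ℕ) :
    (W.tr.vec v, W'.tr.vec v') ∈ jointSpan W W' R l :=
  Submodule.subset_span ⟨fun _ => none, v, v', h, fun _ _ => rfl, by
    rw [Transformer.chainProd_none, Transformer.chainProd_none]⟩

/-- A generator at level `l` uses no value matrix of layer `l` or higher, so the new one goes on top
and the chain still uses each layer at most once. This is why products with increasing layers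
suffice. -/
lemma value_mem_jointSpan {l : Fin L} (h : Fin Hd) {z : H × H'}
    (hz : z ∈ jointSpan W W' R l) : (W.V l h z.1, W'.V l h z.2) ∈ jointSpan W W' R (l + 1) := by
  refine Submodule.span_induction (p := fun z _ =>
    (W.V l h z.1, W'.V l h z.2) ∈ jointSpan W W' R (l + 1)) ?_ ?_ ?_ ?_ hz
  · rintro z ⟨C, v, v', hv, hC, rfl⟩
    refine Submodule.subset_span ⟨Function.update C l (some h), v, v', hv, fun l' hl' => ?_, ?_⟩
    · have hne : l' ≠ l := fun e => by subst e; omega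
      rw [Function.update_of_ne hne]
      exact hC l' (by omega)
    · rw [Transformer.chainProd_update W.tr C l h (fun l' hl' => hC l' hl'),
        Transformer.chainProd_update W'.tr C l h (fun l' hl' => hC l' hl')]
  · simp only [Prod.fst_zero, Prod.snd_zero, map_zero]
    exact Submodule.zero_mem _
  · intro a b _ _ ha hb
    simpa using Submodule.add_mem _ ha hb
  · intro c a _ ha
    simpa using Submodule.smul_mem _ c ha

/-- Membership in the joint span means that both components are the same combination of
corresponding generators; by bilinearity the two forms need only be compared on generators. -/
lemma attn_eq_of_mem_jointSpan {l : Fin L} {h : Fin Hd}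
    (hR : ∀ C₁ C₂ v v' w w', R v v' → R w w' →
      W.tr.prodAttn l h C₁ C₂ v w = W'.tr.prodAttn l h C₁ C₂ v' w')
    {m : ℕ} {y z : H × H'} (hy : y ∈ jointSpan W W' R m) (hz : z ∈ jointSpan W W' R m) :
    inner ℝ (W.K l h y.1) (W.Q l h z.1) = inner ℝ (W'.K l h y.2) (W'.Q l h z.2) := by
  refine Submodule.span_induction (p := fun y _ =>
    inner ℝ (W.K l h y.1) (W.Q l h z.1) = inner ℝ (W'.K l h y.2) (W'.Q l h z.2)) ?_ ?_ ?_ ?_ hy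
  · rintro y ⟨C₁, v, v', hv, -, rfl⟩
    refine Submodule.span_induction (p := fun z _ =>
      inner ℝ (W.K l h (W.tr.chainProd C₁ (W.tr.vec v))) (W.Q l h z.1) =
        inner ℝ (W'.K l h (W'.tr.chainProd C₁ (W'.tr.vec v'))) (W'.Q l h z.2)) ?_ ?_ ?_ ?_ hz
    · rintro z ⟨C₂, w, w', hw, -, rfl⟩
      exact hR C₁ C₂ v v' w w' hv hw
    · simp
    · intro a b _ _ ha hb
      simp only [Prod.fst_add, Prod.snd_add, map_add, inner_add_right, ha, hb]
    · intro c a _ ha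
      simp only [Prod.smul_fst, Prod.smul_snd, map_smul, inner_smul_right, ha]
  · simp
  · intro a b _ _ ha hb
    simp only [Prod.fst_add, Prod.snd_add, map_add, inner_add_left, ha, hb]
  · intro c a _ ha
    simp only [Prod.smul_fst, Prod.smul_snd, map_smul, inner_smul_left, ha]

/-- Linear functionals that agree on corresponding labels agree on joint combinations. -/
lemma functional_eq_of_mem_jointSpan {F : H →ₗ[ℝ] ℝ} {F' : H' →ₗ[ℝ] ℝ}
    (hF : ∀ C v v', R v v' →
      F (W.tr.chainProd C (W.tr.vec v)) = F' (W'.tr.chainProd C (W'.tr.vec v')))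
    {m : ℕ} {y : H × H'} (hy : y ∈ jointSpan W W' R m) : F y.1 = F' y.2 := by
  refine Submodule.span_induction (p := fun y _ => F y.1 = F' y.2) ?_ ?_ ?_ ?_ hy
  · rintro y ⟨C, v, v', hv, -, rfl⟩
    exact hF C v v' hv
  · simp
  · intro a b _ _ ha hb
    simp [ha, hb]
  · intro c a _ ha
    simp [ha]

/-- Product functions agree on corresponding labels. -/
structure Agree (W : Weights S N H L Hd D) (W' : Weights S N' H' L Hd D)
    (R : OutVec S N L D → OutVec S N' L D → Prop) : Prop where
  rnd : W.rnd = W'.rnd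
  act : W.act = W'.act
  bias : ∀ l s, W.b l s = W'.b l s
  unit : ∀ l s, R (.mlp l s) (.mlp l s)
  attn : ∀ l h C₁ C₂ v v' w w', R v v' → R w w' →
    W.tr.prodAttn l h C₁ C₂ v w = W'.tr.prodAttn l h C₁ C₂ v' w'
  mlp : ∀ C l s v v', R v v' → W.tr.prodMlp C l s v = W'.tr.prodMlp C l s v'

/-- The pair of states remains a joint combination through a layer, because the scalars used by the
layer coincide: attention weights by bilinearity, hidden activations by linearity of the rows of
`A`. The vectors that are added are value matrices applied to earlier joint combinations, and
columns of `B`, which are generators. -/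
lemma run_mem_jointSpan (hA : Agree W W' R) (ε : ℝ) {m : ℕ} {y : Fin m → H} {y' : Fin m → H'}
    (hy : ∀ i, (y i, y' i) ∈ jointSpan W W' R 0) (l : ℕ) (i : Fin m) :
    (W.tr.run ε y l i, W'.tr.run ε y' l i) ∈ jointSpan W W' R l := by
  induction l generalizing i with
  | zero => exact hy i
  | succ l ih =>
    by_cases hl : l < L
    swap
    · simp only [Transformer.run, dif_neg hl]
      exact jointSpan_mono (Nat.le_succ l) (ih i)
    simp only [Transformer.run, dif_pos hl]
    set u := W.tr.run ε y l
    set u' := W'.tr.run ε y' l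
    have hw : ∀ h i j, W.tr.attWeight ⟨l, hl⟩ h u i j = W'.tr.attWeight ⟨l, hl⟩ h u' i j := by
      intro h i j
      have := attn_eq_of_mem_jointSpan (hA.attn ⟨l, hl⟩ h) (ih j) (ih i)
      simp only [Transformer.attWeight, Transformer.attLogit, hA.rnd]
      rw [this]
    have hatt : (W.tr.attBlock ⟨l, hl⟩ u i, W'.tr.attBlock ⟨l, hl⟩ u' i) ∈
        jointSpan W W' R (l + 1) := by
      have he : (W.tr.attBlock ⟨l, hl⟩ u i, W'.tr.attBlock ⟨l, hl⟩ u' i) = (u i, u' i) +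
          ∑ h : Fin Hd, (∑ j ∈ Finset.Iic i, W.tr.attWeight ⟨l, hl⟩ h u i j)⁻¹ •
            ∑ j ∈ Finset.Iic i, W.tr.attWeight ⟨l, hl⟩ h u i j •
              (W.V ⟨l, hl⟩ h (u j), W'.V ⟨l, hl⟩ h (u' j)) := by
        ext
        · simp [Transformer.attBlock, Prod.fst_sum]
        · simp [Transformer.attBlock, Prod.snd_sum, hw]
      rw [he]
      refine Submodule.add_mem _ (jointSpan_mono (Nat.le_succ l) (ih i)) ?_
      refine Submodule.sum_mem _ fun h _ => Submodule.smul_mem _ _ ?_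
      exact Submodule.sum_mem _ fun j _ => Submodule.smul_mem _ _
        (value_mem_jointSpan (l := ⟨l, hl⟩) h (ih j))
    set z := W.tr.attBlock ⟨l, hl⟩ u i
    set z' := W'.tr.attBlock ⟨l, hl⟩ u' i
    have hz : ∀ s, W.A ⟨l, hl⟩ z s = W'.A ⟨l, hl⟩ z' s := fun s =>
      functional_eq_of_mem_jointSpan
        (F := ((EuclideanSpace.proj s : EuclideanSpace ℝ (Fin D) →L[ℝ] ℝ).comp
          (W.A ⟨l, hl⟩)).toLinearMap)
        (F' := ((EuclideanSpace.proj s : EuclideanSpace ℝ (Fin D) →L[ℝ] ℝ).comp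
          (W'.A ⟨l, hl⟩)).toLinearMap)
        (fun C v v' hv => hA.mlp C ⟨l, hl⟩ s v v' hv) hatt
    set c : Fin D → ℝ := fun s => (W.act ⟨l, hl⟩ s).eval ε ((W.A ⟨l, hl⟩ z + W.b ⟨l, hl⟩) s)
    have hc : c = fun s => (W'.act ⟨l, hl⟩ s).eval ε ((W'.A ⟨l, hl⟩ z' + W'.b ⟨l, hl⟩) s) := by
      funext s
      simp only [c, PiLp.add_apply, hz, hA.bias, hA.act]
    -- Expanding the activation vector in unit vectors exhibits the MLP output as a combination of
    -- columns of `B` with the coefficients `c` common to both transformers.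
    have hsum : (WithLp.toLp 2 c : EuclideanSpace ℝ (Fin D)) =
        ∑ s, c s • EuclideanSpace.single s (1 : ℝ) := by
      ext t
      simp [Finset.sum_apply, Pi.single_apply]
    have he : (W.tr.mlpBlock ε ⟨l, hl⟩ z, W'.tr.mlpBlock ε ⟨l, hl⟩ z') = (z, z') +
        ∑ s, c s • (W.tr.vec (.mlp ⟨l, hl⟩ s), W'.tr.vec (.mlp ⟨l, hl⟩ s)) := by
      ext
      · change z + W.B ⟨l, hl⟩ (WithLp.toLp 2 c) = _
        rw [hsum]
        simp [Prod.fst_sum, Transformer.vec]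
      · change z' + W'.B ⟨l, hl⟩ (WithLp.toLp 2 fun s =>
          (W'.act ⟨l, hl⟩ s).eval ε ((W'.A ⟨l, hl⟩ z' + W'.b ⟨l, hl⟩) s)) = _
        rw [← hc, hsum]
        simp [Prod.snd_sum, Transformer.vec]
    rw [he]
    exact Submodule.add_mem _ hatt (Submodule.sum_mem _ fun s _ => Submodule.smul_mem _ _
      (vec_mem_jointSpan (hA.unit _ s) _))

/-- Corresponding symbols of two inputs, together with the output symbols. -/
structure SameInput {m : ℕ} (s : ℕ) (L D : ℕ) (tl : Fin m → Token S (Idx N)) (pl : Fin m → Idx N)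
    (tl' : Fin m → Token S (Idx N')) (pl' : Fin m → Idx N') (ω : Token S (Idx N))
    (ω' : Token S (Idx N')) : Prop where
  pos : ∀ i j, ((pl i : ℕ) : ℤ) - (pl j : ℕ) = ((pl' i : ℕ) : ℤ) - (pl' j : ℕ)
  pos_le : ∀ i j, |((pl i : ℕ) : ℤ) - (pl j : ℕ)| ≤ s
  kind : ∀ i, (OutVec.emb (tl i) : OutVec S N L D).kind = (OutVec.emb (tl' i)).kind
  kind_out : (OutVec.emb ω : OutVec S N L D).kind = (OutVec.emb ω').kind
  disp : ∀ i j, (OutVec.emb (tl i) : OutVec S N L D).disp (.emb (tl j)) =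
    (OutVec.emb (tl' i) : OutVec S N' L D).disp (.emb (tl' j))
  disp_le : ∀ i j, |(OutVec.emb (tl i) : OutVec S N L D).disp (.emb (tl j))| ≤ s
  disp_out : ∀ j, (OutVec.emb ω : OutVec S N L D).disp (.emb (tl j)) =
    (OutVec.emb ω' : OutVec S N' L D).disp (.emb (tl' j))
  disp_out_le : ∀ j, |(OutVec.emb ω : OutVec S N L D).disp (.emb (tl j))| ≤ s

/-- Two transformers that are described by the same table, up to the displacements that occur, give
the same logits. -/
theorem logit_eq_of_models {τ : Table S L Hd D} {s : ℕ} (hW : W.Models τ s) (hW' : W'.Models τ s)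
    {m : ℕ} {tl : Fin m → Token S (Idx N)} {pl : Fin m → Idx N}
    {tl' : Fin m → Token S (Idx N')} {pl' : Fin m → Idx N'} {ω : Token S (Idx N)}
    {ω' : Token S (Idx N')} (hin : SameInput s L D tl pl tl' pl' ω ω') (ε : ℝ) (l : ℕ)
    (i : Fin m) :
    W.U (W.tr.run ε (fun i => W.emb (tl i) + W.pos (pl i)) l i) ω =
      W'.U (W'.tr.run ε (fun i => W'.emb (tl' i) + W'.pos (pl' i)) l i) ω' := by
  -- Only labels that occur at the same place of the two inputs are paired. The tables describe the
  -- transformers up to displacement `s` only, and just these labels are known to stay within that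
  -- range.
  set R : OutVec S N L D → OutVec S N' L D → Prop := fun v v' =>
    (∃ i, v = .pos (pl i) ∧ v' = .pos (pl' i)) ∨ (∃ i, v = .emb (tl i) ∧ v' = .emb (tl' i)) ∨
      ∃ l s, v = .mlp l s ∧ v' = .mlp l s with hR
  have hkind : ∀ {v v'}, R v v' → v.kind = v'.kind := by
    rintro v v' (⟨i, rfl, rfl⟩ | ⟨i, rfl, rfl⟩ | ⟨l, s, rfl, rfl⟩)
    exacts [rfl, hin.kind i, rfl]
  have h0 : ∀ {M : ℕ∞} {v w : OutVec S M L D}, ¬ OutVec.Related v w → v.disp w = 0 :=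
    OutVec.disp_of_not_related
  have hmix : ∀ {M : ℕ∞} (a : Idx M) (t : Token S (Idx M)),
      (OutVec.pos a : OutVec S M L D).disp (.emb t) = 0 ∧
      (OutVec.emb t : OutVec S M L D).disp (.pos a) = 0 := by
    rintro M a (_ | σ | k) <;> exact ⟨h0 id, h0 id⟩
  have hml : ∀ {M : ℕ∞} (v : OutVec S M L D) (l : Fin L) (s : Fin D),
      v.disp (.mlp l s) = 0 ∧ (OutVec.mlp l s).disp v = 0 := by
    rintro M (a | (_ | σ | k) | ⟨l, s⟩) l' s' <;> exact ⟨h0 id, h0 id⟩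
  have hdisp : ∀ {v v' w w'}, R v v' → R w w' → v.disp w = v'.disp w' ∧ |v.disp w| ≤ s := by
    rintro v v' w w' (⟨i, rfl, rfl⟩ | ⟨i, rfl, rfl⟩ | ⟨l, s, rfl, rfl⟩)
      (⟨j, rfl, rfl⟩ | ⟨j, rfl, rfl⟩ | ⟨l', s', rfl, rfl⟩)
    · rw [OutVec.disp_pos, OutVec.disp_pos]; exact ⟨hin.pos i j, hin.pos_le i j⟩
    · simp [(hmix _ _).1]
    · simp [(hml _ _ _).1]
    · simp [(hmix _ _).2]
    · exact ⟨hin.disp i j, hin.disp_le i j⟩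
    · simp [(hml _ _ _).1]
    · simp [(hml _ _ _).2]
    · simp [(hml _ _ _).2]
    · simp [(hml _ _ _).2]
  have hout : ∀ {w w'}, R w w' → (OutVec.emb ω : OutVec S N L D).disp w =
      (OutVec.emb ω' : OutVec S N' L D).disp w' ∧
      |(OutVec.emb ω : OutVec S N L D).disp w| ≤ s := by
    rintro w w' (⟨j, rfl, rfl⟩ | ⟨j, rfl, rfl⟩ | ⟨l', s', rfl, rfl⟩)
    · simp [(hmix _ _).2]
    · exact ⟨hin.disp_out j, hin.disp_out_le j⟩
    · simp [(hml _ _ _).1]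
  have hA : Agree W W' R := by
    refine ⟨hW.rnd.trans hW'.rnd.symm, hW.act.trans hW'.act.symm, fun l s => ?_,
      fun l s => .inr (.inr ⟨l, s, rfl, rfl⟩), fun l h C₁ C₂ v v' w w' hv hw => ?_,
      fun C l s v v' hv => ?_⟩
    · exact (hW.val (.bias l s) (by simp [LabelProbe.disp])).trans
        (hW'.val (.bias l s) (by simp [LabelProbe.disp])).symm
    · obtain ⟨h1, h2⟩ := hdisp hv hw
      have e := hW.val (.attn l h C₁ C₂ v w) h2
      have e' := hW'.val (.attn l h C₁ C₂ v' w') (by rw [h1] at h2; exact h2)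
      simp only [eval, LabelProbe.slot, Probe.map, LabelProbe.disp] at e e'
      rw [e, e', h1, hkind hv, hkind hw]
    · have e := hW.val (.mlp C l s v) (by simp [LabelProbe.disp])
      have e' := hW'.val (.mlp C l s v') (by simp [LabelProbe.disp])
      simp only [eval, LabelProbe.slot, Probe.map, LabelProbe.disp] at e e'
      rw [e, e', hkind hv]
  refine functional_eq_of_mem_jointSpan (R := R) (W := W) (W' := W')
    (F := { toFun := fun z => W.U z ω, map_add' := by simp, map_smul' := by simp })
    (F' := { toFun := fun z => W'.U z ω', map_add' := by simp, map_smul' := by simp })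
    (fun C w w' hw => ?_) (run_mem_jointSpan hA ε (fun i => ?_) l i)
  · obtain ⟨h1, h2⟩ := hout hw
    have e := hW.val (.unembed C ω w) h2
    have e' := hW'.val (.unembed C ω' w') (by rw [h1] at h2; exact h2)
    simp only [eval, LabelProbe.slot, Probe.map, LabelProbe.disp] at e e'
    change W.tr.prodUnembed C ω w = W'.tr.prodUnembed C ω' w'
    rw [e, e', h1, hkind hw, hin.kind_out]
  · exact Submodule.add_mem _
      (vec_mem_jointSpan (v := .emb (tl i)) (v' := .emb (tl' i)) (.inr (.inl ⟨i, rfl, rfl⟩)) 0)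
      (vec_mem_jointSpan (v := .pos (pl i)) (v' := .pos (pl' i)) (.inl ⟨i, rfl, rfl⟩) 0)

end Weights

/-! ### Inputs at offsets -/

namespace Token

variable {S : Type*}

/-- The kind of a symbol. -/
def kind (L D : ℕ) : Token S ℕ → Kind S L D
  | start => .start
  | fin σ => .fin σ
  | chr _ => .chr

/-- The difference of the indices of two extended characters, and `0` for other symbols. -/
def disp : Token S ℕ → Token S ℕ → ℤ
  | chr k, chr k' => (k : ℤ) - k'
  | _, _ => 0

end Token

section

variable {S : Type*} {N : ℕ∞}

lemma kind_of_shiftTok {o : ℕ} {a : Token S ℕ} {a' : Token S (Idx N)}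
    (h : shiftTok N o a = some a') (L D : ℕ) :
    (OutVec.emb a' : OutVec S N L D).kind = a.kind L D := by
  rcases a with _ | σ | k
  · simp only [shiftTok, Option.some.injEq] at h; subst h; rfl
  · simp only [shiftTok, Option.some.injEq] at h; subst h; rfl
  · simp only [shiftTok] at h
    split_ifs at h with hk
    simp only [Option.some.injEq] at h; subst h; rfl

lemma disp_of_shiftTok {o : ℕ} {a b : Token S ℕ} {a' b' : Token S (Idx N)}
    (ha : shiftTok N o a = some a') (hb : shiftTok N o b = some b') (L D : ℕ) :
    (OutVec.emb a' : OutVec S N L D).disp (.emb b') = a.disp b := by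
  have h0 : ∀ {v w : OutVec S N L D}, ¬ OutVec.Related v w → v.disp w = 0 :=
    OutVec.disp_of_not_related
  rcases a with _ | σ | k <;> rcases b with _ | σ' | k' <;>
    simp only [shiftTok, Option.some.injEq] at ha hb
  all_goals
    first
    | (subst ha; subst hb; exact h0 id)
    | (subst ha; split_ifs at hb; simp only [Option.some.injEq] at hb; subst hb; exact h0 id)
    | (subst hb; split_ifs at ha; simp only [Option.some.injEq] at ha; subst ha; exact h0 id)
    | (split_ifs at ha hb
       simp only [Option.some.injEq] at ha hb
       subst ha; subst hb
       rw [OutVec.disp_of_related (by trivial)]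
       simp [OutVec.idx, Token.disp])

lemma mem_of_symAt {x : Word S} {i : Fin (strLen x)} {k : ℕ} (h : symAt x i = .chr k) :
    Sum.inr k ∈ x := by
  induction i using Fin.cases with
  | zero => cases h
  | succ j =>
    change (match x.get j with
      | Sum.inl σ => Token.fin σ
      | Sum.inr k => Token.chr k) = Token.chr k at h
    have hj := List.get_mem x j
    generalize x.get j = u at h hj
    rcases u with σ | k'
    · cases h
    · cases h; exact hj

/-- The input fits into the context at the given offsets. -/
structure Fits (x : Word S) (N : ℕ∞) (op oc : ℕ) : Prop where
  pos : ((strLen x + op : ℕ) : ℕ∞) ≤ N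
  chr : ∀ k, Sum.inr k ∈ x → ((k + oc : ℕ) : ℕ∞) < N

lemma Fits.pos_lt {x : Word S} {op oc : ℕ} (h : Fits x N op oc) (i : Fin (strLen x)) :
    ((i + op : ℕ) : ℕ∞) < N := by
  refine lt_of_lt_of_le ?_ h.pos
  exact_mod_cast Nat.add_lt_add_right i.isLt op

lemma Fits.exists_token {x : Word S} {op oc : ℕ} (h : Fits x N op oc) (i : Fin (strLen x)) :
    ∃ a, shiftTok N oc (symAt x i) = some a := by
  rcases hx : symAt x i with _ | σ | k
  · exact ⟨_, rfl⟩
  · exact ⟨_, rfl⟩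
  · have := h.chr k (mem_of_symAt hx)
    simp only [shiftTok]
    rw [dif_pos this]
    exact ⟨_, rfl⟩

variable {H : Type*} [NormedAddCommGroup H] [InnerProductSpace ℝ H]

lemma Transformer.embAt_of_shiftTok (T : Transformer S N H) {o : ℕ} {a : Token S ℕ}
    {a' : Token S (Idx N)} (h : shiftTok N o a = some a') : T.embAt o a = T.emb a' := by
  rw [embAt, h]

lemma Transformer.posAt_of_lt (T : Transformer S N H) {i : ℕ} (h : (i : ℕ∞) < N) :
    T.posAt i = T.pos ⟨i, h⟩ := dif_pos h

lemma Token.disp_le {x : Word S} {ω : Token S ℕ} {s : ℕ}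
    (hle : ∀ k k', (Sum.inr k ∈ x ∨ ω = .chr k) → (Sum.inr k' ∈ x ∨ ω = .chr k') → k ≤ k' + s)
    {a b : Token S ℕ} (ha : ∀ k, a = .chr k → (Sum.inr k ∈ x ∨ ω = .chr k))
    (hb : ∀ k, b = .chr k → (Sum.inr k ∈ x ∨ ω = .chr k)) : |a.disp b| ≤ s := by
  rcases a with _ | σ | k <;> rcases b with _ | σ' | k' <;> try simp [Token.disp]
  have h1 := hle _ _ (ha k rfl) (hb k' rfl)
  have h2 := hle _ _ (hb k' rfl) (ha k rfl)
  rw [abs_le]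
  constructor <;> omega

variable {N' : ℕ∞} {H' : Type*} [NormedAddCommGroup H'] [InnerProductSpace ℝ H'] {L Hd D : ℕ}

/-- Two transformers that are described by the same table give the same logits on inputs that
differ by a shift of the characters. -/
theorem logits_eq_of_models_of_shift {W : Weights S N H L Hd D} {W' : Weights S N' H' L Hd D}
    {τ : Table S L Hd D} {s : ℕ} (hW : W.Models τ s) (hW' : W'.Models τ s) (ε : ℝ)
    {x x' : Word S} (hlen : strLen x = strLen x') {op oc op' oc' : ℕ} (hf : Fits x N op oc)
    (hf' : Fits x' N' op' oc') {ω ω' : Token S ℕ} {a : Token S (Idx N)} {a' : Token S (Idx N')}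
    (ha : shiftTok N oc ω = some a) (ha' : shiftTok N' oc' ω' = some a')
    (hk : ∀ i, (symAt x i).kind L D = (symAt x' (Fin.cast hlen i)).kind L D)
    (hd : ∀ i j, (symAt x i).disp (symAt x j) =
      (symAt x' (Fin.cast hlen i)).disp (symAt x' (Fin.cast hlen j)))
    (hkω : ω.kind L D = ω'.kind L D)
    (hdω : ∀ j, ω.disp (symAt x j) = ω'.disp (symAt x' (Fin.cast hlen j)))
    (hs : strLen x ≤ s)
    (hle : ∀ k k', (Sum.inr k ∈ x ∨ ω = .chr k) → (Sum.inr k' ∈ x ∨ ω = .chr k') → k ≤ k' + s)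
    (i : Fin (strLen x)) :
    W.tr.logits ε x op oc i a = W'.tr.logits ε x' op' oc' (Fin.cast hlen i) a' := by
  choose tl htl using fun i => hf.exists_token i
  choose tl' htl' using fun i => hf'.exists_token i
  have hin : Weights.SameInput s L D tl (fun i => ⟨i + op, hf.pos_lt i⟩)
      (fun i => tl' (Fin.cast hlen i))
      (fun i => ⟨Fin.cast hlen i + op', hf'.pos_lt (Fin.cast hlen i)⟩) a a' := by
    refine ⟨fun i j => ?_, fun i j => ?_, fun i => ?_, ?_, fun i j => ?_, fun i j => ?_,
      fun j => ?_, fun j => ?_⟩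
    · simp
    · have := i.isLt
      have := j.isLt
      rw [abs_le]
      constructor <;> push_cast <;> omega
    · rw [kind_of_shiftTok (htl i), kind_of_shiftTok (htl' _), hk]
    · rw [kind_of_shiftTok ha, kind_of_shiftTok ha', hkω]
    · rw [disp_of_shiftTok (htl i) (htl j), disp_of_shiftTok (htl' _) (htl' _), hd]
    · rw [disp_of_shiftTok (htl i) (htl j)]
      exact Token.disp_le hle (fun k hk => .inl (mem_of_symAt hk))
        (fun k hk => .inl (mem_of_symAt hk))
    · rw [disp_of_shiftTok ha (htl j), disp_of_shiftTok ha' (htl' _), hdω]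
    · rw [disp_of_shiftTok ha (htl j)]
      exact Token.disp_le hle (fun k hk => .inr hk) (fun k hk => .inl (mem_of_symAt hk))
  have key := Weights.logit_eq_of_models hW hW' hin ε L i
  have h1 : W.tr.init x op oc = fun i => W.emb (tl i) + W.pos ⟨i + op, hf.pos_lt i⟩ := by
    funext i
    rw [Transformer.init, W.tr.embAt_of_shiftTok (htl i), W.tr.posAt_of_lt (hf.pos_lt i)]
  have h2 : W'.tr.init x' op' oc' = fun i => W'.emb (tl' i) + W'.pos ⟨i + op', hf'.pos_lt i⟩ := by
    funext i
    rw [Transformer.init, W'.tr.embAt_of_shiftTok (htl' i), W'.tr.posAt_of_lt (hf'.pos_lt i)]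
  rw [Transformer.logits, Transformer.logits, Transformer.states_eq_run,
    Transformer.states_eq_run, h1, h2]
  refine key.trans ?_
  rw [← Transformer.run_cast]

/-- For one and the same word, offsets and context widths play no role, since they cancel in all
differences of indices. -/
theorem logits_eq_of_models {W : Weights S N H L Hd D} {W' : Weights S N' H' L Hd D}
    {τ : Table S L Hd D} {s : ℕ} (hW : W.Models τ s) (hW' : W'.Models τ s) (ε : ℝ)
    {x : Word S} {op oc op' oc' : ℕ} (hf : Fits x N op oc)
    (hf' : Fits x N' op' oc') {ω : Token S ℕ} {a : Token S (Idx N)} {a' : Token S (Idx N')}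
    (ha : shiftTok N oc ω = some a) (ha' : shiftTok N' oc' ω = some a') (hs : strLen x ≤ s)
    (hle : ∀ k k', (Sum.inr k ∈ x ∨ ω = .chr k) → (Sum.inr k' ∈ x ∨ ω = .chr k') → k ≤ k' + s)
    (i : Fin (strLen x)) :
    W.tr.logits ε x op oc i a = W'.tr.logits ε x op' oc' i a' :=
  logits_eq_of_models_of_shift hW hW' ε rfl hf hf' ha ha' (fun _ => rfl) (fun _ _ => rfl) rfl
    (fun _ => rfl) hs hle i

/-- A character offset has the same effect as a shift of the characters of the input. -/
lemma Transformer.logits_cast (T : Transformer S N H) (ε : ℝ) {x x' : Word S}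
    (hlen : strLen x = strLen x') (op : ℕ) {oc oc' : ℕ}
    (h : ∀ i, shiftTok N oc (symAt x i) = shiftTok N oc' (symAt x' (Fin.cast hlen i)))
    (i : Fin (strLen x)) : T.logits ε x op oc i = T.logits ε x' op oc' (Fin.cast hlen i) := by
  have hinit : T.init x op oc = fun j => T.init x' op oc' (Fin.cast hlen j) := by
    funext j
    rw [init, init, embAt, embAt, h j]
    rfl
  funext a
  rw [logits, logits, states_eq_run, states_eq_run, ← run_cast T ε hlen, hinit]

end

/-! ### Partial permutations of a Hilbert basis -/

section PartialPerm

variable {J : Type*}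

/-- A partial injection of the index set acts on square-summable families without increasing
norms. -/
lemma exists_lp_partialPerm (σ : J → Option J)
    (hσ : ∀ i i' j, σ i = some j → σ i' = some j → i = i') :
    ∃ W : lp (fun _ : J => ℝ) 2 →L[ℝ] lp (fun _ : J => ℝ) 2, ‖W‖ ≤ 1 ∧
      ∀ f j, (∀ i, σ i = some j → W f j = f i) ∧ ((∀ i, σ i ≠ some j) → W f j = 0) := by
  classical
  -- The coordinate at `j` is read at the preimage of `j`, which is unique if it exists; without a
  -- preimage it is `0`.
  set g : (J → ℝ) → J → ℝ := fun f j => if h : ∃ i, σ i = some j then f h.choose else 0 with hg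
  have hg1 : ∀ f i j, σ i = some j → g f j = f i := by
    intro f i j h
    have h' : ∃ i, σ i = some j := ⟨i, h⟩
    simp only [hg, dif_pos h']
    rw [hσ _ _ _ h'.choose_spec h]
  have hg0 : ∀ f j, (∀ i, σ i ≠ some j) → g f j = 0 := by
    intro f j h
    simp only [hg]
    rw [dif_neg (by push Not; exact h)]
  have h2 : (0 : ℝ) < (2 : ENNReal).toReal := by norm_num
  have hsum : ∀ (f : lp (fun _ : J => ℝ) 2) (s : Finset J),
      ∑ j ∈ s, ‖g f j‖ ^ (2 : ENNReal).toReal ≤ ‖f‖ ^ (2 : ENNReal).toReal := by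
    intro f s
    -- A finite sum of squares of the image is a sum of squares of `f` over the chosen preimages.
    -- These are distinct for distinct `j`, so the norm of `f` bounds it.
    refine le_trans ?_ (lp.sum_rpow_le_norm_rpow h2 f
      ((s.filter fun j => ∃ i, σ i = some j).attach.image
        fun j => (Finset.mem_filter.1 j.2).2.choose))
    rw [Finset.sum_image, ← Finset.sum_filter_add_sum_filter_not s (fun j => ∃ i, σ i = some j)]
    · rw [Finset.sum_eq_zero (s := s.filter fun j => ¬ ∃ i, σ i = some j), add_zero]
      · rw [← Finset.sum_attach]
        refine le_of_eq (Finset.sum_congr rfl fun j _ => ?_)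
        rw [hg1 f _ _ (Finset.mem_filter.1 j.2).2.choose_spec]
      · intro j hj
        have := (Finset.mem_filter.1 hj).2
        rw [hg0 f j (fun i hi => this ⟨i, hi⟩), norm_zero, Real.zero_rpow h2.ne']
    · intro a _ a' _ h
      have e1 := (Finset.mem_filter.1 a.2).2.choose_spec
      have e2 := (Finset.mem_filter.1 a'.2).2.choose_spec
      beta_reduce at h
      rw [h] at e1
      exact Subtype.ext (Option.some_injective _ (e1.symm.trans e2))
  have hadd : ∀ f f' j, g (f + f') j = g f j + g f' j := by
    intro f f' j
    simp only [hg]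
    split_ifs <;> simp
  have hsmul : ∀ (c : ℝ) f j, g (c • f) j = c * g f j := by
    intro c f j
    simp only [hg]
    split_ifs <;> simp
  let W : lp (fun _ : J => ℝ) 2 →ₗ[ℝ] lp (fun _ : J => ℝ) 2 :=
    { toFun := fun f => ⟨g f, memℓp_gen' (hsum f)⟩
      map_add' := fun f f' => by ext j; exact hadd f f' j
      map_smul' := fun c f => by ext j; exact hsmul c f j }
  refine ⟨W.mkContinuous 1 fun f => ?_, LinearMap.mkContinuous_norm_le _ zero_le_one _,
    fun f j => ⟨fun i h => hg1 f i j h, fun h => hg0 f j h⟩⟩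
  rw [one_mul]
  exact lp.norm_le_of_forall_sum_le h2 (norm_nonneg f) (hsum f)

variable {H : Type*} [NormedAddCommGroup H] [InnerProductSpace ℝ H]

lemma exists_partialPerm (b : HilbertBasis J ℝ H) (σ : J → Option J)
    (hσ : ∀ i i' j, σ i = some j → σ i' = some j → i = i') :
    ∃ W : H →L[ℝ] H, ‖W‖ ≤ 1 ∧ ∀ i, W (b i) = (σ i).elim 0 b := by
  classical
  obtain ⟨W, hW, hW'⟩ := exists_lp_partialPerm σ hσ
  refine ⟨(b.repr.symm : lp (fun _ : J => ℝ) 2 →L[ℝ] H).comp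
    (W.comp (b.repr : H →L[ℝ] lp (fun _ : J => ℝ) 2)), ?_, fun i => ?_⟩
  · refine ContinuousLinearMap.opNorm_le_bound _ zero_le_one fun z => ?_
    simp only [ContinuousLinearMap.coe_comp, Function.comp_apply]
    change ‖b.repr.symm (W (b.repr z))‖ ≤ _
    rw [LinearIsometryEquiv.norm_map]
    refine (W.le_opNorm _).trans ?_
    rw [LinearIsometryEquiv.norm_map]
    exact mul_le_mul_of_nonneg_right hW (norm_nonneg z)
  · change b.repr.symm (W (b.repr (b i))) = _
    rw [LinearIsometryEquiv.symm_apply_eq, b.repr_self]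
    ext j
    rcases hi : σ i with _ | k
    · simp only [Option.elim_none, map_zero]
      change _ = (0 : ℝ)
      by_cases h : ∃ i', σ i' = some j
      · obtain ⟨i', h'⟩ := h
        rw [(hW' _ j).1 i' h', lp.single_apply_ne]
        rintro rfl
        rw [hi] at h'
        cases h'
      · push Not at h
        exact (hW' _ j).2 h
    · simp only [Option.elim_some, b.repr_self]
      by_cases hj : j = k
      · subst hj
        rw [(hW' _ j).1 i hi, lp.single_apply_self, lp.single_apply_self]
      · rw [lp.single_apply_ne _ _ _ hj]
        by_cases h : ∃ i', σ i' = some j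
        · obtain ⟨i', h'⟩ := h
          rw [(hW' _ j).1 i' h', lp.single_apply_ne]
          rintro rfl
          rw [hi] at h'
          exact hj (Option.some_injective _ h').symm
        · push Not at h
          exact (hW' _ j).2 h

open Classical in
/-- The operator that permutes the vectors of a Hilbert basis according to a partial injection. -/
def partialPerm (b : HilbertBasis J ℝ H) (σ : J → Option J) : H →L[ℝ] H :=
  if hσ : ∀ i i' j, σ i = some j → σ i' = some j → i = i' then
    (exists_partialPerm b σ hσ).choose else 0

lemma norm_partialPerm_le (b : HilbertBasis J ℝ H) (σ : J → Option J) : ‖partialPerm b σ‖ ≤ 1 := by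
  rw [partialPerm]
  split_ifs with h
  · exact (exists_partialPerm b σ h).choose_spec.1
  · simp

lemma partialPerm_apply (b : HilbertBasis J ℝ H) {σ : J → Option J}
    (hσ : ∀ i i' j, σ i = some j → σ i' = some j → i = i') (i : J) :
    partialPerm b σ (b i) = (σ i).elim 0 b := by
  rw [partialPerm, dif_pos hσ]
  exact (exists_partialPerm b σ hσ).choose_spec.2 i

/-- A Hilbert basis with another index set. -/
lemma exists_hilbertBasis_equiv [CompleteSpace H] {J' : Type*} (b : HilbertBasis J ℝ H) (e : J' ≃ J) :
    ∃ b' : HilbertBasis J' ℝ H, ∀ j, b' j = b (e j) := by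
  classical
  have h : ⊤ ≤ (Submodule.span ℝ (Set.range (b ∘ e))).topologicalClosure := by
    rw [e.surjective.range_comp, b.dense_span]
  refine ⟨HilbertBasis.mk (b.orthonormal.comp e e.injective) h, fun j => ?_⟩
  rw [HilbertBasis.coe_mk]
  rfl

lemma inner_elim (b : HilbertBasis J ℝ H) (j : J) (o : Option J) [Decidable (o = some j)] :
    inner ℝ (b j) (o.elim 0 b) = if o = some j then (1 : ℝ) else 0 := by
  classical
  rcases o with _ | k
  · simp
  · simp only [Option.elim_some, Option.some.injEq]
    rw [orthonormal_iff_ite.1 b.orthonormal]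
    simp only [eq_comm]

end PartialPerm

/-! ### Dyadic arithmetic and combinations of basis vectors -/

lemma isDyadic_one (p : ℕ) : IsDyadic p 1 := ⟨2 ^ p, by simp⟩

lemma IsDyadic.add {p : ℕ} {x y : ℝ} (hx : IsDyadic p x) (hy : IsDyadic p y) :
    IsDyadic p (x + y) := by
  obtain ⟨m, rfl⟩ := hx
  obtain ⟨k, rfl⟩ := hy
  exact ⟨m + k, by push_cast; ring⟩

lemma IsDyadic.mul {p q : ℕ} {x y : ℝ} (hx : IsDyadic p x) (hy : IsDyadic q y) :
    IsDyadic (p + q) (x * y) := by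
  obtain ⟨m, rfl⟩ := hx
  obtain ⟨k, rfl⟩ := hy
  exact ⟨m * k, by push_cast; rw [pow_add]; ring⟩

lemma IsDyadic.mono {p q : ℕ} {x : ℝ} (hx : IsDyadic p x) (h : p ≤ q) : IsDyadic q x := by
  obtain ⟨m, rfl⟩ := hx
  obtain ⟨k, rfl⟩ := Nat.exists_eq_add_of_le h
  refine ⟨m * 2 ^ k, ?_⟩
  push_cast
  rw [pow_add]
  field_simp

lemma isDyadic_sum {ι : Type*} {p : ℕ} (s : Finset ι) {f : ι → ℝ}
    (h : ∀ i ∈ s, IsDyadic p (f i)) : IsDyadic p (∑ i ∈ s, f i) := by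
  classical
  induction s using Finset.induction_on with
  | empty => simpa using isDyadic_zero p
  | insert a s ha ih =>
    rw [Finset.sum_insert ha]
    exact (h a (Finset.mem_insert_self _ _)).add
      (ih fun i hi => h i (Finset.mem_insert_of_mem hi))

lemma isDyadic_inner_elim {J H : Type*} [NormedAddCommGroup H] [InnerProductSpace ℝ H]
    (b : HilbertBasis J ℝ H) (p : ℕ) (j : J) (o : Option J) :
    IsDyadic p (inner ℝ (b j) (o.elim 0 b)) := by
  classical
  rw [inner_elim]
  split_ifs
  exacts [isDyadic_one p, isDyadic_zero p]

lemma isDyadic_inner_sum {J ι H : Type*} [NormedAddCommGroup H] [InnerProductSpace ℝ H]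
    (b : HilbertBasis J ℝ H) {p : ℕ} (s : Finset ι) {c : ι → ℝ} (o : ι → Option J)
    (h : ∀ i ∈ s, IsDyadic p (c i)) (j : J) :
    IsDyadic p (inner ℝ (b j) (∑ i ∈ s, c i • (o i).elim 0 b)) := by
  classical
  rw [inner_sum]
  refine isDyadic_sum s fun i hi => ?_
  rw [inner_smul_right, inner_elim]
  split_ifs
  · simpa using h i hi
  · simpa using isDyadic_zero p

/-- The triangle inequality is crude, but the bound involves only the number of terms and not the
size of the basis, hence not the context width. -/
lemma norm_sum_elim_le {J ι H : Type*} [NormedAddCommGroup H] [InnerProductSpace ℝ H]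
    (b : HilbertBasis J ℝ H) (s : Finset ι) {c : ι → ℝ} {M : ℝ} (hM : ∀ i, |c i| ≤ M)
    (o : ι → Option J) : ‖∑ i ∈ s, c i • (o i).elim 0 b‖ ≤ s.card * M := by
  refine (norm_sum_le _ _).trans ?_
  rw [← nsmul_eq_mul]
  refine Finset.sum_le_card_nsmul _ _ _ fun i _ => ?_
  rw [norm_smul, Real.norm_eq_abs]
  have : ‖(o i).elim 0 b‖ ≤ 1 := by
    rcases o i with _ | j
    · simp
    · simp [b.orthonormal.1 j]
  calc |c i| * _ ≤ |c i| * 1 := mul_le_mul_of_nonneg_left this (abs_nonneg _)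
    _ ≤ M := by rw [mul_one]; exact hM i

/-! ### A transformer with a given table -/

/-- Index set of a Hilbert basis: a chain of value matrices, a kind, and possibly an index. -/
abbrev Cell (S : Type*) (N : ℕ∞) (L Hd D : ℕ) : Type _ :=
  (Fin L → Option (Fin Hd)) × Kind S L D × Option (Idx N)

instance Kind.fintype {S : Type*} [Finite S] {L D : ℕ} : Fintype (Kind S L D) := Fintype.ofFinite _

/-- Shift of an index, if the result is within the context. -/
def shiftIdx {N : ℕ∞} (j : Idx N) (δ : ℤ) : Option (Idx N) :=
  if h : 0 ≤ ((j : ℕ) : ℤ) + δ ∧ (((((j : ℕ) : ℤ) + δ).toNat : ℕ) : ℕ∞) < N then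
    some ⟨(((j : ℕ) : ℤ) + δ).toNat, h.2⟩ else none

lemma shiftIdx_eq_some {N : ℕ∞} (j i : Idx N) (δ : ℤ) :
    shiftIdx j δ = some i ↔ ((i : ℕ) : ℤ) = (j : ℕ) + δ := by
  rw [shiftIdx]
  constructor
  · intro h
    split_ifs at h with h'
    simp only [Option.some.injEq] at h
    subst h
    exact Int.toNat_of_nonneg h'.1
  · intro h
    have hi : (((j : ℕ) : ℤ) + δ).toNat = (i : ℕ) := by omega
    have h' : 0 ≤ ((j : ℕ) : ℤ) + δ ∧ (((((j : ℕ) : ℤ) + δ).toNat : ℕ) : ℕ∞) < N := by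
      rw [hi]; exact ⟨by omega, i.2⟩
    rw [dif_pos h']
    simp only [Option.some.injEq]
    exact Subtype.ext hi

/-- The index of a position or an extended character. -/
def OutVec.index {S : Type*} {N : ℕ∞} {L D : ℕ} : OutVec S N L D → Option (Idx N)
  | .pos i => some i
  | .emb (.chr k) => some k
  | _ => none

section

variable {S : Type*} {N : ℕ∞} {L Hd D : ℕ}

lemma OutVec.index_cases (v : OutVec S N L D) :
    (v.kind.Indexed ∧ ∃ i : Idx N, v.index = some i ∧ v.idx = i) ∨
      (¬ v.kind.Indexed ∧ v.index = none) := by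
  rcases v with i | (_ | σ | k) | ⟨l, s⟩
  · exact .inl ⟨trivial, i, rfl, rfl⟩
  · exact .inr ⟨id, rfl⟩
  · exact .inr ⟨id, rfl⟩
  · exact .inl ⟨trivial, k, rfl, rfl⟩
  · exact .inr ⟨id, rfl⟩

variable {H : Type*} [NormedAddCommGroup H] [InnerProductSpace ℝ H]

/-- The vector that represents a label acted on by a chain. -/
def labelVec (b : HilbertBasis (Cell S N L Hd D) ℝ H) (C : Fin L → Option (Fin Hd))
    (v : OutVec S N L D) : H :=
  b (C, v.kind, none) + (v.index.map fun i => ((C, v.kind, some i) : Cell S N L Hd D)).elim 0 b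

-- A label vector has two halves. The index-free half sees chain and kind only and serves
-- interactions that must ignore indices; the indexed half, treated in the next lemma, serves those
-- that depend on a displacement.
open Classical in
lemma inner_labelVec_none (b : HilbertBasis (Cell S N L Hd D) ℝ H) (C C' : Fin L → Option (Fin Hd))
    (k : Kind S L D) (v : OutVec S N L D) :
    inner ℝ (b (C', k, none)) (labelVec b C v) = if C' = C ∧ k = v.kind then (1 : ℝ) else 0 := by
  rw [labelVec, inner_add_right, orthonormal_iff_ite.1 b.orthonormal, inner_elim]
  have : ¬ (v.index.map fun i => ((C, v.kind, some i) : Cell S N L Hd D)) = some (C', k, none) := by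
    rcases v.index with _ | i <;> simp
  rw [if_neg this, add_zero]
  simp

open Classical in
lemma inner_labelVec_some (b : HilbertBasis (Cell S N L Hd D) ℝ H) (C C' : Fin L → Option (Fin Hd))
    (k : Kind S L D) (i : Idx N) (v : OutVec S N L D) :
    inner ℝ (b (C', k, some i)) (labelVec b C v) =
      if C' = C ∧ k = v.kind ∧ v.index = some i then (1 : ℝ) else 0 := by
  rw [labelVec, inner_add_right, orthonormal_iff_ite.1 b.orthonormal, inner_elim]
  have : ¬ ((C', k, some i) : Cell S N L Hd D) = (C, v.kind, none) := by simp
  rw [if_neg this, zero_add]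
  congr 1
  rcases v.index with _ | j
  · simp
  · simp only [Option.map_some, Option.some.injEq, Prod.mk.injEq, eq_iff_iff]
    constructor
    · rintro ⟨rfl, rfl, rfl⟩; exact ⟨rfl, rfl, rfl⟩
    · rintro ⟨rfl, rfl, rfl⟩; exact ⟨rfl, rfl, rfl⟩

lemma norm_labelVec_le (b : HilbertBasis (Cell S N L Hd D) ℝ H) (C : Fin L → Option (Fin Hd)) (v : OutVec S N L D) :
    ‖labelVec b C v‖ ≤ 2 := by
  refine (norm_add_le _ _).trans ?_
  rw [b.orthonormal.1]
  have : ‖(v.index.map fun i => ((C, v.kind, some i) : Cell S N L Hd D)).elim 0 b‖ ≤ 1 := by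
    rcases v.index with _ | i
    · simp
    · simp [b.orthonormal.1]
  linarith

lemma isDyadic_inner_labelVec (b : HilbertBasis (Cell S N L Hd D) ℝ H) (p : ℕ) (c : Cell S N L Hd D) (C : Fin L → Option (Fin Hd))
    (v : OutVec S N L D) : IsDyadic p (inner ℝ (b c) (labelVec b C v)) := by
  rw [labelVec, inner_add_right]
  exact (isDyadic_inner_elim b p c (some _)).add (isDyadic_inner_elim b p c _)

open Classical in
/-- The basis vectors that interact in a given slot at a given displacement. -/
def attnMap (x : ((Fin L → Option (Fin Hd)) × (Fin L → Option (Fin Hd)) × Kind S L D × Kind S L D) × ℤ)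
    (c : Cell S N L Hd D) : Option (Cell S N L Hd D) :=
  if c.1 = x.1.2.1 ∧ c.2.1 = x.1.2.2.2 then
    if x.1.2.2.1 = x.1.2.2.2 ∧ x.1.2.2.1.Indexed then
      (c.2.2.bind fun j => shiftIdx j x.2).map fun i => (x.1.1, x.1.2.2.1, some i)
    else if x.2 = 0 ∧ c.2.2 = none then some (x.1.1, x.1.2.2.1, none) else none
  else none

/-- The slot fixes the chain and the kind of the source, and at a fixed displacement the target
index determines the source index. -/
lemma attnMap_injective
    (x : ((Fin L → Option (Fin Hd)) × (Fin L → Option (Fin Hd)) × Kind S L D × Kind S L D) × ℤ)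
    (c c' d : Cell S N L Hd D) (h : attnMap x c = some d) (h' : attnMap x c' = some d) : c = c' := by
  obtain ⟨C, k, o⟩ := c
  obtain ⟨C', k', o'⟩ := c'
  obtain ⟨⟨C₁, C₂, k₁, k₂⟩, δ⟩ := x
  have h1 : C = C₂ ∧ k = k₂ := by
    by_contra hn
    simp [attnMap, hn] at h
  have h2 : C' = C₂ ∧ k' = k₂ := by
    by_contra hn
    simp [attnMap, hn] at h'
  obtain ⟨rfl, rfl⟩ := h1
  obtain ⟨rfl, rfl⟩ := h2
  by_cases hr : k₁ = k' ∧ k₁.Indexed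
  · simp only [attnMap, and_self, if_true, if_pos hr, Option.map_eq_some_iff,
      Option.bind_eq_some_iff] at h h'
    obtain ⟨i, ⟨j, rfl, hj⟩, rfl⟩ := h
    obtain ⟨i', ⟨j', rfl, hj'⟩, e⟩ := h'
    simp only [Prod.mk.injEq, Option.some.injEq, true_and] at e
    subst e
    rw [shiftIdx_eq_some] at hj hj'
    have : j = j' := Subtype.ext (by omega)
    rw [this]
  · simp only [attnMap, and_self, if_true, if_neg hr] at h h'
    split_ifs at h h' with h3 h4
    rw [h3.2, h4.2]

-- Between related kinds only indexed cells move, and the shift `j ↦ j + δ` reaches `i` exactly if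
-- `i - j = δ`. Otherwise only index-free cells move, and only for `δ = 0`, the conventional
-- displacement. So each pair of label vectors is detected by exactly one pair of slot and
-- displacement.
open Classical in
lemma inner_attnMap (b : HilbertBasis (Cell S N L Hd D) ℝ H)
    (x : ((Fin L → Option (Fin Hd)) × (Fin L → Option (Fin Hd)) × Kind S L D × Kind S L D) × ℤ)
    (C C' : Fin L → Option (Fin Hd)) (v w : OutVec S N L D) :
    inner ℝ (labelVec b C v) (partialPerm b (attnMap x) (labelVec b C' w)) =
      if x = ((C, C', v.kind, w.kind), v.disp w) then (1 : ℝ) else 0 := by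
  obtain ⟨⟨C₁, C₂, k₁, k₂⟩, δ⟩ := x
  -- The image of a basis vector is a cell or nothing; pairing it with a label vector tests whether
  -- the cell is one of the two halves.
  have hbool : ∀ z : Option (Cell S N L Hd D), inner ℝ (labelVec b C v) (z.elim 0 b) =
      if (∃ k, z = some (C, k, none) ∧ k = v.kind) ∨
        (∃ k i, z = some (C, k, some i) ∧ k = v.kind ∧ v.index = some i) then (1 : ℝ) else 0 := by
    rintro (_ | ⟨C₀, k, _ | i⟩)
    · simp
    · rw [Option.elim_some, real_inner_comm, inner_labelVec_none]
      congr 1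
      simp
    · rw [Option.elim_some, real_inner_comm, inner_labelVec_some]
      congr 1
      simp only [Option.some.injEq, Prod.mk.injEq, reduceCtorEq, and_false, false_and,
        exists_false, false_or, eq_iff_iff]
      constructor
      · rintro ⟨h1, h2, h3⟩; exact ⟨k, i, ⟨h1, rfl, rfl⟩, h2, h3⟩
      · rintro ⟨k, i, ⟨h1, rfl, rfl⟩, h2, h3⟩; exact ⟨h1, h2, h3⟩
  have hpp : ∀ c, partialPerm b (attnMap ((C₁, C₂, k₁, k₂), δ)) (b c) = _ :=
    partialPerm_apply b (attnMap_injective ((C₁, C₂, k₁, k₂), δ))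
  rw [show labelVec b C' w = b (C', w.kind, none) +
    (w.index.map fun i => ((C', w.kind, some i) : Cell S N L Hd D)).elim 0 b from rfl,
    map_add, hpp, inner_add_right, hbool]
  by_cases h2 : C' = C₂ ∧ w.kind = k₂
  swap
  · have hz : ∀ o, attnMap ((C₁, C₂, k₁, k₂), δ) ((C', w.kind, o) : Cell S N L Hd D) = none := by
      intro o
      simp only [attnMap]
      rw [if_neg h2]
    rw [hz, if_neg (by simp), zero_add, if_neg]
    · rcases w.index with _ | j
      · simp
      · simp only [Option.map_some, Option.elim_some]
        rw [hpp, hz]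
        simp
    · simp only [Prod.mk.injEq]
      rintro ⟨⟨-, e1, -, e2⟩, -⟩
      exact h2 ⟨e1.symm, e2.symm⟩
  obtain ⟨rfl, rfl⟩ := h2
  by_cases hr : k₁ = w.kind ∧ k₁.Indexed
  · obtain ⟨rfl, hi⟩ := hr
    have hz : attnMap ((C₁, C', w.kind, w.kind), δ) ((C', w.kind, none) : Cell S N L Hd D) =
        none := by
      simp [attnMap, hi]
    -- For related kinds the index-free half of `w` is killed by `hz`, so only the shift of the
    -- index `j` remains.
    rcases w.index_cases with ⟨-, j, hj, hj'⟩ | ⟨h, -⟩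
    swap
    · exact absurd hi h
    rw [hz, if_neg (by simp), zero_add, hj, Option.map_some, Option.elim_some, hpp, hbool]
    congr 1
    simp only [attnMap, and_self, if_true, hi, Option.bind_some, Prod.mk.injEq, eq_iff_iff]
    by_cases hv : v.kind = w.kind
    · rcases v.index_cases with ⟨-, i, hvi, hvi'⟩ | ⟨h, -⟩
      swap
      · exact absurd (hv ▸ hi) h
      have hd : v.disp w = (i : ℕ) - (j : ℕ) := by
        rw [OutVec.disp_of_related ((OutVec.related_iff v w).2 ⟨hv, hv ▸ hi⟩), hvi', hj']
      rw [hd, hvi, hv]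
      rcases hs : shiftIdx j δ with _ | i'
      · have := fun h => (shiftIdx_eq_some j i δ).2 h
        rw [hs] at this
        simp only [Option.map_none, reduceCtorEq, false_and, exists_false, or_self,
          and_true, false_iff, not_and]
        intro _ hδ
        exact absurd (this (by omega)) (by simp)
      · have hs' := (shiftIdx_eq_some j i' δ).1 hs
        simp only [Option.map_some, Option.some.injEq, Prod.mk.injEq, reduceCtorEq, and_false,
          false_and, exists_false, false_or, and_true]
        constructor
        · rintro ⟨k, i'', ⟨h1, -, h3⟩, -, h4⟩
          subst h3; subst h4
          exact ⟨h1, by omega⟩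
        · rintro ⟨h1, h2⟩
          refine ⟨w.kind, i', ⟨h1, rfl, rfl⟩, rfl, Subtype.ext (by omega)⟩
    · constructor
      · rintro (⟨k, h, rfl⟩ | ⟨k, i, h, rfl, -⟩)
        · simp at h
        · simp only [Option.map_eq_some_iff, Prod.mk.injEq] at h
          obtain ⟨-, -, -, h, -⟩ := h
          exact absurd h.symm hv
      · rintro ⟨⟨-, -, h, -⟩, -⟩
        exact absurd h.symm hv
  · have hz : (w.index.map fun i => ((C', w.kind, some i) : Cell S N L Hd D)).elim 0 b = 0 ∨
        ∃ j, (w.index.map fun i => ((C', w.kind, some i) : Cell S N L Hd D)).elim 0 b =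
          b (C', w.kind, some j) := by
      rcases w.index with _ | j
      · exact .inl rfl
      · exact .inr ⟨j, rfl⟩
    have hz' : partialPerm b (attnMap ((C₁, C', k₁, w.kind), δ))
        ((w.index.map fun i => ((C', w.kind, some i) : Cell S N L Hd D)).elim 0 b) = 0 := by
      rcases hz with h | ⟨j, h⟩
      · rw [h, map_zero]
      · rw [h, hpp]
        simp [attnMap, hr]
    rw [hz', inner_zero_right, add_zero]
    congr 1
    simp only [attnMap, and_self, if_true, if_neg hr, and_true, Prod.mk.injEq, eq_iff_iff]
    constructor
    · rintro (⟨k, h, rfl⟩ | ⟨k, i, h, rfl, -⟩)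
      · split_ifs at h with h0
        simp only [Option.some.injEq, Prod.mk.injEq, and_true] at h
        refine ⟨⟨h.1, trivial, h.2⟩, ?_⟩
        rw [OutVec.disp_of_not_related, h0]
        rw [OutVec.related_iff, ← h.2]
        exact hr
      · split_ifs at h with h0
        simp at h
    · rintro ⟨⟨h1, -, h2⟩, h3⟩
      left
      refine ⟨v.kind, ?_, rfl⟩
      rw [if_pos, h1, h2]
      rw [h3]
      apply OutVec.disp_of_not_related
      rw [OutVec.related_iff, ← h2]
      exact hr

open Classical in
/-- The basis vector on which the row of `U` for `ω` acts in a given slot at a displacement. -/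
def unembedMap (ω : Token S (Idx N)) (x : ((Fin L → Option (Fin Hd)) × Kind S L D) × ℤ) :
    Option (Cell S N L Hd D) :=
  if (OutVec.emb ω : OutVec S N L D).kind = x.1.2 ∧ x.1.2.Indexed then
    ((OutVec.emb ω : OutVec S N L D).index.bind fun j => shiftIdx j (-x.2)).map
      fun i => (x.1.1, x.1.2, some i)
  else if x.2 = 0 then some (x.1.1, x.1.2, none) else none

-- The mechanism of `inner_attnMap`, with the output symbol in the role of the left label. Its index
-- `j` is known and that of `w` is sought, so `j - i = δ` is solved by the shift `-δ`.
open Classical in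
lemma inner_unembedMap (b : HilbertBasis (Cell S N L Hd D) ℝ H) (ω : Token S (Idx N))
    (x : ((Fin L → Option (Fin Hd)) × Kind S L D) × ℤ)
    (C : Fin L → Option (Fin Hd)) (w : OutVec S N L D) :
    inner ℝ ((unembedMap ω x).elim 0 b) (labelVec b C w) =
      if x = ((C, w.kind), (OutVec.emb ω : OutVec S N L D).disp w) then (1 : ℝ) else 0 := by
  obtain ⟨⟨C₁, k⟩, δ⟩ := x
  simp only [unembedMap]
  by_cases hr : (OutVec.emb ω : OutVec S N L D).kind = k ∧ k.Indexed
  · rw [if_pos hr]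
    obtain ⟨rfl, hi⟩ := hr
    rcases (OutVec.emb ω : OutVec S N L D).index_cases with ⟨-, j, hj, hj'⟩ | ⟨h, -⟩
    swap
    · exact absurd hi h
    rw [hj, Option.bind_some]
    by_cases hw : (OutVec.emb ω : OutVec S N L D).kind = w.kind
    · rcases w.index_cases with ⟨-, i, hwi, hwi'⟩ | ⟨h, -⟩
      swap
      · exact absurd (hw ▸ hi) h
      have hd : (OutVec.emb ω : OutVec S N L D).disp w = (j : ℕ) - (i : ℕ) := by
        rw [OutVec.disp_of_related ((OutVec.related_iff _ w).2 ⟨hw, hi⟩), hwi', hj']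
      rcases hs : shiftIdx j (-δ) with _ | i'
      · have := fun h => (shiftIdx_eq_some j i (-δ)).2 h
        rw [hs] at this
        simp only [Option.map_none, Option.elim_none, inner_zero_left]
        rw [if_neg]
        simp only [Prod.mk.injEq, not_and, hd]
        intro _ hδ
        exact absurd (this (by omega)) (by simp)
      · have hs' := (shiftIdx_eq_some j i' (-δ)).1 hs
        simp only [Option.map_some, Option.elim_some]
        rw [inner_labelVec_some, hwi, hd]
        congr 1
        simp only [Option.some.injEq, Prod.mk.injEq, eq_iff_iff]
        constructor
        · rintro ⟨h1, h2, rfl⟩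
          exact ⟨⟨h1, h2⟩, by omega⟩
        · rintro ⟨⟨h1, h2⟩, h3⟩
          exact ⟨h1, h2, Subtype.ext (by omega)⟩
    · rw [if_neg]
      · rcases shiftIdx j (-δ) with _ | i'
        · simp
        · simp only [Option.map_some, Option.elim_some]
          rw [inner_labelVec_some, if_neg]
          exact fun h => hw h.2.1
      · simp only [Prod.mk.injEq]
        exact fun h => hw h.1.2
  · rw [if_neg hr]
    by_cases hδ : δ = 0
    · rw [if_pos hδ, Option.elim_some, inner_labelVec_none]
      congr 1
      simp only [Prod.mk.injEq, eq_iff_iff]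
      refine ⟨?_, fun h => h.1⟩
      rintro ⟨h1, h2⟩
      refine ⟨⟨h1, h2⟩, ?_⟩
      rw [hδ, OutVec.disp_of_not_related]
      rw [OutVec.related_iff, ← h2]
      rintro ⟨h3, h4⟩
      exact hr ⟨h3, h3 ▸ h4⟩
    · rw [if_neg hδ, Option.elim_none, inner_zero_left, if_neg]
      simp only [Prod.mk.injEq]
      rintro ⟨⟨-, h2⟩, h3⟩
      rw [OutVec.disp_of_not_related] at h3
      · exact hδ h3
      rw [OutVec.related_iff, ← h2]
      rintro ⟨h5, h4⟩
      exact hr ⟨h5, h5 ▸ h4⟩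

/-- The action of a value matrix on basis vectors: the matrix is added to the chain. -/
def valueMap (l : Fin L) (h : Fin Hd) (c : Cell S N L Hd D) : Option (Cell S N L Hd D) :=
  if c.1 l = none then some (Function.update c.1 l (some h), c.2) else none

/-- A cell is moved only if layer `l` of its chain is vacant, so erasing that layer recovers the
original chain. -/
lemma valueMap_injective (l : Fin L) (h : Fin Hd) (c c' d : Cell S N L Hd D)
    (hc : valueMap l h c = some d) (hc' : valueMap l h c' = some d) : c = c' := by
  obtain ⟨C, k⟩ := c
  obtain ⟨C', k'⟩ := c'
  simp only [valueMap] at hc hc'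
  split_ifs at hc hc' with h1 h2
  simp only [Option.some.injEq] at hc hc'
  subst hc
  simp only [Prod.mk.injEq] at hc'
  obtain ⟨e, rfl⟩ := hc'
  have : C = C' := by
    funext l'
    by_cases hl : l' = l
    · subst hl; rw [h1, h2]
    · have := congrFun e l'
      rw [Function.update_of_ne hl, Function.update_of_ne hl] at this
      exact this.symm
  rw [this]

/-- Value matrices that extend chains generate, by their products, all chains. -/
lemma chainProd_basis (T : Transformer S N H) {ι : Type*} (b : T.Chain × ι → H)
    (hV : ∀ l h C q, C l = none → T.V l h (b (C, q)) = b (Function.update C l (some h), q))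
    (C : T.Chain) (q : ι) : T.chainProd C (b (fun _ => none, q)) = b (C, q) := by
  classical
  -- After the layers in `t` the basis vector carries the part of `C` on `t`. Since `t` has no
  -- repetitions, the next layer is still vacant when its value matrix acts.
  have key : ∀ t : List (Fin T.depth), t.Nodup →
      (t.foldl (fun M l => match C l with
        | none => M
        | some h => (T.V l h).comp M) (ContinuousLinearMap.id ℝ H)) (b (fun _ => none, q)) =
      b (fun l => if l ∈ t then C l else none, q) := by
    intro t
    induction t using List.reverseRecOn with
    | nil => intro _; simp
    | append_singleton t a ih =>
      intro ht
      rw [List.nodup_append] at ht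
      have ha : a ∉ t := fun h => ht.2.2 a h a (by simp) rfl
      rw [List.foldl_append, List.foldl_cons, List.foldl_nil]
      rcases hC : C a with _ | h
      · simp only
        rw [ih ht.1]
        congr 2
        funext l
        by_cases hl : l = a
        · subst hl; simp [hC]
        · simp [hl]
      · simp only [ContinuousLinearMap.coe_comp, Function.comp_apply]
        rw [ih ht.1, hV _ _ _ _ (by simp [ha])]
        congr 2
        funext l
        by_cases hl : l = a
        · subst hl; simp [hC]
        · simp [hl]
  have := key (List.finRange T.depth) (List.nodup_finRange _)
  refine Eq.trans this ?_
  simp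

lemma memℓp_rows {ι : Type*} {r : ι → H} {M : ℝ} (hr : ∀ i, ‖r i‖ ≤ M) (z : H) :
    Memℓp (fun i => (inner ℝ (r i) z : ℝ)) ⊤ := by
  rw [memℓp_infty_iff]
  refine ⟨M * ‖z‖, ?_⟩
  rintro _ ⟨i, rfl⟩
  exact (norm_inner_le_norm _ _).trans (mul_le_mul_of_nonneg_right (hr i) (norm_nonneg z))

/-- The bounded operator to bounded families with given rows. -/
def rowsOp {ι : Type*} (r : ι → H) (M : ℝ) (hM : 0 ≤ M) (hr : ∀ i, ‖r i‖ ≤ M) :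
    H →L[ℝ] lp (fun _ : ι => ℝ) ⊤ :=
  LinearMap.mkContinuous
    { toFun := fun z => ⟨fun i => inner ℝ (r i) z, memℓp_rows hr z⟩
      map_add' := fun z z' => by ext i; exact inner_add_right _ _ _
      map_smul' := fun c z => by ext i; exact real_inner_smul_right _ _ _ } M
    fun z => by
      refine lp.norm_le_of_forall_le (mul_nonneg hM (norm_nonneg z)) fun i => ?_
      exact (norm_inner_le_norm _ _).trans (mul_le_mul_of_nonneg_right (hr i) (norm_nonneg z))

lemma norm_rowsOp_le {ι : Type*} (r : ι → H) (M : ℝ) (hM : 0 ≤ M) (hr : ∀ i, ‖r i‖ ≤ M) :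
    ‖rowsOp r M hM hr‖ ≤ M := LinearMap.mkContinuous_norm_le _ hM _

end

/-! ### Realization of a local table -/

section

variable {S : Type*} [Finite S] {N : ℕ∞} {L Hd D : ℕ}

/-- There are finitely many slots, because `S` is finite, and locality leaves finitely many
displacements. -/
lemma Table.LocalTo.exists_bound {τ : Table S L Hd D} {Δ : ℕ} (h : τ.LocalTo Δ) :
    ∃ M : ℝ, 0 ≤ M ∧ ∀ σ δ, |τ.val σ δ| ≤ M := by
  have hfin : (Set.range fun x : Slot S L Hd D × Set.Icc (-(Δ : ℤ)) Δ =>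
      |τ.val x.1 x.2|).Finite := Set.finite_range _
  obtain ⟨M, hM⟩ := hfin.bddAbove
  refine ⟨max M 0, le_max_right _ _, fun σ δ => ?_⟩
  by_cases hδ : |δ| ≤ (Δ : ℤ)
  · exact (hM ⟨(σ, ⟨δ, abs_le.1 hδ⟩), rfl⟩).trans (le_max_left _ _)
  · rw [h σ δ (not_le.1 hδ), abs_zero]
    exact le_max_right _ _

variable {H : Type*} [NormedAddCommGroup H] [InnerProductSpace ℝ H]

/-- The row of `U` for `ω`. -/
def unembedRow (b : HilbertBasis (Cell S N L Hd D) ℝ H) (τ : Table S L Hd D) (Δ : ℕ)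
    (ω : Token S (Idx N)) : H :=
  ∑ x ∈ Finset.univ ×ˢ Finset.Icc (-(Δ : ℤ)) Δ,
    τ.val (.unembed x.1.1 (OutVec.emb ω : OutVec S N L D).kind x.1.2) x.2 •
      (unembedMap ω x).elim 0 b

/-- The row of `A_l` for a hidden unit. -/
def mlpRow (b : HilbertBasis (Cell S N L Hd D) ℝ H) (τ : Table S L Hd D) (l : Fin L) (s : Fin D) :
    H :=
  ∑ x : (Fin L → Option (Fin Hd)) × Kind S L D,
    τ.val (.mlp x.1 l s x.2) 0 •
      (some ((x.1, x.2, none) : Cell S N L Hd D)).elim 0 b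

variable (S L Hd D) in
/-- The number of slots and displacements up to `Δ` of an attention form. -/
def slotCount (Δ : ℕ) : ℝ :=
  (((Finset.univ : Finset ((Fin L → Option (Fin Hd)) × (Fin L → Option (Fin Hd)) ×
    Kind S L D × Kind S L D)) ×ˢ Finset.Icc (-(Δ : ℤ)) Δ).card : ℝ)

variable (S L Hd D) in
/-- The number of slots and displacements up to `Δ` of a row of `U`. -/
def rowCount (Δ : ℕ) : ℝ :=
  (((Finset.univ : Finset ((Fin L → Option (Fin Hd)) × Kind S L D)) ×ˢ
    Finset.Icc (-(Δ : ℤ)) Δ).card : ℝ)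

lemma norm_unembedRow_le (b : HilbertBasis (Cell S N L Hd D) ℝ H) {τ : Table S L Hd D} (Δ : ℕ)
    {M : ℝ} (hM : ∀ σ δ, |τ.val σ δ| ≤ M) (ω : Token S (Idx N)) :
    ‖unembedRow b τ Δ ω‖ ≤ rowCount S L Hd D Δ * M :=
  norm_sum_elim_le b _ (fun _ => hM _ _) _

lemma norm_mlpRow_le (b : HilbertBasis (Cell S N L Hd D) ℝ H) {τ : Table S L Hd D}
    {M : ℝ} (hM : ∀ σ δ, |τ.val σ δ| ≤ M) (l : Fin L) (s : Fin D) :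
    ‖mlpRow b τ l s‖ ≤
      ((Finset.univ : Finset ((Fin L → Option (Fin Hd)) × Kind S L D)).card : ℝ) * M :=
  norm_sum_elim_le b _ (fun _ => hM _ _) _

/-- A transformer, on a space with a suitable Hilbert basis, whose product functions are those of a
given table. -/
def realize (b : HilbertBasis (Cell S N L Hd D) ℝ H) (τ : Table S L Hd D) (Δ : ℕ) (M : ℝ)
    (hM0 : 0 ≤ M) (hM : ∀ σ δ, |τ.val σ δ| ≤ M) : Weights S N H L Hd D where
  rnd := τ.rnd
  emb ω := labelVec b (fun _ => none) (.emb ω)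
  pos i := labelVec b (fun _ => none) (.pos i)
  -- The product functions and the regularizer involve only `KᵀQ`, so the whole form can be placed
  -- in `Q`.
  K _ _ := ContinuousLinearMap.id ℝ H
  Q l h := ∑ x ∈ Finset.univ ×ˢ Finset.Icc (-(Δ : ℤ)) Δ,
    τ.val (.attn l h x.1.1 x.1.2.1 x.1.2.2.1 x.1.2.2.2) x.2 • partialPerm b (attnMap x)
  V l h := partialPerm b (valueMap l h)
  A l := ((PiLp.continuousLinearEquiv 2 ℝ fun _ : Fin D => ℝ).symm :
      (Fin D → ℝ) →L[ℝ] EuclideanSpace ℝ (Fin D)).comp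
    (ContinuousLinearMap.pi fun s => innerSL ℝ (mlpRow b τ l s))
  B l := ∑ s, (EuclideanSpace.proj s : EuclideanSpace ℝ (Fin D) →L[ℝ] ℝ).smulRight
    (b (fun _ => none, .mlp l s, none))
  b l := WithLp.toLp 2 fun s => τ.val (.bias l s) 0
  act := τ.act
  U := rowsOp (unembedRow b τ Δ) (rowCount S L Hd D Δ * M)
    (mul_nonneg (Nat.cast_nonneg _) hM0) (norm_unembedRow_le b Δ hM)

variable (b : HilbertBasis (Cell S N L Hd D) ℝ H) {τ : Table S L Hd D} {Δ : ℕ} {M : ℝ}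
  (hM0 : 0 ≤ M) (hM : ∀ σ δ, |τ.val σ δ| ≤ M)

lemma realize_B_single (l : Fin L) (s : Fin D) :
    (realize b τ Δ M hM0 hM).B l (EuclideanSpace.single s 1) =
      b (fun _ => none, .mlp l s, none) := by
  simp only [realize, sum_apply, ContinuousLinearMap.smulRight_apply,
    EuclideanSpace.coe_proj]
  rw [Finset.sum_eq_single s]
  · simp
  · intro t _ ht; simp [ht]
  · simp

lemma realize_vec (v : OutVec S N L D) :
    (realize b τ Δ M hM0 hM).tr.vec v = labelVec b (fun _ => none) v := by
  rcases v with i | ω | ⟨l, s⟩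
  · rfl
  · rfl
  · refine (realize_B_single b (Δ := Δ) hM0 hM l s).trans ?_
    simp [labelVec, OutVec.index, OutVec.kind]

/-- Value matrices append themselves to the chain of a cell and leave kind and index alone, so they
act on both halves of a label vector alike. -/
lemma realize_chainProd (C : Fin L → Option (Fin Hd)) (v : OutVec S N L D) :
    (realize b τ Δ M hM0 hM).tr.chainProd C ((realize b τ Δ M hM0 hM).tr.vec v) =
      labelVec b C v := by
  have h := fun q => chainProd_basis (realize b τ Δ M hM0 hM).tr (ι := Kind S L D × Option (Idx N))
    b (fun l h C q hC => by
      change partialPerm b (valueMap l h) _ = _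
      rw [partialPerm_apply b (valueMap_injective l h), valueMap, if_pos hC, Option.elim_some]) C q
  rw [realize_vec, labelVec, map_add, h, labelVec]
  congr 1
  rcases v.index with _ | i
  · simp
  · simp only [Option.map_some, Option.elim_some]
    rw [h]

/-- Orthonormality picks out the one summand whose slot and displacement are those of the probe. If
that displacement lies outside the window of summation, the sum is zero and so is the table entry,
by locality. -/
lemma realize_eval (hloc : τ.LocalTo Δ) (q : LabelProbe S N L Hd D) :
    (realize b τ Δ M hM0 hM).eval q = τ.val q.slot q.disp := by
  classical
  have hmem : ∀ {α : Type _} [Fintype α] (a : α) {δ : ℤ} {σ : Slot S L Hd D},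
      (a, δ) ∉ (Finset.univ : Finset α) ×ˢ Finset.Icc (-(Δ : ℤ)) Δ → τ.val σ δ = 0 := by
    intro α _ a δ σ h
    refine hloc _ _ (not_le.1 fun h' => h ?_)
    simpa using abs_le.1 h'
  rcases q with ⟨l, h, C₁, C₂, v, w⟩ | ⟨C, ω, w⟩ | ⟨C, l, s, w⟩ | ⟨l, s⟩
  · simp only [Weights.eval, Transformer.prodAttn, realize_chainProd]
    change inner ℝ (labelVec b C₁ v) ((∑ x ∈ Finset.univ ×ˢ Finset.Icc (-(Δ : ℤ)) Δ,
      τ.val (.attn l h x.1.1 x.1.2.1 x.1.2.2.1 x.1.2.2.2) x.2 •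
        partialPerm b (attnMap x)) (labelVec b C₂ w)) = _
    rw [sum_apply, inner_sum]
    rw [Finset.sum_eq_single ((C₁, C₂, v.kind, w.kind), v.disp w)]
    · rw [smul_apply, inner_smul_right, inner_attnMap, if_pos rfl, mul_one]
      rfl
    · intro x _ hx
      rw [smul_apply, inner_smul_right, inner_attnMap, if_neg hx, mul_zero]
    · intro hx
      rw [hmem _ hx, zero_smul, zero_apply, inner_zero_right]
  · simp only [Weights.eval, Transformer.prodUnembed, realize_chainProd]
    change inner ℝ (unembedRow b τ Δ ω) (labelVec b C w) = _
    rw [unembedRow, sum_inner, Finset.sum_eq_single ((C, w.kind), (OutVec.emb ω).disp w)]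
    · rw [real_inner_smul_left, inner_unembedMap, if_pos rfl, mul_one]
      rfl
    · intro x _ hx
      rw [real_inner_smul_left, inner_unembedMap, if_neg hx, mul_zero]
    · intro hx
      rw [hmem _ hx, zero_smul, inner_zero_left]
  · simp only [Weights.eval, Transformer.prodMlp, realize_chainProd]
    change inner ℝ (mlpRow b τ l s) (labelVec b C w) = _
    rw [mlpRow, sum_inner, Finset.sum_eq_single (C, w.kind)]
    · rw [real_inner_smul_left, Option.elim_some, inner_labelVec_none, if_pos ⟨rfl, rfl⟩, mul_one]
      rfl
    · intro x _ hx
      rw [real_inner_smul_left, Option.elim_some, inner_labelVec_none, if_neg, mul_zero]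
      rintro ⟨h1, h2⟩
      exact hx (Prod.ext h1 h2)
    · simp
  · rfl

lemma realize_models (hloc : τ.LocalTo Δ) (s : ℕ) : (realize b τ Δ M hM0 hM).Models τ s :=
  ⟨rfl, rfl, fun q _ => realize_eval b hM0 hM hloc q⟩

/-- A local table with dyadic entries is the table of a symbolic limit transformer. -/
theorem exists_isSymbolicLimit {p : ℕ} (hloc : τ.LocalTo Δ) (hdy : τ.Dyadic p) :
    ∃ (H : Type) (_ : NormedAddCommGroup H) (_ : InnerProductSpace ℝ H) (_ : CompleteSpace H)
      (W : Weights S ⊤ H L Hd D), IsSymbolicLimit W.tr ∧ ∀ s, W.Models τ s := by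
  obtain ⟨M, hM0, hM⟩ := hloc.exists_bound
  -- Expressibility asks for a space in `Type`, while `S` may live in any universe; kinds are
  -- therefore replaced by a finite ordinal in the index set of the basis.
  obtain ⟨n, ⟨e⟩⟩ := Finite.exists_equiv_fin (Kind S L D)
  let e' : Cell S ⊤ L Hd D ≃ (Fin L → Option (Fin Hd)) × Fin n × Option (Idx ⊤) :=
    (Equiv.refl _).prodCongr (e.prodCongr (Equiv.refl _))
  let b₀ : HilbertBasis ((Fin L → Option (Fin Hd)) × Fin n × Option (Idx ⊤)) ℝ
    (lp (fun _ : (Fin L → Option (Fin Hd)) × Fin n × Option (Idx ⊤) => ℝ) 2) :=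
    HilbertBasis.ofRepr (LinearIsometryEquiv.refl ℝ _)
  obtain ⟨b, -⟩ := exists_hilbertBasis_equiv b₀ e'
  refine ⟨lp (fun _ : (Fin L → Option (Fin Hd)) × Fin n × Option (Idx ⊤) => ℝ) 2, inferInstance,
    inferInstance, inferInstance, realize b τ Δ M hM0 hM, ?_, realize_models b hM0 hM hloc⟩
  refine ⟨⟨2, fun i => norm_labelVec_le b _ _, fun k => norm_labelVec_le b _ _⟩, ⟨p, ?_⟩,
    Weights.translationInvariant_of_models (realize_models b hM0 hM hloc), ?_⟩
  · rw [Weights.productsDyadic_iff]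
    intro q
    rw [realize_eval b hM0 hM hloc]
    exact hdy _ _
  · rw [Weights.isLocal_iff]
    refine ⟨Δ, fun q hq => ?_⟩
    rw [realize_eval b hM0 hM hloc]
    exact hloc _ _ hq

end

/-! ### Realization in finite contexts with a uniform bound on the regularizer -/

instance Idx.finite (n : ℕ) : Finite (Idx (n : ℕ∞)) :=
  Finite.of_injective (fun k : Idx (n : ℕ∞) => (⟨k, by exact_mod_cast k.2⟩ : Fin n)) fun a b h =>
    Subtype.ext (by simpa using h)

instance Token.finite {S ι : Type*} [Finite S] [Finite ι] : Finite (Token S ι) := by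
  refine Finite.of_surjective (fun z : Option (S ⊕ ι) => (match z with
    | none => .start
    | some (.inl σ) => .fin σ
    | some (.inr k) => .chr k : Token S ι)) ?_
  rintro (_ | σ | k)
  exacts [⟨none, rfl⟩, ⟨some (.inl σ), rfl⟩, ⟨some (.inr k), rfl⟩]

/-- A sum over pairs of indices that is supported near the corner. -/
lemma sum_corner_le {n Δ : ℕ} {F : Fin n → Fin n → ℝ} {c : ℝ} (hc : 0 ≤ c)
    (hF : ∀ i j, F i j ≤ c) (h0 : ∀ i j : Fin n, ¬ ((i : ℕ) ≤ Δ ∧ (j : ℕ) ≤ Δ) → F i j = 0) :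
    ∑ i, ∑ j, F i j ≤ ((Δ : ℝ) + 1) ^ 2 * c := by
  classical
  rw [← Fintype.sum_prod_type' F]
  rw [← Finset.sum_filter_add_sum_filter_not _ fun x : Fin n × Fin n =>
    (x.1 : ℕ) ≤ Δ ∧ (x.2 : ℕ) ≤ Δ]
  rw [Finset.sum_eq_zero (s := Finset.univ.filter fun x : Fin n × Fin n =>
    ¬ ((x.1 : ℕ) ≤ Δ ∧ (x.2 : ℕ) ≤ Δ)) fun x hx => h0 _ _ (Finset.mem_filter.1 hx).2, add_zero]
  refine (Finset.sum_le_card_nsmul _ _ c fun x _ => hF _ _).trans ?_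
  rw [nsmul_eq_mul]
  refine mul_le_mul_of_nonneg_right ?_ hc
  have : (Finset.univ.filter fun x : Fin n × Fin n => (x.1 : ℕ) ≤ Δ ∧ (x.2 : ℕ) ≤ Δ).card ≤
      (Finset.range (Δ + 1) ×ˢ Finset.range (Δ + 1)).card := by
    refine Finset.card_le_card_of_injOn (fun x => ((x.1 : ℕ), (x.2 : ℕ))) (fun x hx => ?_)
      (fun x _ y _ h => ?_)
    · have := (Finset.mem_filter.1 hx).2
      simp only [Finset.coe_product, Finset.coe_range, Set.mem_prod, Set.mem_Iio]
      omega
    · simp only [Prod.mk.injEq] at h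
      exact Prod.ext (Fin.ext h.1) (Fin.ext h.2)
  rw [Finset.card_product, Finset.card_range] at this
  calc _ ≤ (((Δ + 1) * (Δ + 1) : ℕ) : ℝ) := by exact_mod_cast this
    _ = _ := by push_cast; ring

section

variable {S : Type*} [Finite S] {N : ℕ∞} {L Hd D : ℕ}
  {H : Type*} [NormedAddCommGroup H] [InnerProductSpace ℝ H]

section

variable (b : HilbertBasis (Cell S N L Hd D) ℝ H) {τ : Table S L Hd D} {Δ : ℕ} {M : ℝ}
  (hM0 : 0 ≤ M) (hM : ∀ σ δ, |τ.val σ δ| ≤ M)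

lemma realize_Q_basis (l : Fin L) (h : Fin Hd) (c : Cell S N L Hd D) :
    (realize b τ Δ M hM0 hM).Q l h (b c) = ∑ x ∈ Finset.univ ×ˢ Finset.Icc (-(Δ : ℤ)) Δ,
      τ.val (.attn l h x.1.1 x.1.2.1 x.1.2.2.1 x.1.2.2.2) x.2 • (attnMap x c).elim 0 b := by
  change (∑ x ∈ Finset.univ ×ˢ Finset.Icc (-(Δ : ℤ)) Δ,
      τ.val (.attn l h x.1.1 x.1.2.1 x.1.2.2.1 x.1.2.2.2) x.2 •
        partialPerm b (attnMap x)) (b c) = _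
  rw [sum_apply]
  refine Finset.sum_congr rfl fun x _ => ?_
  rw [smul_apply, partialPerm_apply b (attnMap_injective x)]

lemma norm_realize_Q_le (l : Fin L) (h : Fin Hd) :
    ‖(realize b τ Δ M hM0 hM).Q l h‖ ≤ slotCount S L Hd D Δ * M := by
  refine (norm_sum_le _ _).trans ?_
  rw [slotCount, ← nsmul_eq_mul]
  refine Finset.sum_le_card_nsmul _ _ _ fun x _ => ?_
  rw [norm_smul, Real.norm_eq_abs]
  calc _ ≤ M * 1 := mul_le_mul (hM _ _) (norm_partialPerm_le b _) (norm_nonneg _) hM0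
    _ = M := mul_one M

end

section

variable {n d : ℕ} (b : HilbertBasis (Cell S (n : ℕ∞) L Hd D) ℝ (EuclideanSpace ℝ (Fin d)))
  {τ : Table S L Hd D} {Δ : ℕ} {M : ℝ} (hM0 : 0 ≤ M) (hM : ∀ σ δ, |τ.val σ δ| ≤ M)

/-- Every standard basis vector is a cell vector, so matrix entries are inner products of cell
vectors with images of cell vectors: integers or sums of table entries. -/
lemma realize_hasPrecision {p : ℕ} (hdy : τ.Dyadic p)
    (hb : ∀ a, ∃ c, b c = EuclideanSpace.single a 1) :
    (realize b τ Δ M hM0 hM).tr.HasPrecision p := by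
  have hco : ∀ (z : EuclideanSpace ℝ (Fin d)), (∀ c, IsDyadic p (inner ℝ (b c) z)) →
      ∀ a, IsDyadic p (z a) := by
    intro z hz a
    obtain ⟨c, hc⟩ := hb a
    have := hz c
    rw [hc, EuclideanSpace.inner_single_left] at this
    simpa using this
  refine ⟨fun ω => hco _ fun c => isDyadic_inner_labelVec b p c _ _,
    fun i => hco _ fun c => isDyadic_inner_labelVec b p c _ _,
    fun l h a => hco _ fun c => ?_, fun l h a => hco _ fun c => ?_, fun l h a => hco _ fun c => ?_,
    fun l a s => ?_, fun l s => hco _ fun c => ?_, fun l s => hdy _ _, fun a ω => ?_⟩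
  · obtain ⟨c', hc⟩ := hb a
    rw [← hc]
    exact isDyadic_inner_elim b p c (some c')
  · obtain ⟨c', hc⟩ := hb a
    rw [← hc, realize_Q_basis]
    exact isDyadic_inner_sum b _ _ (fun _ _ => hdy _ _) c
  · obtain ⟨c', hc⟩ := hb a
    rw [← hc]
    change IsDyadic p (inner ℝ (b c) (partialPerm b (valueMap l h) (b c')))
    rw [partialPerm_apply b (valueMap_injective l h)]
    exact isDyadic_inner_elim b p c _
  · obtain ⟨c', hc⟩ := hb a
    rw [← hc]
    change IsDyadic p (inner ℝ (mlpRow b τ l s) (b c'))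
    rw [real_inner_comm]
    exact isDyadic_inner_sum b _ _ (fun _ _ => hdy _ _) c'
  · rw [realize_B_single]
    exact isDyadic_inner_elim b p c (some _)
  · obtain ⟨c', hc⟩ := hb a
    rw [← hc]
    change IsDyadic p (inner ℝ (unembedRow b τ Δ ω) (b c'))
    rw [real_inner_comm]
    exact isDyadic_inner_sum b _ _ (fun _ _ => hdy _ _) c'

variable (S L Hd D) in
/-- A bound on the regularizer of `realize`, independent of the context width. -/
def regBound (p r Δ : ℕ) (M : ℝ) : ℝ :=
  (L : ℝ) + Hd + p + r + slotCount S L Hd D Δ * M + 1 +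
  √(∑ _s : Fin D,
    (((Finset.univ : Finset ((Fin L → Option (Fin Hd)) × Kind S L D)).card : ℝ) * M) ^ 2) +
  √(∑ _s : Fin D, 1 ^ 2) + rowCount S L Hd D Δ * M + 2 + 2 + √(∑ _s : Fin D, M ^ 2) +
  ((∑ _l : Fin L, ∑ _h : Fin Hd, ∑ _C₁ : Fin L → Option (Fin Hd),
      ∑ _C₂ : Fin L → Option (Fin Hd), ((Δ : ℝ) + 1) ^ 2 * (M ^ 2 + M ^ 2)) +
    ∑ _C : Fin L → Option (Fin Hd), ((Δ : ℝ) + 1) ^ 2 * M ^ 2)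

/-- Everything but the penalty is bounded by counting slots, displacements and hidden units. In the
penalty, a pair with one index `0` has the other index as its distance, so locality leaves only
pairs with both indices at most `Δ`. -/
lemma realize_reg_le {p : ℕ} (hloc : τ.LocalTo Δ)
    (hp : (realize b τ Δ M hM0 hM).tr.HasPrecision p)
    (hi : (realize b τ Δ M hM0 hM).tr.TranslationInvariant) :
    (⟨d, p, (realize b τ Δ M hM0 hM).tr, hp, hi⟩ : Hypothesis S n).reg ≤
      regBound S L Hd D p τ.rnd Δ M := by
  have hcorner : ∀ {i j : Fin n}, ((i : ℕ) = 0 ∨ (j : ℕ) = 0) → ¬ ((i : ℕ) ≤ Δ ∧ (j : ℕ) ≤ Δ) →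
      (Δ : ℤ) < |((i : ℕ) : ℤ) - (j : ℕ)| := by
    intro i j h h'
    rw [lt_abs]
    omega
  have hsq : ∀ {x : ℝ}, |x| ≤ M → |x| ^ 2 ≤ M ^ 2 := fun h => pow_le_pow_left₀ (abs_nonneg _) h 2
  have hev := realize_eval b hM0 hM hloc
  unfold Hypothesis.reg regBound
  refine add_le_add (add_le_add (add_le_add (add_le_add (add_le_add (add_le_add (add_le_add
    (add_le_add (add_le_add le_rfl ?_) ?_) ?_) ?_) ?_) ?_) ?_) ?_) ?_
  · refine Real.iSup_le (fun lh => ?_) (mul_nonneg (Nat.cast_nonneg _) hM0)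
    refine (ContinuousLinearMap.opNorm_comp_le _ _).trans ?_
    refine (mul_le_of_le_one_left (norm_nonneg _) ?_).trans (norm_realize_Q_le b hM0 hM _ _)
    rw [LinearIsometryEquiv.norm_map]
    exact ContinuousLinearMap.norm_id_le
  · exact Real.iSup_le (fun lh => norm_partialPerm_le b _) zero_le_one
  · refine Real.iSup_le (fun l => Real.sqrt_le_sqrt ?_) (Real.sqrt_nonneg _)
    have h1 : ∀ a : Fin d, ‖(realize b τ Δ M hM0 hM).A l (EuclideanSpace.single a 1)‖ ^ 2 =
        ∑ s, ‖mlpRow b τ l s a‖ ^ 2 := by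
      intro a
      rw [EuclideanSpace.norm_sq_eq]
      refine Finset.sum_congr rfl fun s _ => ?_
      change ‖(inner ℝ (mlpRow b τ l s) (EuclideanSpace.single a 1) : ℝ)‖ ^ 2 = _
      rw [EuclideanSpace.inner_single_right]
      simp
    refine (le_of_eq (Finset.sum_congr rfl fun a _ => h1 a)).trans ?_
    -- The Frobenius norm of `A_l` is summed by rows, whose norms do not depend on the dimension
    -- `d`.
    rw [Finset.sum_comm]
    refine Finset.sum_le_sum fun s _ => ?_
    rw [← EuclideanSpace.norm_sq_eq]
    exact pow_le_pow_left₀ (norm_nonneg _) (norm_mlpRow_le b hM l s) 2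
  · refine Real.iSup_le (fun l => Real.sqrt_le_sqrt ?_) (Real.sqrt_nonneg _)
    refine Finset.sum_le_sum fun s _ => ?_
    rw [realize_B_single, b.orthonormal.1]
  · exact norm_rowsOp_le _ _ (mul_nonneg (Nat.cast_nonneg _) hM0) (norm_unembedRow_le b Δ hM)
  · exact Real.iSup_le (fun i => norm_labelVec_le b _ _) zero_le_two
  · exact Real.iSup_le (fun i => norm_labelVec_le b _ _) zero_le_two
  · refine Real.iSup_le (fun l => ?_) (Real.sqrt_nonneg _)
    rw [EuclideanSpace.norm_eq]
    refine Real.sqrt_le_sqrt (Finset.sum_le_sum fun s _ => ?_)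
    exact hsq (hM _ _)
  · unfold Hypothesis.zeta
    refine add_le_add ?_ ?_
    · refine Finset.sum_le_sum fun l _ => Finset.sum_le_sum fun h _ =>
        Finset.sum_le_sum fun C₁ _ => Finset.sum_le_sum fun C₂ _ => ?_
      refine sum_corner_le (by positivity) (fun i j => ?_) (fun i j hij => ?_)
      · split_ifs
        · refine add_le_add ?_ ?_
          · refine hsq ((congrArg abs (hev (.attn l h C₁ C₂ (.pos (Hypothesis.index i))
              (.pos (Hypothesis.index j))))).trans_le (hM _ _))
          · refine hsq ((congrArg abs (hev (.attn l h C₁ C₂ (.emb (.chr (Hypothesis.index i)))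
              (.emb (.chr (Hypothesis.index j)))))).trans_le (hM _ _))
        · positivity
      · split_ifs with h0
        · have e1 := hev (.attn l h C₁ C₂ (.pos (Hypothesis.index i))
            (.pos (Hypothesis.index j)))
          have e2 := hev (.attn l h C₁ C₂ (.emb (.chr (Hypothesis.index i)))
            (.emb (.chr (Hypothesis.index j))))
          rw [hloc _ _ (by
            change _ < |OutVec.disp _ _|
            first | rw [OutVec.disp_pos] | rw [OutVec.disp_chr]
            exact hcorner h0 hij)] at e1 e2
          change |(realize b τ Δ M hM0 hM).eval (.attn l h C₁ C₂ (.pos (Hypothesis.index i))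
            (.pos (Hypothesis.index j)))| ^ 2 + |(realize b τ Δ M hM0 hM).eval
            (.attn l h C₁ C₂ (.emb (.chr (Hypothesis.index i)))
            (.emb (.chr (Hypothesis.index j))))| ^ 2 = 0
          rw [e1, e2]
          simp
        · rfl
    · refine Finset.sum_le_sum fun C _ => ?_
      refine sum_corner_le (by positivity) (fun i j => ?_) (fun i j hij => ?_)
      · split_ifs
        · exact hsq ((congrArg abs (hev (.unembed C (.chr (Hypothesis.index i))
            (.emb (.chr (Hypothesis.index j)))))).trans_le (hM _ _))
        · positivity
      · split_ifs with h0
        · have e1 := hev (.unembed C (.chr (Hypothesis.index i))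
            (.emb (.chr (Hypothesis.index j))))
          rw [hloc _ _ (by
            change _ < |OutVec.disp _ _|
            first | rw [OutVec.disp_pos] | rw [OutVec.disp_chr]
            exact hcorner h0 hij)] at e1
          change |(realize b τ Δ M hM0 hM).eval (.unembed C (.chr (Hypothesis.index i))
            (.emb (.chr (Hypothesis.index j))))| ^ 2 = 0
          rw [e1]
          simp
        · rfl

end

/-- A local table with dyadic entries is the table of hypotheses of every context width whose
regularizers are bounded. -/
theorem exists_hypothesis_of_table {τ : Table S L Hd D} {Δ p : ℕ} (hloc : τ.LocalTo Δ)
    (hdy : τ.Dyadic p) :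
    ∃ C : ℝ, ∀ n : ℕ, ∃ G : Hypothesis S n, G.reg ≤ C ∧
      ∃ W : Weights S (n : ℕ∞) (EuclideanSpace ℝ (Fin G.d)) L Hd D,
        G.T = W.tr ∧ ∀ s, W.Models τ s := by
  obtain ⟨M, hM0, hM⟩ := hloc.exists_bound
  refine ⟨regBound S L Hd D p τ.rnd Δ M, fun n => ?_⟩
  obtain ⟨d, ⟨e⟩⟩ := Finite.exists_equiv_fin (Cell S (n : ℕ∞) L Hd D)
  obtain ⟨b, hb⟩ := exists_hilbertBasis_equiv (EuclideanSpace.basisFun (Fin d) ℝ).toHilbertBasis e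
  have hb' : ∀ a, ∃ c, b c = EuclideanSpace.single a 1 := by
    intro a
    refine ⟨e.symm a, ?_⟩
    rw [hb, e.apply_symm_apply, OrthonormalBasis.coe_toHilbertBasis, EuclideanSpace.basisFun_apply]
  exact ⟨⟨d, p, (realize b τ Δ M hM0 hM).tr, realize_hasPrecision b hM0 hM hdy hb',
    Weights.translationInvariant_of_models (realize_models b hM0 hM hloc)⟩,
    realize_reg_le b hM0 hM hloc _ _, realize b τ Δ M hM0 hM, rfl, realize_models b hM0 hM hloc⟩

end

/-! ### Product functions of hypotheses with bounded regularizer -/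

/-- The counter advances with every layer, whether or not the chain uses it, so estimates end at the
depth for every chain. It serves for growth of norms and of precision. -/
lemma Transformer.chainProd_induction {S : Type*} {N : ℕ∞} {H : Type*} [NormedAddCommGroup H]
    [InnerProductSpace ℝ H] (T : Transformer S N H) (P : ℕ → H → Prop)
    (h1 : ∀ k z, P k z → P (k + 1) z) (h2 : ∀ k z l h, P k z → P (k + 1) (T.V l h z))
    (C : T.Chain) (z : H) (h0 : P 0 z) : P T.depth (T.chainProd C z) := by
  have key : ∀ (t : List (Fin T.depth)) (k : ℕ) (M : H →L[ℝ] H), P k (M z) →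
      P (k + t.length) (t.foldl (fun M l => match C l with
        | none => M
        | some h => (T.V l h).comp M) M z) := by
    intro t
    induction t with
    | nil => intro k M h; exact h
    | cons a t ih =>
      intro k M h
      rw [List.foldl_cons, List.length_cons, add_comm t.length, ← add_assoc]
      apply ih
      rcases C a with _ | h'
      · exact h1 _ _ h
      · exact h2 _ _ _ _ h
  have := key (List.finRange T.depth) 0 (ContinuousLinearMap.id ℝ H) h0
  rw [List.length_finRange, zero_add] at this
  exact this

/-! ### Coordinates, precision and norms in Euclidean spaces -/

section Euclidean

variable {d d' : ℕ}

lemma euclidean_eq_sum (z : EuclideanSpace ℝ (Fin d)) :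
    z = ∑ a, z a • EuclideanSpace.single a (1 : ℝ) := by
  ext t
  simp [Finset.sum_apply, Pi.single_apply]

lemma isDyadic_functional {p q : ℕ} (f : EuclideanSpace ℝ (Fin d) →ₗ[ℝ] ℝ)
    (hf : ∀ a, IsDyadic p (f (EuclideanSpace.single a 1))) {z : EuclideanSpace ℝ (Fin d)}
    (hz : ∀ a, IsDyadic q (z a)) : IsDyadic (q + p) (f z) := by
  rw [euclidean_eq_sum z, map_sum]
  refine isDyadic_sum _ fun a _ => ?_
  rw [map_smul, smul_eq_mul]
  exact (hz a).mul (hf a)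

lemma isDyadic_apply {p q : ℕ} (M : EuclideanSpace ℝ (Fin d) →L[ℝ] EuclideanSpace ℝ (Fin d'))
    (hM : ∀ a a', IsDyadic p (M (EuclideanSpace.single a 1) a')) {z : EuclideanSpace ℝ (Fin d)}
    (hz : ∀ a, IsDyadic q (z a)) (a' : Fin d') : IsDyadic (q + p) (M z a') :=
  isDyadic_functional (((EuclideanSpace.proj a' : EuclideanSpace ℝ (Fin d') →L[ℝ] ℝ).comp
    M).toLinearMap) (fun a => hM a a') hz

lemma isDyadic_inner {p q : ℕ} {y z : EuclideanSpace ℝ (Fin d)}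
    (hy : ∀ a, IsDyadic p (y a)) (hz : ∀ a, IsDyadic q (z a)) :
    IsDyadic (p + q) (inner ℝ y z) := by
  rw [PiLp.inner_apply]
  refine isDyadic_sum _ fun a _ => ?_
  have := (hy a).mul (hz a)
  simpa [mul_comm] using this

/-- The Frobenius norm bounds the spectral norm. -/
lemma norm_apply_le_frobenius {H : Type*} [NormedAddCommGroup H] [InnerProductSpace ℝ H]
    (M : EuclideanSpace ℝ (Fin d) →L[ℝ] H) (z : EuclideanSpace ℝ (Fin d)) :
    ‖M z‖ ≤ √(∑ a, ‖M (EuclideanSpace.single a 1)‖ ^ 2) * ‖z‖ := by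
  conv_lhs => rw [euclidean_eq_sum z, map_sum]
  refine (norm_sum_le _ _).trans ?_
  simp only [map_smul, norm_smul]
  refine (Real.sum_mul_le_sqrt_mul_sqrt _ _ _).trans ?_
  rw [mul_comm, EuclideanSpace.norm_eq]

/-- A nonzero integer has absolute value at least `1`. This gap bounds the number of active hidden
units and gives a minimal price to every long-range interaction. -/
lemma IsDyadic.le_abs {p : ℕ} {x : ℝ} (hx : IsDyadic p x) (h0 : x ≠ 0) : (2 ^ p : ℝ)⁻¹ ≤ |x| := by
  obtain ⟨m, rfl⟩ := hx
  have hm : m ≠ 0 := by rintro rfl; simp at h0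
  have : (1 : ℝ) ≤ |(m : ℝ)| := by exact_mod_cast Int.one_le_abs hm
  rw [abs_div, abs_of_pos (by positivity : (0 : ℝ) < 2 ^ p), ← one_div]
  exact div_le_div_of_nonneg_right this (by positivity)

lemma finite_dyadic (p : ℕ) (M : ℝ) : {x : ℝ | IsDyadic p x ∧ |x| ≤ M}.Finite := by
  refine ((Set.finite_Icc (-⌈M * 2 ^ p⌉) ⌈M * 2 ^ p⌉).image
    fun m : ℤ => (m : ℝ) / 2 ^ p).subset ?_
  rintro x ⟨⟨m, rfl⟩, hx⟩
  refine ⟨m, ?_, rfl⟩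
  rw [abs_div, abs_of_pos (by positivity : (0 : ℝ) < 2 ^ p), div_le_iff₀ (by positivity)] at hx
  have : |m| ≤ ⌈M * 2 ^ p⌉ := by
    have := hx.trans (Int.le_ceil _)
    exact_mod_cast this
  exact abs_le.1 this

end Euclidean

/-! ### Consequences of a bound on the regularizer -/

namespace Hypothesis

variable {S : Type*} {n : ℕ}

lemma zeta_nonneg (G : Hypothesis S n) : 0 ≤ G.zeta := by
  unfold zeta
  refine add_nonneg ?_ ?_
  · refine Finset.sum_nonneg fun _ _ => Finset.sum_nonneg fun _ _ => Finset.sum_nonneg fun _ _ =>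
      Finset.sum_nonneg fun _ _ => Finset.sum_nonneg fun _ _ => Finset.sum_nonneg fun _ _ => ?_
    split_ifs <;> positivity
  · refine Finset.sum_nonneg fun _ _ => Finset.sum_nonneg fun _ _ => Finset.sum_nonneg fun _ _ => ?_
    split_ifs <;> positivity

lemma reg_nonneg (G : Hypothesis S n) : 0 ≤ G.reg := by
  unfold reg
  have h1 := Real.iSup_nonneg (fun lh : Fin G.T.depth × Fin G.T.heads => norm_nonneg
    ((ContinuousLinearMap.adjoint (G.T.K lh.1 lh.2)).comp (G.T.Q lh.1 lh.2)))
  have h2 := Real.iSup_nonneg (fun lh : Fin G.T.depth × Fin G.T.heads =>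
    norm_nonneg (G.T.V lh.1 lh.2))
  have h3 := Real.iSup_nonneg (fun l : Fin G.T.depth =>
    Real.sqrt_nonneg (∑ a : Fin G.d, ‖G.T.A l (EuclideanSpace.single a 1)‖ ^ 2))
  have h4 := Real.iSup_nonneg (fun l : Fin G.T.depth =>
    Real.sqrt_nonneg (∑ s : Fin G.T.dff, ‖G.T.B l (EuclideanSpace.single s 1)‖ ^ 2))
  have h5 := Real.iSup_nonneg (fun i : Idx (n : ℕ∞) => norm_nonneg (G.T.pos i))
  have h6 := Real.iSup_nonneg (fun ω : Token S (Idx (n : ℕ∞)) => norm_nonneg (G.T.emb ω))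
  have h7 := Real.iSup_nonneg (fun l : Fin G.T.depth => norm_nonneg (G.T.b l))
  have h8 := G.zeta_nonneg
  positivity

/-- All terms of the regularizer are at most `C`. -/
structure RegBounded (G : Hypothesis S n) (C : ℝ) : Prop where
  dims : (G.T.depth : ℝ) + G.T.heads + G.prec + G.T.rnd ≤ C
  attn : ∀ l h, ‖(ContinuousLinearMap.adjoint (G.T.K l h)).comp (G.T.Q l h)‖ ≤ C
  value : ∀ l h, ‖G.T.V l h‖ ≤ C
  mlpA : ∀ l, √(∑ a : Fin G.d, ‖G.T.A l (EuclideanSpace.single a 1)‖ ^ 2) ≤ C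
  mlpB : ∀ l, √(∑ s : Fin G.T.dff, ‖G.T.B l (EuclideanSpace.single s 1)‖ ^ 2) ≤ C
  unembed : ‖G.T.U‖ ≤ C
  pos : ∀ i, ‖G.T.pos i‖ ≤ C
  emb : ∀ ω, ‖G.T.emb ω‖ ≤ C
  bias : ∀ l, ‖G.T.b l‖ ≤ C

/-- All summands of the regularizer are nonnegative, so each is at most the sum; finiteness of the
index sets makes each supremum an upper bound of its family. -/
lemma regBounded [Finite S] {G : Hypothesis S n} {C : ℝ} (h : G.reg ≤ C) : G.RegBounded C := by
  unfold reg at h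
  have h1 := Real.iSup_nonneg (fun lh : Fin G.T.depth × Fin G.T.heads => norm_nonneg
    ((ContinuousLinearMap.adjoint (G.T.K lh.1 lh.2)).comp (G.T.Q lh.1 lh.2)))
  have h2 := Real.iSup_nonneg (fun lh : Fin G.T.depth × Fin G.T.heads =>
    norm_nonneg (G.T.V lh.1 lh.2))
  have h3 := Real.iSup_nonneg (fun l : Fin G.T.depth =>
    Real.sqrt_nonneg (∑ a : Fin G.d, ‖G.T.A l (EuclideanSpace.single a 1)‖ ^ 2))
  have h4 := Real.iSup_nonneg (fun l : Fin G.T.depth =>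
    Real.sqrt_nonneg (∑ s : Fin G.T.dff, ‖G.T.B l (EuclideanSpace.single s 1)‖ ^ 2))
  have h5 := Real.iSup_nonneg (fun i : Idx (n : ℕ∞) => norm_nonneg (G.T.pos i))
  have h6 := Real.iSup_nonneg (fun ω : Token S (Idx (n : ℕ∞)) => norm_nonneg (G.T.emb ω))
  have h7 := Real.iSup_nonneg (fun l : Fin G.T.depth => norm_nonneg (G.T.b l))
  have h8 := G.zeta_nonneg
  have h9 := norm_nonneg G.T.U
  have h10 : (0 : ℝ) ≤ (G.T.depth : ℝ) + G.T.heads + G.prec + G.T.rnd := by positivity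
  refine ⟨by linarith, fun l a => ?_, fun l a => ?_, fun l => ?_, fun l => ?_, by linarith,
    fun i => ?_, fun ω => ?_, fun l => ?_⟩
  · refine (le_ciSup (f := fun lh : Fin G.T.depth × Fin G.T.heads =>
      ‖(ContinuousLinearMap.adjoint (G.T.K lh.1 lh.2)).comp (G.T.Q lh.1 lh.2)‖)
      (Set.finite_range _).bddAbove (l, a)).trans ?_
    linarith
  · refine (le_ciSup (f := fun lh : Fin G.T.depth × Fin G.T.heads => ‖G.T.V lh.1 lh.2‖)
      (Set.finite_range _).bddAbove (l, a)).trans ?_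
    linarith
  · refine (le_ciSup (f := fun l : Fin G.T.depth =>
      √(∑ a : Fin G.d, ‖G.T.A l (EuclideanSpace.single a 1)‖ ^ 2))
      (Set.finite_range _).bddAbove l).trans ?_
    linarith
  · refine (le_ciSup (f := fun l : Fin G.T.depth =>
      √(∑ s : Fin G.T.dff, ‖G.T.B l (EuclideanSpace.single s 1)‖ ^ 2))
      (Set.finite_range _).bddAbove l).trans ?_
    linarith
  · refine (le_ciSup (f := fun i : Idx (n : ℕ∞) => ‖G.T.pos i‖)
      (Set.finite_range _).bddAbove i).trans ?_
    linarith
  · refine (le_ciSup (f := fun ω : Token S (Idx (n : ℕ∞)) => ‖G.T.emb ω‖)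
      (Set.finite_range _).bddAbove ω).trans ?_
    linarith
  · refine (le_ciSup (f := fun l : Fin G.T.depth => ‖G.T.b l‖)
      (Set.finite_range _).bddAbove l).trans ?_
    linarith

/-- The precision of the product functions. -/
def evalPrec (G : Hypothesis S n) : ℕ := 2 * (G.T.depth * G.prec + 2 * G.prec)

/-- Precisions add under multiplication: one `prec` for the vector, one per layer of the chain, one
for the outer matrix, and the total doubles in an attention form. -/
lemma isDyadic_eval (G : Hypothesis S n)
    (q : LabelProbe S (n : ℕ∞) G.T.depth G.T.heads G.T.dff) :
    IsDyadic G.evalPrec (G.T.weights.eval q) := by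
  have hG := G.hasPrecision
  have hvec : ∀ (v : G.T.Out) a, IsDyadic G.prec (G.T.vec v a) := by
    rintro (i | ω | ⟨l, s⟩) a
    exacts [hG.pos i a, hG.emb ω a, hG.B l s a]
  have hch : ∀ (C : G.T.Chain) (v : G.T.Out) a,
      IsDyadic (G.T.depth * G.prec + G.prec) (G.T.chainProd C (G.T.vec v) a) := by
    intro C v
    refine G.T.chainProd_induction (fun k z => ∀ a, IsDyadic (k * G.prec + G.prec) (z a))
      (fun k z h a => ?_) (fun k z l h hz a => ?_) C _ (fun a => by simpa using hvec v a)
    · exact (h a).mono (by rw [add_mul]; omega)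
    · refine (isDyadic_apply _ (hG.V l h) hz a).mono (by rw [add_mul]; omega)
  have hle : G.T.depth * G.prec + G.prec + G.prec ≤ G.evalPrec := by unfold evalPrec; omega
  rcases q with ⟨l, h, C₁, C₂, v, w⟩ | ⟨C, ω, w⟩ | ⟨C, l, s, w⟩ | ⟨l, s⟩
  · refine (isDyadic_inner (isDyadic_apply _ (hG.K l h) (hch C₁ v))
      (isDyadic_apply _ (hG.Q l h) (hch C₂ w))).mono ?_
    unfold evalPrec; omega
  · exact (isDyadic_functional
      (f := { toFun := fun z => G.T.U z ω, map_add' := by simp, map_smul' := by simp })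
      (fun a => hG.U a ω) (hch C w)).mono hle
  · exact (isDyadic_apply _ (hG.A l) (hch C w) s).mono hle
  · exact (hG.b l s).mono (by unfold evalPrec; omega)

/-- A bound on the product functions in terms of a bound on the regularizer. -/
def evalBound (C : ℝ) : ℝ := (1 + C) * ((1 + C) ^ ⌈C⌉₊ * (1 + C)) ^ 2

lemma RegBounded.nonneg {G : Hypothesis S n} {C : ℝ} (hC : G.RegBounded C) : 0 ≤ C :=
  le_trans (by positivity) hC.dims

lemma RegBounded.depth_le {G : Hypothesis S n} {C : ℝ} (hC : G.RegBounded C) :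
    G.T.depth ≤ ⌈C⌉₊ ∧ G.T.heads ≤ ⌈C⌉₊ ∧ G.prec ≤ ⌈C⌉₊ ∧ G.T.rnd ≤ ⌈C⌉₊ := by
  have h := hC.dims.trans (Nat.le_ceil C)
  have : G.T.depth + G.T.heads + G.prec + G.T.rnd ≤ ⌈C⌉₊ := by exact_mod_cast h
  omega

/-- A chain stretches a vector by at most `R` per layer. The attention form is estimated through
`KᵀQ`, since `K` and `Q` are not bounded separately. -/
lemma abs_eval_le {G : Hypothesis S n} {C : ℝ} (hC : G.RegBounded C)
    (q : LabelProbe S (n : ℕ∞) G.T.depth G.T.heads G.T.dff) :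
    |G.T.weights.eval q| ≤ evalBound C := by
  have h0 := hC.nonneg
  -- With `1 + C` in place of `C` the base is at least `1`, so its powers increase with the depth.
  have h1 : (1 : ℝ) ≤ 1 + C := by linarith
  set R := 1 + C with hR
  set X := R ^ ⌈C⌉₊ * R with hX
  have hX1 : 1 ≤ X := by
    rw [hX]; exact one_le_mul_of_one_le_of_one_le (one_le_pow₀ h1) h1
  have hXX : X ≤ X ^ 2 := by nlinarith
  have hvec : ∀ v : G.T.Out, ‖G.T.vec v‖ ≤ R := by
    rintro (i | ω | ⟨l, s⟩)
    · exact (hC.pos i).trans (by linarith)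
    · exact (hC.emb ω).trans (by linarith)
    · have h2 := norm_apply_le_frobenius (G.T.B l) (EuclideanSpace.single s 1)
      rw [PiLp.norm_single, norm_one, mul_one] at h2
      exact h2.trans ((hC.mlpB l).trans (by linarith))
  have hch : ∀ (D : G.T.Chain) (v : G.T.Out), ‖G.T.chainProd D (G.T.vec v)‖ ≤ X := by
    intro D v
    have : ‖G.T.chainProd D (G.T.vec v)‖ ≤ R ^ G.T.depth * R := by
      refine G.T.chainProd_induction (fun k z => ‖z‖ ≤ R ^ k * R)
        (fun k z h => ?_) (fun k z l h hz => ?_) D _ (by simpa using hvec v)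
      · refine h.trans (mul_le_mul_of_nonneg_right ?_ (by linarith))
        exact pow_le_pow_right₀ h1 (Nat.le_succ k)
      · refine ((G.T.V l h).le_opNorm z).trans ?_
        calc _ ≤ R * (R ^ k * R) :=
              mul_le_mul ((hC.value l h).trans (by linarith)) hz (norm_nonneg _) (by linarith)
          _ = _ := by ring
    exact this.trans (mul_le_mul_of_nonneg_right (pow_le_pow_right₀ h1 hC.depth_le.1) (by linarith))
  have hRX : R * X ≤ evalBound C := by
    change R * X ≤ R * X ^ 2
    exact mul_le_mul_of_nonneg_left hXX (by linarith)
  rcases q with ⟨l, h, C₁, C₂, v, w⟩ | ⟨D, ω, w⟩ | ⟨D, l, s, w⟩ | ⟨l, s⟩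
  · change |inner ℝ (G.T.K l h (G.T.chainProd C₁ (G.T.vec v)))
      (G.T.Q l h (G.T.chainProd C₂ (G.T.vec w)))| ≤ _
    rw [← ContinuousLinearMap.adjoint_inner_right]
    refine (abs_real_inner_le_norm _ _).trans ?_
    calc _ ≤ X * (R * X) := by
          refine mul_le_mul (hch C₁ v) ?_ (norm_nonneg _) (by linarith)
          refine (((ContinuousLinearMap.adjoint (G.T.K l h)).comp (G.T.Q l h)).le_opNorm
            (G.T.chainProd C₂ (G.T.vec w))).trans ?_
          exact mul_le_mul ((hC.attn l h).trans (by linarith)) (hch C₂ w) (norm_nonneg _)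
            (by linarith)
      _ = evalBound C := by change _ = R * X ^ 2; ring
  · refine le_trans ?_ hRX
    change ‖G.T.U (G.T.chainProd D (G.T.vec w)) ω‖ ≤ _
    refine (lp.norm_apply_le_norm ENNReal.top_ne_zero _ ω).trans ?_
    refine (G.T.U.le_opNorm _).trans ?_
    exact mul_le_mul (hC.unembed.trans (by linarith)) (hch D w) (norm_nonneg _) (by linarith)
  · refine le_trans ?_ hRX
    change ‖(G.T.A l (G.T.chainProd D (G.T.vec w))) s‖ ≤ _
    refine (PiLp.norm_apply_le _ s).trans ?_
    refine (norm_apply_le_frobenius _ _).trans ?_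
    exact mul_le_mul ((hC.mlpA l).trans (by linarith)) (hch D w) (norm_nonneg _) (by linarith)
  · refine le_trans ?_ hRX
    change ‖G.T.b l s‖ ≤ _
    refine (PiLp.norm_apply_le _ s).trans ?_
    refine (hC.bias l).trans ?_
    nlinarith

end Hypothesis

/-! ### Removing idle hidden units -/

namespace Weights

variable {S : Type*} {N : ℕ∞} {H : Type*} [NormedAddCommGroup H] [InnerProductSpace ℝ H]
  {L Hd D D' : ℕ}

/-- The transformer with only some of the hidden units. -/
def restrictUnits (W : Weights S N H L Hd D) (e : Fin D' → Fin D) : Weights S N H L Hd D' where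
  rnd := W.rnd
  emb := W.emb
  pos := W.pos
  K := W.K
  Q := W.Q
  V := W.V
  A l := ((PiLp.continuousLinearEquiv 2 ℝ fun _ : Fin D' => ℝ).symm :
      (Fin D' → ℝ) →L[ℝ] EuclideanSpace ℝ (Fin D')).comp
    (ContinuousLinearMap.pi fun s =>
      (EuclideanSpace.proj (e s) : EuclideanSpace ℝ (Fin D) →L[ℝ] ℝ).comp (W.A l))
  B l := ∑ s, (EuclideanSpace.proj s : EuclideanSpace ℝ (Fin D') →L[ℝ] ℝ).smulRight
    (W.B l (EuclideanSpace.single (e s) 1))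
  b l := WithLp.toLp 2 fun s => W.b l (e s)
  act l s := W.act l (e s)
  U := W.U

lemma restrictUnits_B_apply (W : Weights S N H L Hd D) (e : Fin D' → Fin D) (l : Fin L)
    (z : EuclideanSpace ℝ (Fin D')) :
    (W.restrictUnits e).B l z = ∑ s, z s • W.B l (EuclideanSpace.single (e s) 1) := by
  simp only [restrictUnits, sum_apply, ContinuousLinearMap.smulRight_apply]
  rfl

lemma restrictUnits_vec (W : Weights S N H L Hd D) (e : Fin D' → Fin D) (v : OutVec S N L D') :
    (W.restrictUnits e).tr.vec v = W.tr.vec (v.mapUnit e) := by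
  rcases v with i | ω | ⟨l, s⟩
  · rfl
  · rfl
  · refine (restrictUnits_B_apply W e l _).trans ?_
    rw [Finset.sum_eq_single s]
    · simp [OutVec.mapUnit, Transformer.vec]
    · intro t _ ht; simp [ht]
    · simp

lemma restrictUnits_eval (W : Weights S N H L Hd D) (e : Fin D' → Fin D)
    (q : LabelProbe S N L Hd D') :
    (W.restrictUnits e).eval q = W.eval (q.map e (OutVec.mapUnit e) id) := by
  have hch : ∀ (C : Fin L → Option (Fin Hd)) (v : OutVec S N L D'),
      (W.restrictUnits e).tr.chainProd C ((W.restrictUnits e).tr.vec v) =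
      W.tr.chainProd C (W.tr.vec (v.mapUnit e)) := by
    intro C v
    rw [restrictUnits_vec]
    have h : (W.restrictUnits e).tr.chainProd C = W.tr.chainProd C := by
      unfold Transformer.chainProd
      congr 1
      funext M l
      rcases C l with _ | h <;> rfl
    rw [h]
  rcases q with ⟨l, h, C₁, C₂, v, w⟩ | ⟨C, ω, w⟩ | ⟨C, l, s, w⟩ | ⟨l, s⟩
  · simp only [eval, Transformer.prodAttn, hch]
    rfl
  · simp only [eval, Transformer.prodUnembed, hch]
    rfl
  · simp only [eval, Transformer.prodMlp, hch]
    rfl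
  · rfl

lemma disp_mapUnit (e : Fin D' → Fin D) (q : LabelProbe S N L Hd D') :
    LabelProbe.disp (q.map e (OutVec.mapUnit e) id) = q.disp := by
  rcases q with ⟨l, h, C₁, C₂, v, w⟩ | ⟨C, ω, w⟩ | ⟨C, l, s, w⟩ | ⟨l, s⟩
  · exact OutVec.disp_mapUnit e v w
  · exact OutVec.disp_mapUnit e (.emb ω) w
  · rfl
  · rfl

lemma slot_mapUnit (e : Fin D' → Fin D) {q q' : LabelProbe S N L Hd D'} (h : q.slot = q'.slot) :
    LabelProbe.slot (q.map e (OutVec.mapUnit e) id) =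
      LabelProbe.slot (q'.map e (OutVec.mapUnit e) id) := by
  have hemb : ∀ ω ω' : Token S (Idx N), (OutVec.emb ω : OutVec S N L D').kind =
      (OutVec.emb ω').kind → (OutVec.emb ω : OutVec S N L D).kind = (OutVec.emb ω').kind :=
    fun ω ω' h => OutVec.kind_mapUnit e _ _ h
  rcases q with ⟨l, h, C₁, C₂, v, w⟩ | ⟨C, ω, w⟩ | ⟨C, l, s, w⟩ | ⟨l, s⟩ <;>
    rcases q' with ⟨l', h', C₁', C₂', v', w'⟩ | ⟨C', ω', w'⟩ | ⟨C', l', s', w'⟩ | ⟨l', s'⟩ <;>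
    simp only [LabelProbe.slot, Probe.map, Probe.attn.injEq, Probe.unembed.injEq,
      Probe.mlp.injEq, Probe.bias.injEq, reduceCtorEq, id] at h ⊢
  · obtain ⟨rfl, rfl, rfl, rfl, hv, hw⟩ := h
    exact ⟨rfl, rfl, rfl, rfl, OutVec.kind_mapUnit e _ _ hv, OutVec.kind_mapUnit e _ _ hw⟩
  · obtain ⟨rfl, hv, hw⟩ := h
    exact ⟨rfl, hemb _ _ hv, OutVec.kind_mapUnit e _ _ hw⟩
  · obtain ⟨rfl, rfl, rfl, hw⟩ := h
    exact ⟨rfl, rfl, rfl, OutVec.kind_mapUnit e _ _ hw⟩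
  · obtain ⟨rfl, rfl⟩ := h
    exact ⟨rfl, rfl⟩

lemma restrictUnits_translationInvariant {W : Weights S N H L Hd D} (e : Fin D' → Fin D)
    (hW : W.tr.TranslationInvariant) : (W.restrictUnits e).tr.TranslationInvariant := by
  rw [translationInvariant_iff] at hW ⊢
  intro q q' hs hd
  rw [restrictUnits_eval, restrictUnits_eval]
  exact hW _ _ (slot_mapUnit e hs) (by rw [disp_mapUnit, disp_mapUnit, hd])

/-- A unit whose column of `B` is zero writes nothing to the residual stream, whatever its
activation. -/
lemma restrictUnits_run (W : Weights S N H L Hd D) {e : Fin D' → Fin D}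
    (he : Function.Injective e)
    (hB : ∀ l s, s ∉ Set.range e → W.B l (EuclideanSpace.single s 1) = 0) (ε : ℝ) {m : ℕ}
    (y : Fin m → H) (l : ℕ) : (W.restrictUnits e).tr.run ε y l = W.tr.run ε y l := by
  have hmlp : ∀ l z, (W.restrictUnits e).tr.mlpBlock ε l z = W.tr.mlpBlock ε l z := by
    intro l z
    refine congrArg (z + ·) ?_
    refine (restrictUnits_B_apply W e l _).trans ?_
    have hr : W.B l (WithLp.toLp 2 fun s => (W.act l s).eval ε ((W.A l z + W.b l) s)) =
        ∑ s, (W.act l s).eval ε ((W.A l z + W.b l) s) •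
          W.B l (EuclideanSpace.single s 1) := by
      conv_lhs => rw [euclidean_eq_sum (WithLp.toLp 2 fun s =>
        (W.act l s).eval ε ((W.A l z + W.b l) s)), map_sum]
      simp only [map_smul]
    refine Eq.trans ?_ hr.symm
    refine Fintype.sum_of_injective e he _ _ (fun s hs => ?_) (fun s => rfl)
    rw [hB l s hs, smul_zero]
  induction l with
  | zero => rfl
  | succ l ih =>
    simp only [Transformer.run]
    split_ifs with hl
    · funext i
      rw [hmlp, ih]
      rfl
    · exact ih

lemma restrictUnits_logits (W : Weights S N H L Hd D) {e : Fin D' → Fin D}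
    (he : Function.Injective e)
    (hB : ∀ l s, s ∉ Set.range e → W.B l (EuclideanSpace.single s 1) = 0) (ε : ℝ) (x : Word S)
    (op oc : ℕ) : (W.restrictUnits e).tr.logits ε x op oc = W.tr.logits ε x op oc := by
  funext i ω
  rw [Transformer.logits, Transformer.logits, Transformer.states_eq_run, Transformer.states_eq_run]
  have := congrFun (restrictUnits_run W he hB ε (W.tr.init x op oc) L) i
  exact congrArg (fun z => W.U z ω) this

end Weights

namespace Hypothesis

variable {S : Type*} {n : ℕ}

/-- A bound on the number of hidden units that are not idle. -/
def unitBound (C : ℝ) : ℕ := ⌈C⌉₊ * ⌈C ^ 2 * (2 ^ ⌈C⌉₊) ^ 2⌉₊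

-- The regularizer does not charge for `dff` itself. But by precision a nonzero column of `B_l` has
-- norm at least `2 ^ (-c)`, and the squares of the norms add up to at most `C ^ 2`; summing over
-- layers gives the bound.
open Classical in
lemma RegBounded.card_active_le {G : Hypothesis S n} {C : ℝ} (hC : G.RegBounded C) :
    (Finset.univ.filter fun s : Fin G.T.dff =>
      ∃ l, G.T.B l (EuclideanSpace.single s 1) ≠ 0).card ≤ unitBound C := by
  set c := ⌈C⌉₊ with hc
  have hl : ∀ l, (Finset.univ.filter fun s : Fin G.T.dff =>
      G.T.B l (EuclideanSpace.single s 1) ≠ 0).card ≤ ⌈C ^ 2 * (2 ^ c) ^ 2⌉₊ := by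
    intro l
    set F := Finset.univ.filter fun s : Fin G.T.dff => G.T.B l (EuclideanSpace.single s 1) ≠ 0
    have h1 : ∀ s ∈ F, ((2 ^ c : ℝ)⁻¹) ^ 2 ≤ ‖G.T.B l (EuclideanSpace.single s 1)‖ ^ 2 := by
      intro s hs
      have hs := (Finset.mem_filter.1 hs).2
      obtain ⟨a, ha⟩ : ∃ a, G.T.B l (EuclideanSpace.single s 1) a ≠ 0 := by
        by_contra hn
        push Not at hn
        exact hs (by ext a; exact hn a)
      refine pow_le_pow_left₀ (by positivity) ?_ 2
      have h2 := ((G.hasPrecision.B l s a).mono hC.depth_le.2.2.1).le_abs ha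
      exact h2.trans (PiLp.norm_apply_le (G.T.B l (EuclideanSpace.single s 1)) a)
    have h2 : (F.card : ℝ) * ((2 ^ c : ℝ)⁻¹) ^ 2 ≤ C ^ 2 := by
      rw [← nsmul_eq_mul]
      refine (Finset.card_nsmul_le_sum _ _ _ h1).trans ?_
      refine (Finset.sum_le_sum_of_subset_of_nonneg (Finset.filter_subset _ _)
        fun _ _ _ => by positivity).trans ?_
      exact (Real.sqrt_le_left hC.nonneg).1 (hC.mlpB l)
    have h3 : (F.card : ℝ) ≤ C ^ 2 * (2 ^ c) ^ 2 := by
      rw [inv_pow, ← div_eq_mul_inv, div_le_iff₀ (by positivity)] at h2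
      exact h2
    exact_mod_cast h3.trans (Nat.le_ceil _)
  have hsub : (Finset.univ.filter fun s : Fin G.T.dff =>
      ∃ l, G.T.B l (EuclideanSpace.single s 1) ≠ 0) ⊆ Finset.univ.biUnion fun l =>
      Finset.univ.filter fun s : Fin G.T.dff => G.T.B l (EuclideanSpace.single s 1) ≠ 0 := by
    intro s hs
    simpa using hs
  refine (Finset.card_le_card hsub).trans ?_
  refine (Finset.card_biUnion_le_card_mul _ _ _ fun l _ => hl l).trans ?_
  rw [Finset.card_univ, Fintype.card_fin]
  exact Nat.mul_le_mul_right _ hC.depth_le.1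

end Hypothesis

/-! ### Finitely many tables -/

instance Activation.finite : Finite Activation := by
  refine Finite.of_surjective (fun z : Fin 3 => (match z with
    | 0 => .relu
    | 1 => .heaviside
    | 2 => .recip : Activation)) ?_
  rintro (_ | _ | _)
  exacts [⟨0, rfl⟩, ⟨1, rfl⟩, ⟨2, rfl⟩]

/-- A local table is determined by its discrete data and by its values on a finite window, each
value being taken from a finite set. -/
lemma finite_tables {S : Type*} [Finite S] (L Hd D c Δ : ℕ) {F : Set ℝ} (hF : F.Finite) :
    {τ : Table S L Hd D | τ.rnd ≤ c ∧ (∀ σ δ, τ.val σ δ ∈ F) ∧ τ.LocalTo Δ}.Finite := by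
  refine Set.Finite.of_injOn (t := (Set.Iic c ×ˢ (Set.univ : Set (Fin L → Fin D → Activation))) ×ˢ
    {g : Slot S L Hd D × Set.Icc (-(Δ : ℤ)) Δ → ℝ | ∀ x, g x ∈ F})
    (f := fun τ => ((τ.rnd, τ.act), fun x => τ.val x.1 x.2)) ?_ ?_ ?_
  · rintro τ ⟨h1, h2, -⟩
    exact ⟨⟨h1, trivial⟩, fun x => h2 _ _⟩
  · rintro τ ⟨-, -, h⟩ τ' ⟨-, -, h'⟩ e
    simp only [Prod.mk.injEq] at e
    obtain ⟨⟨e1, e2⟩, e3⟩ := e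
    have e4 : τ.val = τ'.val := by
      funext σ δ
      by_cases hδ : |δ| ≤ (Δ : ℤ)
      · exact congrFun e3 (σ, ⟨δ, abs_le.1 hδ⟩)
      · rw [h σ δ (not_le.1 hδ), h' σ δ (not_le.1 hδ)]
    cases τ
    cases τ'
    simp_all
  · exact ((Set.finite_Iic c).prod Set.finite_univ).prod (Set.Finite.pi' fun _ => hF)

/-- A table with its dimensions. -/
abbrev SizedTable (S : Type*) : Type _ := Σ k : ℕ × ℕ × ℕ, Table S k.1 k.2.1 k.2.2

/-- Hypotheses with bounded regularizer and bounded interaction range have, up to idle hidden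
units, finitely many tables. -/
theorem exists_finite_tables (S : Type*) [Finite S] (C : ℝ) (Δ : ℕ) :
    ∃ 𝓣 : Set (SizedTable S), 𝓣.Finite ∧
      (∀ k ∈ 𝓣, k.2.LocalTo Δ ∧ ∃ p, k.2.Dyadic p) ∧
      ∀ (n : ℕ) (G : Hypothesis S n), G.reg ≤ C →
        (∀ q : LabelProbe S (n : ℕ∞) G.T.depth G.T.heads G.T.dff, (Δ : ℤ) < |q.disp| →
          G.T.weights.eval q = 0) →
        ∃ k ∈ 𝓣, ∃ W : Weights S (n : ℕ∞) (EuclideanSpace ℝ (Fin G.d)) k.1.1 k.1.2.1 k.1.2.2,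
          (∀ s, W.Models k.2 s) ∧
          ∀ ε x op oc, W.tr.logits ε x op oc = G.T.logits ε x op oc := by
  classical
  set c := ⌈C⌉₊ with hc
  set P := 2 * (c * c + 2 * c) with hP
  set F : Set ℝ := {x | IsDyadic P x ∧ |x| ≤ Hypothesis.evalBound C} with hF
  refine ⟨⋃ k ∈ Set.Iic c ×ˢ Set.Iic c ×ˢ Set.Iic (Hypothesis.unitBound C),
    Sigma.mk k '' {τ : Table S k.1 k.2.1 k.2.2 |
      τ.rnd ≤ c ∧ (∀ σ δ, τ.val σ δ ∈ F) ∧ τ.LocalTo Δ}, ?_, ?_, ?_⟩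
  · refine Set.Finite.biUnion ((Set.finite_Iic c).prod ((Set.finite_Iic c).prod
      (Set.finite_Iic _))) fun k _ => (finite_tables _ _ _ _ _ (finite_dyadic P _)).image _
  · intro k hk
    simp only [Set.mem_iUnion, Set.mem_image] at hk
    obtain ⟨_, _, τ, ⟨_, h1, h2⟩, rfl⟩ := hk
    exact ⟨h2, P, fun σ δ => (h1 σ δ).1⟩
  · intro n G hG hloc
    have hC := Hypothesis.regBounded hG
    obtain ⟨hL, hH, hp, hr⟩ := hC.depth_le
    -- All layers share the hidden dimension, so a unit is kept if it is active in at least one of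
    -- them.
    set Act := Finset.univ.filter fun s : Fin G.T.dff =>
      ∃ l, G.T.B l (EuclideanSpace.single s 1) ≠ 0 with hAct
    set e : Fin Act.card → Fin G.T.dff := fun s => (Act.equivFin.symm s : Fin G.T.dff) with he
    have hinj : Function.Injective e := fun s s' h => Act.equivFin.symm.injective (Subtype.ext h)
    have hB : ∀ l s, s ∉ Set.range e → G.T.weights.B l (EuclideanSpace.single s 1) = 0 := by
      intro l s hs
      by_contra hne
      have hmem : s ∈ Act := Finset.mem_filter.2 ⟨Finset.mem_univ _, l, hne⟩
      exact hs ⟨Act.equivFin ⟨s, hmem⟩, by simp [he]⟩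
    set W := G.T.weights.restrictUnits e with hW
    have hTI : W.tr.TranslationInvariant :=
      Weights.restrictUnits_translationInvariant (W := G.T.weights) e G.invariant
    have hev : ∀ q, W.eval q ∈ F := by
      intro q
      rw [hW, Weights.restrictUnits_eval]
      refine ⟨(G.isDyadic_eval _).mono ?_, Hypothesis.abs_eval_le hC _⟩
      have := Nat.mul_le_mul hL hp
      rw [Hypothesis.evalPrec, hP]
      rw [← hc] at this hp
      omega
    -- Table entries without a probe are `0` by default and must be allowed as well.
    have h0 : (0 : ℝ) ∈ F := by
      refine ⟨isDyadic_zero P, ?_⟩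
      rw [abs_zero]
      have := hC.nonneg
      unfold Hypothesis.evalBound
      positivity
    refine ⟨⟨(G.T.depth, G.T.heads, Act.card), W.table⟩, ?_, W, W.models_table hTI,
      fun ε x op oc => Weights.restrictUnits_logits G.T.weights hinj hB ε x op oc⟩
    simp only [Set.mem_iUnion]
    refine ⟨(G.T.depth, G.T.heads, Act.card), ⟨hL, hH, hC.card_active_le⟩, W.table,
      ⟨hr, fun σ δ => ?_, W.localTo_table fun q hq => ?_⟩, rfl⟩
    · rcases W.table_val σ δ with h | ⟨q, -, -, h⟩
      · rw [h]; exact h0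
      · rw [h]; exact hev q
    · rw [hW, Weights.restrictUnits_eval]
      exact hloc _ (by rw [Weights.disp_mapUnit]; exact hq)

/-! ### Restriction to a smaller context -/

section

variable {S : Type*} {n m : ℕ}

/-- An index in a smaller context, in a larger one. -/
def castIdx (h : n ≤ m) (i : Idx (n : ℕ∞)) : Idx (m : ℕ∞) :=
  ⟨i, lt_of_lt_of_le i.2 (by exact_mod_cast h)⟩

/-- A symbol of a smaller vocabulary, in a larger one. -/
def castTok (h : n ≤ m) : Token S (Idx (n : ℕ∞)) → Token S (Idx (m : ℕ∞))
  | .start => .start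
  | .fin σ => .fin σ
  | .chr k => .chr (castIdx h k)

/-- A label in a smaller context, in a larger one. -/
def castOut {L D : ℕ} (h : n ≤ m) : OutVec S (n : ℕ∞) L D → OutVec S (m : ℕ∞) L D
  | .pos i => .pos (castIdx h i)
  | .emb ω => .emb (castTok h ω)
  | .mlp l s => .mlp l s

lemma kind_castOut {L D : ℕ} (h : n ≤ m) (v : OutVec S (n : ℕ∞) L D) :
    (castOut h v).kind = v.kind := by
  rcases v with i | (_ | σ | k) | ⟨l, s⟩ <;> rfl

lemma disp_castOut {L D : ℕ} (h : n ≤ m) (v w : OutVec S (n : ℕ∞) L D) :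
    (castOut h v).disp (castOut h w) = v.disp w := by
  have hi : ∀ v : OutVec S (n : ℕ∞) L D, (castOut h v).idx = v.idx := by
    rintro (i | (_ | σ | k) | ⟨l, s⟩) <;> rfl
  rw [OutVec.disp, OutVec.disp, kind_castOut, kind_castOut, hi, hi]

lemma shiftTok_castTok (h : n ≤ m) {o : ℕ} {a : Token S ℕ} {a' : Token S (Idx (n : ℕ∞))}
    (ha : shiftTok (n : ℕ∞) o a = some a') : shiftTok (m : ℕ∞) o a = some (castTok h a') := by
  rcases a with _ | σ | k
  · simp only [shiftTok, Option.some.injEq] at ha ⊢; subst ha; rfl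
  · simp only [shiftTok, Option.some.injEq] at ha ⊢; subst ha; rfl
  · simp only [shiftTok] at ha ⊢
    split_ifs at ha with hk
    have hk' : ((k + o : ℕ) : ℕ∞) < (m : ℕ∞) := lt_of_lt_of_le hk (by exact_mod_cast h)
    rw [dif_pos hk']
    simp only [Option.some.injEq] at ha ⊢
    subst ha
    rfl

lemma memℓp_precomp {ι ι' : Type*} (g : ι' → ι) (z : lp (fun _ : ι => ℝ) ⊤) :
    Memℓp (fun i => z (g i)) ⊤ := by
  rw [memℓp_infty_iff]
  refine ⟨‖z‖, ?_⟩
  rintro _ ⟨i, rfl⟩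
  exact lp.norm_apply_le_norm ENNReal.top_ne_zero z (g i)

/-- Restriction of bounded families along a map of index sets. -/
def lpPrecomp {ι ι' : Type*} (g : ι' → ι) :
    lp (fun _ : ι => ℝ) ⊤ →L[ℝ] lp (fun _ : ι' => ℝ) ⊤ :=
  LinearMap.mkContinuous
    { toFun := fun z => ⟨fun i => z (g i), memℓp_precomp g z⟩
      map_add' := fun z z' => rfl
      map_smul' := fun c z => rfl } 1 fun z => by
    rw [one_mul]
    exact lp.norm_le_of_forall_le (norm_nonneg z) fun i =>
      lp.norm_apply_le_norm ENNReal.top_ne_zero z (g i)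

lemma norm_lpPrecomp_le {ι ι' : Type*} (g : ι' → ι) : ‖lpPrecomp g‖ ≤ 1 :=
  LinearMap.mkContinuous_norm_le _ zero_le_one _

variable {H : Type*} [NormedAddCommGroup H] [InnerProductSpace ℝ H] {L Hd D : ℕ}

namespace Weights

/-- The transformer with a smaller context width. -/
def restrictContext (W : Weights S (m : ℕ∞) H L Hd D) (h : n ≤ m) :
    Weights S (n : ℕ∞) H L Hd D where
  rnd := W.rnd
  emb ω := W.emb (castTok h ω)
  pos i := W.pos (castIdx h i)
  K := W.K
  Q := W.Q
  V := W.V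
  A := W.A
  B := W.B
  b := W.b
  act := W.act
  U := (lpPrecomp (castTok h)).comp W.U

variable (W : Weights S (m : ℕ∞) H L Hd D) (h : n ≤ m)

lemma restrictContext_eval (q : LabelProbe S (n : ℕ∞) L Hd D) :
    (W.restrictContext h).eval q = W.eval (q.map id (castOut h) (castTok h)) := by
  have hvec : ∀ v : OutVec S (n : ℕ∞) L D,
      (W.restrictContext h).tr.vec v = W.tr.vec (castOut h v) := by
    rintro (i | ω | ⟨l, s⟩) <;> rfl
  have hch : ∀ (C : Fin L → Option (Fin Hd)) (v : OutVec S (n : ℕ∞) L D),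
      (W.restrictContext h).tr.chainProd C ((W.restrictContext h).tr.vec v) =
        W.tr.chainProd C (W.tr.vec (castOut h v)) := by
    intro C v
    rw [hvec]
    have h : (W.restrictContext h).tr.chainProd C = W.tr.chainProd C := by
      unfold Transformer.chainProd
      congr 1
      funext M l
      rcases C l with _ | a <;> rfl
    rw [h]
  rcases q with ⟨l, a, C₁, C₂, v, w⟩ | ⟨C, ω, w⟩ | ⟨C, l, s, w⟩ | ⟨l, s⟩
  · simp only [eval, Transformer.prodAttn, hch]
    rfl
  · simp only [eval, Transformer.prodUnembed, hch]
    rfl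
  · simp only [eval, Transformer.prodMlp, hch]
    rfl
  · rfl

lemma restrictContext_translationInvariant (hW : W.tr.TranslationInvariant) :
    (W.restrictContext h).tr.TranslationInvariant := by
  rw [translationInvariant_iff] at hW ⊢
  have hs : ∀ q : LabelProbe S (n : ℕ∞) L Hd D,
      LabelProbe.slot (q.map id (castOut h) (castTok h)) = q.slot := by
    have hk := fun ω => kind_castOut h (OutVec.emb ω : OutVec S (n : ℕ∞) L D)
    rintro (⟨l, a, C₁, C₂, v, w⟩ | ⟨C, ω, w⟩ | ⟨C, l, s, w⟩ | ⟨l, s⟩)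
    · simp [LabelProbe.slot, Probe.map, kind_castOut]
    · simp only [LabelProbe.slot, Probe.map, kind_castOut]
      rw [← hk ω]
      rfl
    · simp [LabelProbe.slot, Probe.map, kind_castOut]
    · rfl
  have hd : ∀ q : LabelProbe S (n : ℕ∞) L Hd D,
      LabelProbe.disp (q.map id (castOut h) (castTok h)) = q.disp := by
    rintro (⟨l, a, C₁, C₂, v, w⟩ | ⟨C, ω, w⟩ | ⟨C, l, s, w⟩ | ⟨l, s⟩)
    · exact disp_castOut h v w
    · exact disp_castOut h (.emb ω) w
    · rfl
    · rfl
  intro q q' h1 h2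
  rw [restrictContext_eval, restrictContext_eval]
  exact hW _ _ (by rw [hs, hs, h1]) (by rw [hd, hd, h2])

/-- An input that fits into the smaller context uses only embeddings and positions that were kept,
and the operators between the layers are unchanged. -/
lemma restrictContext_logits (ε : ℝ) {x : Word S} {op oc : ℕ} (hf : Fits x (n : ℕ∞) op oc)
    (i : Fin (strLen x)) (ω : Token S (Idx (n : ℕ∞))) :
    (W.restrictContext h).tr.logits ε x op oc i ω = W.tr.logits ε x op oc i (castTok h ω) := by
  have hinit : (W.restrictContext h).tr.init x op oc = W.tr.init x op oc := by
    funext j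
    obtain ⟨a, ha⟩ := hf.exists_token j
    have hp := hf.pos_lt j
    have hp' : ((j + op : ℕ) : ℕ∞) < (m : ℕ∞) := lt_of_lt_of_le hp (by exact_mod_cast h)
    rw [Transformer.init, Transformer.init, Transformer.embAt_of_shiftTok _ ha,
      Transformer.embAt_of_shiftTok _ (shiftTok_castTok h ha), Transformer.posAt_of_lt _ hp,
      Transformer.posAt_of_lt _ hp']
    rfl
  have hrun : ∀ (l : ℕ) (y : Fin (strLen x) → H),
      (W.restrictContext h).tr.run ε y l = W.tr.run ε y l := by
    intro l y
    induction l with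
    | zero => rfl
    | succ l ih =>
      simp only [Transformer.run]
      split_ifs with hl
      · rw [ih]
        rfl
      · exact ih
  rw [Transformer.logits, Transformer.logits, Transformer.states_eq_run,
    Transformer.states_eq_run, hinit, hrun]
  rfl

/-! ### The interaction penalty under restriction -/

/-- The part of the interaction penalty from one attention form. -/
def attnPenalty (W : Weights S (n : ℕ∞) H L Hd D) (l : Fin L) (a : Fin Hd)
    (C₁ C₂ : Fin L → Option (Fin Hd)) : ℝ :=
  ∑ i : Fin n, ∑ j : Fin n, if (i : ℕ) = 0 ∨ (j : ℕ) = 0 then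
    |W.eval (.attn l a C₁ C₂ (.pos (Hypothesis.index i)) (.pos (Hypothesis.index j)))| ^ 2 +
    |W.eval (.attn l a C₁ C₂ (.emb (.chr (Hypothesis.index i)))
      (.emb (.chr (Hypothesis.index j))))| ^ 2
  else 0

/-- The part of the interaction penalty from the unembedding of one chain. -/
def unembedPenalty (W : Weights S (n : ℕ∞) H L Hd D) (C : Fin L → Option (Fin Hd)) : ℝ :=
  ∑ i : Fin n, ∑ j : Fin n, if (i : ℕ) = 0 ∨ (j : ℕ) = 0 then
    |W.eval (.unembed C (.chr (Hypothesis.index i)) (.emb (.chr (Hypothesis.index j))))| ^ 2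
  else 0

/-- The interaction penalty. -/
def penalty (W : Weights S (n : ℕ∞) H L Hd D) : ℝ :=
  (∑ l, ∑ a, ∑ C₁, ∑ C₂, W.attnPenalty l a C₁ C₂) + ∑ C, W.unembedPenalty C

end Weights

/-- A gain at one index survives summation; applied repeatedly, it carries a gain in one attention
form through the sums over layers, heads and chains. -/
lemma sum_add_le_sum {ι : Type*} [Fintype ι] {f g : ι → ℝ} {c : ℝ} (h : ∀ i, f i ≤ g i) (i : ι)
    (hi : f i + c ≤ g i) : ∑ i, f i + c ≤ ∑ i, g i := by
  have h1 := Finset.single_le_sum (f := fun i => g i - f i) (s := Finset.univ)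
    (fun i _ => sub_nonneg.2 (h i)) (Finset.mem_univ i)
  rw [Finset.sum_sub_distrib] at h1
  linarith

lemma sum_castLE_add_le (h : n ≤ m) {F : Fin m → Fin m → ℝ} (hF : ∀ i j, 0 ≤ F i j) (i₀ j₀ : Fin m)
    (h0 : n ≤ (i₀ : ℕ) ∨ n ≤ (j₀ : ℕ)) :
    ∑ i : Fin n, ∑ j : Fin n, F (Fin.castLE h i) (Fin.castLE h j) + F i₀ j₀ ≤
      ∑ i, ∑ j, F i j := by
  classical
  rw [← Fintype.sum_prod_type' F,
    ← Fintype.sum_prod_type' fun i j : Fin n => F (Fin.castLE h i) (Fin.castLE h j)]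
  let e : Fin n × Fin n ↪ Fin m × Fin m :=
    (Fin.castLEEmb h).prodMap (Fin.castLEEmb h)
  have he : ∑ x : Fin n × Fin n, F (Fin.castLE h x.1) (Fin.castLE h x.2) =
      ∑ y ∈ Finset.univ.map e, F y.1 y.2 := by
    rw [Finset.sum_map]
    rfl
  have hn : (i₀, j₀) ∉ Finset.univ.map e := by
    intro hmem
    obtain ⟨⟨i, j⟩, -, hx⟩ := Finset.mem_map.1 hmem
    have h1 : (i : ℕ) = i₀ := congrArg (fun y => (y.1 : ℕ)) hx
    have h2 : (j : ℕ) = j₀ := congrArg (fun y => (y.2 : ℕ)) hx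
    have := i.isLt
    have := j.isLt
    omega
  rw [he, add_comm, ← Finset.sum_insert (f := fun y : Fin m × Fin m => F y.1 y.2) hn]
  exact Finset.sum_le_sum_of_subset_of_nonneg (Finset.subset_univ _) fun y _ _ => hF _ _

lemma sum_castLE_le (h : n ≤ m) {F : Fin m → Fin m → ℝ} (hF : ∀ i j, 0 ≤ F i j) :
    ∑ i : Fin n, ∑ j : Fin n, F (Fin.castLE h i) (Fin.castLE h j) ≤ ∑ i, ∑ j, F i j := by
  rw [← Fintype.sum_prod_type' F,
    ← Fintype.sum_prod_type' fun i j : Fin n => F (Fin.castLE h i) (Fin.castLE h j)]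
  let e : Fin n × Fin n ↪ Fin m × Fin m :=
    (Fin.castLEEmb h).prodMap (Fin.castLEEmb h)
  have he : ∑ x : Fin n × Fin n, F (Fin.castLE h x.1) (Fin.castLE h x.2) =
      ∑ y ∈ Finset.univ.map e, F y.1 y.2 := by
    rw [Finset.sum_map]
    rfl
  rw [he]
  exact Finset.sum_le_sum_of_subset_of_nonneg (Finset.subset_univ _) fun y _ _ => hF _ _

namespace Weights

variable (W : Weights S (m : ℕ∞) H L Hd D) (h : n ≤ m)

/-- The summand of `attnPenalty`. -/
def attnTerm (l : Fin L) (a : Fin Hd) (C₁ C₂ : Fin L → Option (Fin Hd)) (i j : Fin m) : ℝ :=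
  if (i : ℕ) = 0 ∨ (j : ℕ) = 0 then
    |W.eval (.attn l a C₁ C₂ (.pos (Hypothesis.index i)) (.pos (Hypothesis.index j)))| ^ 2 +
    |W.eval (.attn l a C₁ C₂ (.emb (.chr (Hypothesis.index i)))
      (.emb (.chr (Hypothesis.index j))))| ^ 2
  else 0

/-- The summand of `unembedPenalty`. -/
def unembedTerm (C : Fin L → Option (Fin Hd)) (i j : Fin m) : ℝ :=
  if (i : ℕ) = 0 ∨ (j : ℕ) = 0 then
    |W.eval (.unembed C (.chr (Hypothesis.index i)) (.emb (.chr (Hypothesis.index j))))| ^ 2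
  else 0

lemma attnTerm_nonneg (l : Fin L) (a : Fin Hd) (C₁ C₂ : Fin L → Option (Fin Hd)) (i j : Fin m) :
    0 ≤ W.attnTerm l a C₁ C₂ i j := by
  unfold attnTerm
  split_ifs <;> positivity

lemma unembedTerm_nonneg (C : Fin L → Option (Fin Hd)) (i j : Fin m) :
    0 ≤ W.unembedTerm C i j := by
  unfold unembedTerm
  split_ifs <;> positivity

lemma attnPenalty_restrictContext (l : Fin L) (a : Fin Hd) (C₁ C₂ : Fin L → Option (Fin Hd)) :
    (W.restrictContext h).attnPenalty l a C₁ C₂ =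
      ∑ i : Fin n, ∑ j : Fin n, W.attnTerm l a C₁ C₂ (Fin.castLE h i) (Fin.castLE h j) := by
  unfold attnPenalty attnTerm
  simp only [restrictContext_eval]
  rfl

lemma unembedPenalty_restrictContext (C : Fin L → Option (Fin Hd)) :
    (W.restrictContext h).unembedPenalty C =
      ∑ i : Fin n, ∑ j : Fin n, W.unembedTerm C (Fin.castLE h i) (Fin.castLE h j) := by
  unfold unembedPenalty unembedTerm
  simp only [restrictContext_eval]
  rfl

lemma attnPenalty_restrictContext_le (l : Fin L) (a : Fin Hd) (C₁ C₂ : Fin L → Option (Fin Hd)) :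
    (W.restrictContext h).attnPenalty l a C₁ C₂ ≤ W.attnPenalty l a C₁ C₂ := by
  rw [attnPenalty_restrictContext]
  exact sum_castLE_le h (W.attnTerm_nonneg l a C₁ C₂)

lemma unembedPenalty_restrictContext_le (C : Fin L → Option (Fin Hd)) :
    (W.restrictContext h).unembedPenalty C ≤ W.unembedPenalty C := by
  rw [unembedPenalty_restrictContext]
  exact sum_castLE_le h (W.unembedTerm_nonneg C)

lemma penalty_restrictContext_le : (W.restrictContext h).penalty ≤ W.penalty := by
  refine add_le_add ?_ ?_
  · exact Finset.sum_le_sum fun l _ => Finset.sum_le_sum fun a _ => Finset.sum_le_sum fun C₁ _ =>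
      Finset.sum_le_sum fun C₂ _ => W.attnPenalty_restrictContext_le h l a C₁ C₂
  · exact Finset.sum_le_sum fun C _ => W.unembedPenalty_restrictContext_le h C

/-- The pair of indices, at least one of them zero, at the same displacement as `(i, j)`. -/
lemma exists_corner (i j : Idx (m : ℕ∞)) :
    ∃ i₀ j₀ : Fin m, ((i₀ : ℕ) = 0 ∨ (j₀ : ℕ) = 0) ∧
      ((i₀ : ℕ) : ℤ) - (j₀ : ℕ) = ((i : ℕ) : ℤ) - (j : ℕ) := by
  have hi : (i : ℕ) < m := by exact_mod_cast i.2
  have hj : (j : ℕ) < m := by exact_mod_cast j.2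
  -- Subtraction of naturals is truncated, so at least one of the two differences is `0`.
  exact ⟨⟨(i : ℕ) - j, by omega⟩, ⟨(j : ℕ) - i, by omega⟩, by simp; omega, by simp; omega⟩

/-- If an interaction at a displacement beyond the smaller context does not vanish, the restriction
reduces the interaction penalty. -/
lemma penalty_restrictContext_add_le (hW : W.tr.TranslationInvariant)
    {q : LabelProbe S (m : ℕ∞) L Hd D} (hq : (n : ℤ) < |q.disp|) :
    (W.restrictContext h).penalty + |W.eval q| ^ 2 ≤ W.penalty := by
  rw [translationInvariant_iff] at hW
  have hA := W.attnPenalty_restrictContext_le h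
  have hU := W.unembedPenalty_restrictContext_le h
  have hn : (0 : ℤ) ≤ n := Int.natCast_nonneg n
  have hbig : ∀ {i j : Idx (m : ℕ∞)} {i₀ j₀ : Fin m}, (n : ℤ) < |((i : ℕ) : ℤ) - (j : ℕ)| →
      ((i₀ : ℕ) : ℤ) - (j₀ : ℕ) = ((i : ℕ) : ℤ) - (j : ℕ) → n ≤ (i₀ : ℕ) ∨ n ≤ (j₀ : ℕ) := by
    intro i j i₀ j₀ h1 h2
    rw [← h2, lt_abs] at h1
    omega
  -- The penalty records displacements at corner pairs only. Invariance moves the interaction to the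
  -- corner pair `(i₀, j₀)`, which lies outside the smaller context, so its summand is lost
  -- entirely.
  have hattn : ∀ (l : Fin L) (a : Fin Hd) (C₁ C₂ : Fin L → Option (Fin Hd)) (i₀ j₀ : Fin m),
      n ≤ (i₀ : ℕ) ∨ n ≤ (j₀ : ℕ) → |W.eval q| ^ 2 ≤ W.attnTerm l a C₁ C₂ i₀ j₀ →
      (W.restrictContext h).penalty + |W.eval q| ^ 2 ≤ W.penalty := by
    intro l a C₁ C₂ i₀ j₀ h1 h2
    have key : (W.restrictContext h).attnPenalty l a C₁ C₂ + |W.eval q| ^ 2 ≤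
        W.attnPenalty l a C₁ C₂ := by
      refine (add_le_add le_rfl h2).trans ?_
      rw [attnPenalty_restrictContext]
      exact sum_castLE_add_le h (W.attnTerm_nonneg l a C₁ C₂) i₀ j₀ h1
    rw [penalty, penalty, add_right_comm]
    refine add_le_add ?_ (Finset.sum_le_sum fun C _ => hU C)
    refine sum_add_le_sum (fun l => Finset.sum_le_sum fun a _ => Finset.sum_le_sum fun C₁ _ =>
      Finset.sum_le_sum fun C₂ _ => hA l a C₁ C₂) l ?_
    refine sum_add_le_sum (fun a => Finset.sum_le_sum fun C₁ _ =>
      Finset.sum_le_sum fun C₂ _ => hA l a C₁ C₂) a ?_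
    refine sum_add_le_sum (fun C₁ => Finset.sum_le_sum fun C₂ _ => hA l a C₁ C₂) C₁ ?_
    exact sum_add_le_sum (fun C₂ => hA l a C₁ C₂) C₂ key
  have h0 : ∀ {v w : OutVec S (m : ℕ∞) L D}, ¬ OutVec.Related v w → ¬ (n : ℤ) < |v.disp w| := by
    intro v w hr
    rw [OutVec.disp_of_not_related hr, abs_zero]
    omega
  rcases q with ⟨l, a, C₁, C₂, v, w⟩ | ⟨C, ω, w⟩ | ⟨C, l, s, w⟩ | ⟨l, s⟩
  · change (n : ℤ) < |v.disp w| at hq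
    by_cases hr : OutVec.Related v w
    swap
    · exact absurd hq (h0 hr)
    rcases v with i | (_ | σ | k) | ⟨l', s'⟩ <;> rcases w with j | (_ | σ | k') | ⟨l', s'⟩ <;>
      try exact absurd hr id
    · rw [OutVec.disp_pos] at hq
      obtain ⟨i₀, j₀, hz, hd⟩ := exists_corner i j
      refine hattn l a C₁ C₂ i₀ j₀ (hbig hq hd) ?_
      rw [attnTerm, if_pos hz, hW (.attn l a C₁ C₂ (.pos i) (.pos j))
        (.attn l a C₁ C₂ (.pos (Hypothesis.index i₀)) (.pos (Hypothesis.index j₀))) rfl]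
      · exact le_add_of_nonneg_right (by positivity)
      · change OutVec.disp _ _ = OutVec.disp _ _
        rw [OutVec.disp_pos, OutVec.disp_pos]
        exact hd.symm
    · rw [OutVec.disp_chr] at hq
      obtain ⟨i₀, j₀, hz, hd⟩ := exists_corner k k'
      refine hattn l a C₁ C₂ i₀ j₀ (hbig hq hd) ?_
      rw [attnTerm, if_pos hz, hW (.attn l a C₁ C₂ (.emb (.chr k)) (.emb (.chr k')))
        (.attn l a C₁ C₂ (.emb (.chr (Hypothesis.index i₀)))
          (.emb (.chr (Hypothesis.index j₀)))) rfl]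
      · exact le_add_of_nonneg_left (by positivity)
      · change OutVec.disp _ _ = OutVec.disp _ _
        rw [OutVec.disp_chr, OutVec.disp_chr]
        exact hd.symm
  · change (n : ℤ) < |OutVec.disp (.emb ω) w| at hq
    by_cases hr : OutVec.Related (.emb ω) w
    swap
    · exact absurd hq (h0 hr)
    rcases ω with _ | σ | k <;> rcases w with j | (_ | σ | k') | ⟨l', s'⟩ <;>
      try exact absurd hr id
    rw [OutVec.disp_chr] at hq
    obtain ⟨i₀, j₀, hz, hd⟩ := exists_corner k k'
    rw [penalty, penalty, add_assoc]
    refine add_le_add (Finset.sum_le_sum fun l _ => Finset.sum_le_sum fun a _ =>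
      Finset.sum_le_sum fun C₁ _ => Finset.sum_le_sum fun C₂ _ => hA l a C₁ C₂) ?_
    refine sum_add_le_sum hU C ?_
    rw [unembedPenalty_restrictContext]
    refine le_trans (add_le_add le_rfl ?_)
      (sum_castLE_add_le h (W.unembedTerm_nonneg C) i₀ j₀ (hbig hq hd))
    rw [unembedTerm, if_pos hz, hW (.unembed C (.chr k) (.emb (.chr k')))
      (.unembed C (.chr (Hypothesis.index i₀)) (.emb (.chr (Hypothesis.index j₀)))) rfl]
    change OutVec.disp _ _ = OutVec.disp _ _
    rw [OutVec.disp_chr, OutVec.disp_chr]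
    exact hd.symm
  · exact absurd hq (by simp [LabelProbe.disp])
  · exact absurd hq (by simp [LabelProbe.disp])

end Weights

/-! ### The regularizer and matching under restriction -/

namespace Hypothesis

/-- The hypothesis with a smaller context width. -/
def restrict (G : Hypothesis S m) (h : n ≤ m) : Hypothesis S n where
  d := G.d
  prec := G.prec
  T := (G.T.weights.restrictContext h).tr
  hasPrecision :=
    { emb := fun ω => G.hasPrecision.emb (castTok h ω)
      pos := fun i => G.hasPrecision.pos (castIdx h i)
      K := G.hasPrecision.K
      Q := G.hasPrecision.Q
      V := G.hasPrecision.V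
      A := G.hasPrecision.A
      B := G.hasPrecision.B
      b := G.hasPrecision.b
      U := fun a ω => G.hasPrecision.U a (castTok h ω) }
  invariant := G.T.weights.restrictContext_translationInvariant h G.invariant

/-- Outside the penalty, the maxima over positions and symbols run over smaller sets, `U` is
composed with an operator of norm at most `1`, and all other terms are unchanged. -/
lemma reg_restrict_sub_le [Finite S] (G : Hypothesis S m) (h : n ≤ m) :
    (G.restrict h).reg - (G.T.weights.restrictContext h).penalty ≤ G.reg - G.T.weights.penalty := by
  have e1 : (G.restrict h).zeta = (G.T.weights.restrictContext h).penalty := rfl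
  have e2 : G.zeta = G.T.weights.penalty := rfl
  have h1 : ‖(G.restrict h).T.U‖ ≤ ‖G.T.U‖ := by
    refine (ContinuousLinearMap.opNorm_comp_le (lpPrecomp (castTok h)) G.T.U).trans ?_
    exact mul_le_of_le_one_left (norm_nonneg _) (norm_lpPrecomp_le _)
  have h2 : (⨆ i : Idx (n : ℕ∞), ‖(G.restrict h).T.pos i‖) ≤ ⨆ i : Idx (m : ℕ∞), ‖G.T.pos i‖ :=
    Real.iSup_le (fun i => le_ciSup (f := fun i : Idx (m : ℕ∞) => ‖G.T.pos i‖)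
      (Set.finite_range _).bddAbove (castIdx h i)) (Real.iSup_nonneg fun _ => norm_nonneg _)
  have h3 : (⨆ ω : Token S (Idx (n : ℕ∞)), ‖(G.restrict h).T.emb ω‖) ≤
      ⨆ ω : Token S (Idx (m : ℕ∞)), ‖G.T.emb ω‖ :=
    Real.iSup_le (fun i => le_ciSup (f := fun ω : Token S (Idx (m : ℕ∞)) => ‖G.T.emb ω‖)
      (Set.finite_range _).bddAbove (castTok h i)) (Real.iSup_nonneg fun _ => norm_nonneg _)
  rw [← e1, ← e2]
  unfold reg
  rw [add_sub_cancel_right, add_sub_cancel_right]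
  refine add_le_add (add_le_add (add_le_add (add_le_add ?_ h1) h2) h3) ?_
  · exact le_rfl
  · exact le_rfl

lemma reg_restrict_le [Finite S] (G : Hypothesis S m) (h : n ≤ m) :
    (G.restrict h).reg ≤ G.reg := by
  have h1 := G.reg_restrict_sub_le h
  have h2 := G.T.weights.penalty_restrictContext_le h
  linarith

/-- Restriction to a context width below the range of an interaction reduces the regularizer. -/
lemma reg_restrict_add_le [Finite S] (G : Hypothesis S m) (h : n ≤ m)
    {q : LabelProbe S (m : ℕ∞) G.T.depth G.T.heads G.T.dff} (hq : (n : ℤ) < |q.disp|) :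
    (G.restrict h).reg + |G.T.weights.eval q| ^ 2 ≤ G.reg := by
  have h1 := G.reg_restrict_sub_le h
  have h2 := G.T.weights.penalty_restrictContext_add_le h G.invariant hq
  linarith

lemma MatchesUpTo.fits {x : Word S} {op oc : ℕ} (hop : strLen x + op ≤ n)
    (hoc : ∀ k, Sum.inr k ∈ x → k + oc < n) : Fits x (n : ℕ∞) op oc :=
  ⟨by exact_mod_cast hop, fun k hk => by exact_mod_cast hoc k hk⟩

lemma MatchesUpTo.restrict {ε : ℝ} {f : Target S} {G : Hypothesis S m} {r : ℕ}
    (hG : G.MatchesUpTo ε f r) (h : n ≤ m) : (G.restrict h).MatchesUpTo ε f r := by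
  intro x ω hx hk hkk op oc hop hoc i ω' hω'
  have := hG x ω hx (fun k hk' => (hk k hk').trans_le h) hkk op oc (hop.trans h)
    (fun k hk' => (hoc k hk').trans_le h) i (castTok h ω') (shiftTok_castTok h hω')
  rw [← this]
  exact G.T.weights.restrictContext_logits h ε (MatchesUpTo.fits hop hoc) i ω'

lemma MatchesUpTo.mono {ε : ℝ} {f : Target S} {G : Hypothesis S n} {r r' : ℕ}
    (hG : G.MatchesUpTo ε f r) (h : r' ≤ r) : G.MatchesUpTo ε f r' :=
  fun x ω hx hk hkk => hG x ω (hx.trans h) hk fun k k' h1 h2 => (hkk k k' h1 h2).trans (by omega)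

end Hypothesis

end

/-! ### Runs with bounded regularizer -/

section

variable {S : Type*} [Finite S] {ε : ℝ} {f : Target S}

/-- The hypotheses of a run whose regularizers are bounded are eventually uniformly local. -/
lemma IsRun.exists_local {t : ℕ → ℕ} (ht : IsTrainingLength t) {G : (n : ℕ) → Hypothesis S n}
    (hG : IsRun ε f t G) {C : ℝ} (hC : ∀ n, 1 ≤ n → (G n).reg ≤ C) :
    ∃ Δ m₀ : ℕ, ∀ m, m₀ ≤ m →
      ∀ q : LabelProbe S (m : ℕ∞) (G m).T.depth (G m).T.heads (G m).T.dff, (Δ : ℤ) < |q.disp| →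
        (G m).T.weights.eval q = 0 := by
  set c := ⌈C⌉₊ with hc
  set P := 2 * (c * c + 2 * c) with hP
  -- All product functions along the run have `P`-bit precision, so `η` is the least possible
  -- contribution of a nonzero one to the penalty.
  set η : ℝ := ((2 ^ P : ℝ)⁻¹) ^ 2 with hη
  have hη0 : 0 < η := by positivity
  obtain ⟨N, hN⟩ := exists_nat_one_div_lt (show (0 : ℝ) < η / 4 by positivity)
  have hbdd : BddAbove ((fun n => (G n).reg) '' Set.Ici (N + 1)) := by
    refine ⟨C, ?_⟩
    rintro _ ⟨n, hn, rfl⟩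
    exact hC n (le_trans (Nat.le_add_left 1 N) hn)
  -- The index `n₀` is chosen beyond `N`, so that `1 / n₀ < η / 4`, and with a regularizer within `η
  -- / 4` of the supremum over the tail. The same `n₀` serves as the bandwidth.
  obtain ⟨_, ⟨n₀, hn₀, rfl⟩, hs⟩ := exists_lt_of_lt_csSup
    (Set.Nonempty.image (fun n => (G n).reg) ⟨N + 1, Set.mem_Ici.2 le_rfl⟩)
    (show sSup ((fun n => (G n).reg) '' Set.Ici (N + 1)) - η / 4 <
      sSup ((fun n => (G n).reg) '' Set.Ici (N + 1)) by linarith)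
  obtain ⟨M, hM⟩ := eventually_atTop.1 (tendsto_atTop.1 ht.1 (t n₀))
  have hn₀' : N + 1 ≤ n₀ := hn₀
  refine ⟨n₀, max n₀ M, fun m hm q hq => ?_⟩
  by_contra hne
  have hm1 : n₀ ≤ m := (le_max_left _ _).trans hm
  have hCm := hC m (by omega)
  have hb := Hypothesis.regBounded hCm
  -- The restriction competes with `G n₀` only if it matches `f` up to `t n₀`; since `t` need not be
  -- monotone, `m ≥ M` is what ensures `t m ≥ t n₀`.
  have hmatch : ((G m).restrict hm1).MatchesUpTo ε f (t n₀) :=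
    ((hG m (by omega)).1.mono (hM m ((le_max_right _ _).trans hm))).restrict hm1
  have h1 := (hG n₀ (by omega)).2 _ hmatch
  have h2 := (G m).reg_restrict_add_le hm1 hq
  have h3 : η ≤ |(G m).T.weights.eval q| ^ 2 := by
    refine pow_le_pow_left₀ (by positivity) ?_ 2
    refine (((G m).isDyadic_eval q).mono ?_).le_abs hne
    have := Nat.mul_le_mul hb.depth_le.1 hb.depth_le.2.2.1
    have h4 := hb.depth_le.2.2.1
    rw [← hc] at this h4
    rw [Hypothesis.evalPrec, hP]
    omega
  have h4 : (G m).reg ≤ sSup ((fun n => (G n).reg) '' Set.Ici (N + 1)) :=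
    le_csSup hbdd ⟨m, hn₀'.trans hm1, rfl⟩
  have h5 : 1 / (n₀ : ℝ) ≤ 1 / ((N : ℝ) + 1) := by
    refine one_div_le_one_div_of_le (by positivity) ?_
    exact_mod_cast hn₀'
  dsimp only at hs
  -- The regularizer of `G n₀` is at most `1 / n₀` plus the supremum minus `η`, hence below the
  -- supremum minus `3η / 4`, against the choice of `n₀`.
  linarith

/-- Infinitely many hypotheses of a run with bounded regularizers have the same table. -/
lemma IsRun.exists_table {t : ℕ → ℕ} (ht : IsTrainingLength t) {G : (n : ℕ) → Hypothesis S n}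
    (hG : IsRun ε f t G) {C : ℝ} (hC : ∀ n, 1 ≤ n → (G n).reg ≤ C) {I : Set ℕ} (hI : I.Infinite) :
    ∃ (L Hd D Δ p : ℕ) (τ : Table S L Hd D), τ.LocalTo Δ ∧ τ.Dyadic p ∧
      ∃ I' : Set ℕ, I' ⊆ I ∧ I'.Infinite ∧ ∀ m ∈ I', 1 ≤ m ∧
        ∃ W : Weights S (m : ℕ∞) (EuclideanSpace ℝ (Fin (G m).d)) L Hd D, (∀ s, W.Models τ s) ∧
          ∀ ε x op oc, W.tr.logits ε x op oc = (G m).T.logits ε x op oc := by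
  obtain ⟨Δ, m₀, hloc⟩ := hG.exists_local ht hC
  obtain ⟨𝓣, hfin, hprop, hex⟩ := exists_finite_tables S C Δ
  set I₁ := I \ Set.Iio (m₀ + 1) with hI₁
  have hinf : I₁.Infinite := hI.sdiff (Set.finite_Iio _)
  have hmem : ∀ m ∈ I₁, m₀ ≤ m ∧ 1 ≤ m := by
    intro m hm
    have := hm.2
    simp only [Set.mem_Iio, not_lt] at this
    omega
  set J : SizedTable S → Set ℕ := fun k => {m | m ∈ I₁ ∧
    ∃ W : Weights S (m : ℕ∞) (EuclideanSpace ℝ (Fin (G m).d)) k.1.1 k.1.2.1 k.1.2.2,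
      (∀ s, W.Models k.2 s) ∧
      ∀ ε x op oc, W.tr.logits ε x op oc = (G m).T.logits ε x op oc} with hJ
  have hcover : I₁ ⊆ ⋃ k ∈ 𝓣, J k := by
    intro m hm
    obtain ⟨k, hk, hW⟩ := hex m (G m) (hC m (hmem m hm).2) (hloc m (hmem m hm).1)
    exact Set.mem_biUnion hk ⟨hm, hW⟩
  -- Pigeonhole: finitely many tables serve an infinite set of indices.
  obtain ⟨k, hk, hkinf⟩ : ∃ k ∈ 𝓣, (J k).Infinite := by
    by_contra hn
    push Not at hn
    exact hinf ((hfin.biUnion fun k hk => hn k hk).subset hcover)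
  obtain ⟨hl, p, hp⟩ := hprop k hk
  exact ⟨k.1.1, k.1.2.1, k.1.2.2, Δ, p, k.2, hl, hp, J k, fun m hm => hm.1.1, hkinf,
    fun m hm => ⟨(hmem m hm.1).2, hm.2⟩⟩

lemma fits_top {S : Type*} (x : Word S) : Fits x ⊤ 0 0 := ⟨le_top, fun _ _ => ENat.natCast_lt_top _⟩

lemma exists_shiftTok_top {S : Type*} (ω : Token S ℕ) : ∃ a, shiftTok ⊤ 0 ω = some a := by
  rcases ω with _ | σ | k
  · exact ⟨_, rfl⟩
  · exact ⟨_, rfl⟩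
  · have : ((k + 0 : ℕ) : ℕ∞) < ⊤ := ENat.natCast_lt_top _
    simp only [shiftTok]
    rw [dif_pos this]
    exact ⟨_, rfl⟩

/-- An expressible function is computed by hypotheses of bounded regularizer. -/
lemma Expressible.exists_hypothesis (hf : Expressible ε f) :
    ∃ C : ℝ, ∀ n, ∃ G : Hypothesis S n, G.reg ≤ C ∧ ∀ s, G.MatchesUpTo ε f s := by
  obtain ⟨H, _, _, _, T, hT, hTf⟩ := hf
  obtain ⟨p, hp⟩ := hT.dyadic
  obtain ⟨Δ, hΔ⟩ := (Weights.isLocal_iff T.weights).1 hT.isLocal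
  obtain ⟨C, hC⟩ := exists_hypothesis_of_table (T.weights.localTo_table hΔ)
    (T.weights.dyadic_table ((Weights.productsDyadic_iff T.weights p).1 hp))
  refine ⟨C, fun n => ?_⟩
  obtain ⟨G, hG, W, hW, hmod⟩ := hC n
  refine ⟨G, hG, fun s x ω hx hk hkk op oc hop hoc i ω' hω' => ?_⟩
  obtain ⟨a, ha⟩ := exists_shiftTok_top ω
  rw [hW, logits_eq_of_models (hmod s) (T.weights.models_table hT.invariant s) ε
    (Hypothesis.MatchesUpTo.fits hop hoc) (fits_top x) hω' ha hx hkk i]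
  exact hTf x i ω a ha

/-- The inference procedure has a run if there are matching hypotheses. -/
lemma exists_isRun {S : Type*} {ε : ℝ} {f : Target S} {t : ℕ → ℕ}
    (h : ∀ n, ∃ G : Hypothesis S n, G.MatchesUpTo ε f (t n)) :
    ∃ G : (n : ℕ) → Hypothesis S n, IsRun ε f t G := by
  have key : ∀ n, ∃ G : Hypothesis S n, 1 ≤ n → G.MatchesUpTo ε f (t n) ∧
      ∀ G' : Hypothesis S n, G'.MatchesUpTo ε f (t n) → G.reg ≤ 1 / (n : ℝ) + G'.reg := by
    intro n
    obtain ⟨G₀, hG₀⟩ := h n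
    by_cases hn : 1 ≤ n
    swap
    · exact ⟨G₀, fun h => absurd h hn⟩
    set A : Set ℝ := Hypothesis.reg '' {G : Hypothesis S n | G.MatchesUpTo ε f (t n)} with hA
    have hbdd : BddBelow A := ⟨0, by rintro _ ⟨G, -, rfl⟩; exact G.reg_nonneg⟩
    have hpos : (0 : ℝ) < 1 / n := by
      have : (0 : ℝ) < n := by exact_mod_cast hn
      positivity
    -- The infimum need not be attained, but it exists because regularizers are nonnegative, and a
    -- slack of `1 / n` is permitted.
    obtain ⟨_, ⟨G, hG, rfl⟩, hlt⟩ := Real.lt_sInf_add_pos (s := A) ⟨_, G₀, hG₀, rfl⟩ hpos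
    refine ⟨G, fun _ => ⟨hG, fun G' hG' => ?_⟩⟩
    have := csInf_le hbdd (Set.mem_image_of_mem Hypothesis.reg hG')
    linarith
  choose G hG using key
  exact ⟨G, fun n hn => hG n hn⟩

/-- A run on an expressible function generalizes. -/
lemma IsRun.generalizes (hf : Expressible ε f) {t : ℕ → ℕ} (ht : IsTrainingLength t)
    {G : (n : ℕ) → Hypothesis S n} (hG : IsRun ε f t G) :
    ∃ N₀ : ℕ, ∀ m, N₀ < m → (G m).MatchesUpTo ε f m := by
  obtain ⟨C, hC⟩ := hf.exists_hypothesis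
  have hreg : ∀ n, 1 ≤ n → (G n).reg ≤ 1 + C := by
    intro n hn
    obtain ⟨G', hG', hm⟩ := hC n
    have h1 := (hG n hn).2 G' (hm _)
    have h2 : 1 / (n : ℝ) ≤ 1 := by
      rw [div_le_one (by exact_mod_cast hn)]
      exact_mod_cast hn
    linarith
  by_contra hbad
  push Not at hbad
  have hinf : {m | ¬ (G m).MatchesUpTo ε f m}.Infinite := by
    rw [Set.infinite_iff_exists_gt]
    intro N
    obtain ⟨m, hm, hm'⟩ := hbad N
    exact ⟨m, hm', hm⟩
  obtain ⟨L, Hd, D, Δ, p, τ, -, -, I, hI, hIinf, hW⟩ := hG.exists_table ht hreg hinf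
  obtain ⟨m, hm⟩ := hIinf.nonempty
  refine hI hm fun x ω hx hk hkk op oc hop hoc i ω' hω' => ?_
  -- A later `m'` with the same table and `t m' ≥ m` is correct on all inputs of size up to `m`; the
  -- common table hands these logits down to `G m`.
  obtain ⟨M, hM⟩ := eventually_atTop.1 (tendsto_atTop.1 ht.1 m)
  obtain ⟨m', hm', hmm'⟩ := hIinf.exists_gt (max m M)
  have hle : m ≤ m' := (le_max_left _ _).trans hmm'.le
  obtain ⟨-, W, hmod, hlog⟩ := hW m hm
  obtain ⟨h1, W', hmod', hlog'⟩ := hW m' hm'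
  have ha := shiftTok_castTok hle hω'
  have hfit : Fits x (m : ℕ∞) op oc := Hypothesis.MatchesUpTo.fits hop hoc
  have hfit' : Fits x (m' : ℕ∞) op oc := Hypothesis.MatchesUpTo.fits (hop.trans hle)
    fun k hk => (hoc k hk).trans_le hle
  rw [← hlog, logits_eq_of_models (hmod m) (hmod' m) ε hfit hfit' hω' ha hx hkk i, hlog']
  exact ((hG m' h1).1.mono (hM m' ((le_max_right _ _).trans hmm'.le))) x ω hx
    (fun k hk' => (hk k hk').trans_le hle) hkk op oc (hop.trans hle)
    (fun k hk' => (hoc k hk').trans_le hle) i _ ha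

/-- If a function is not expressible, the regularizers of matching hypotheses tend to infinity. -/
lemma exists_lt_reg_of_not_expressible (hf : ¬ Expressible ε f) (C : ℝ) :
    ∃ n₀ : ℕ, ∀ n, n₀ ≤ n → ∀ G : Hypothesis S n, G.MatchesUpTo ε f n → C < G.reg := by
  by_contra hn
  push Not at hn
  -- Cheap full matches at arbitrarily large widths give cheap full matches at every width, by
  -- restriction.
  have hall : ∀ n, ∃ G : Hypothesis S n, G.MatchesUpTo ε f n ∧ G.reg ≤ C := by
    intro n
    obtain ⟨m, hm, G, hG, hr⟩ := hn n
    exact ⟨G.restrict hm, (hG.mono hm).restrict hm, (G.reg_restrict_le hm).trans hr⟩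
  obtain ⟨G, hG⟩ := exists_isRun (t := id) fun n => ⟨_, (hall n).choose_spec.1⟩
  have hreg : ∀ n, 1 ≤ n → (G n).reg ≤ 1 + C := by
    intro n h
    obtain ⟨G', hm, hG'⟩ := hall n
    have h1 := (hG n h).2 G' hm
    have h2 : 1 / (n : ℝ) ≤ 1 := by
      rw [div_le_one (by exact_mod_cast h)]
      exact_mod_cast h
    linarith
  obtain ⟨L, Hd, D, Δ, p, τ, hloc, hdy, I, -, hIinf, hW⟩ :=
    hG.exists_table ⟨tendsto_id, fun n => le_rfl⟩ hreg Set.infinite_univ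
  obtain ⟨H, i1, i2, i3, W, hlim, hmod⟩ := exists_isSymbolicLimit hloc hdy
  refine hf ⟨H, i1, i2, i3, W.tr, hlim, fun x i ω ω' hω' => ?_⟩
  -- Only finitely many characters occur, so a large member of the run with the same table covers
  -- the input and `ω`, and its logits are those of the limit.
  obtain ⟨B, hB⟩ : ∃ B : ℕ, ∀ k, (Sum.inr k ∈ x ∨ ω = .chr k) → k < B := by
    have hfin : {k : ℕ | Sum.inr k ∈ x ∨ ω = .chr k}.Finite := by
      refine Set.Finite.union ?_ ?_
      · exact (List.finite_toSet x).preimage (Sum.inr_injective.injOn)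
      · refine Set.Subsingleton.finite fun a ha b hb => ?_
        have : (Token.chr a : Token S ℕ) = .chr b := ha.symm.trans hb
        simpa using this
    obtain ⟨B, hB⟩ := hfin.bddAbove
    exact ⟨B + 1, fun k hk => Nat.lt_succ_of_le (hB hk)⟩
  obtain ⟨m, hm, hmlt⟩ := hIinf.exists_gt (max B (strLen x))
  have hBm : B ≤ m := (le_max_left _ _).trans hmlt.le
  have hxm : strLen x ≤ m := (le_max_right _ _).trans hmlt.le
  obtain ⟨h1, W', hmod', hlog⟩ := hW m hm
  have hk : ∀ k, (Sum.inr k ∈ x ∨ ω = .chr k) → k < m := fun k hk => (hB k hk).trans_le hBm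
  have hkk : ∀ k k', (Sum.inr k ∈ x ∨ ω = .chr k) → (Sum.inr k' ∈ x ∨ ω = .chr k') →
      k ≤ k' + m := fun k k' h _ => by have := hk k h; omega
  obtain ⟨a, ha⟩ : ∃ a, shiftTok (m : ℕ∞) 0 ω = some a := by
    rcases ω with _ | σ | k
    · exact ⟨_, rfl⟩
    · exact ⟨_, rfl⟩
    · have : ((k + 0 : ℕ) : ℕ∞) < (m : ℕ∞) := by exact_mod_cast hk k (.inr rfl)
      simp only [shiftTok]
      rw [dif_pos this]
      exact ⟨_, rfl⟩
  have hop : strLen x + 0 ≤ m := hxm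
  have hoc : ∀ k, Sum.inr k ∈ x → k + 0 < m := fun k h => hk k (.inl h)
  rw [logits_eq_of_models (hmod m) (hmod' m) ε (fits_top x)
    (Hypothesis.MatchesUpTo.fits hop hoc) hω' ha hxm hkk i, hlog]
  exact (hG m h1).1 x ω hxm hk hkk 0 0 hop hoc i a ha

/-! ### Hypotheses that match short inputs only -/

/-- Shift of an extended character towards the first one. -/
def Token.unshift {S : Type*} (k₀ : ℕ) : Token S ℕ → Token S ℕ
  | start => start
  | fin σ => fin σ
  | chr k => chr (k - k₀)

/-- Shift of all extended characters of a word towards the first one. -/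
def unshiftWord {S : Type*} (k₀ : ℕ) (x : Word S) : Word S := x.map (Sum.map id (· - k₀))

lemma strLen_unshiftWord {S : Type*} (k₀ : ℕ) (x : Word S) :
    strLen x = strLen (unshiftWord k₀ x) := by
  simp [strLen, unshiftWord]

lemma symAt_unshiftWord {S : Type*} (k₀ : ℕ) (x : Word S) (i : Fin (strLen x)) :
    symAt (unshiftWord k₀ x) (Fin.cast (strLen_unshiftWord k₀ x) i) =
      (symAt x i).unshift k₀ := by
  induction i using Fin.cases with
  | zero => rfl
  | succ j =>
    change (match (x.map (Sum.map id (· - k₀))).get (Fin.cast (by simp) j) with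
      | Sum.inl σ => Token.fin σ
      | Sum.inr k => Token.chr k : Token S ℕ) = Token.unshift k₀ (match x.get j with
      | Sum.inl σ => Token.fin σ
      | Sum.inr k => Token.chr k)
    have : (x.map (Sum.map id (· - k₀))).get (Fin.cast (by simp) j) =
        Sum.map id (· - k₀) (x.get j) := by simp
    rw [this]
    rcases x.get j with σ | k <;> rfl

lemma mem_unshiftWord {S : Type*} {k₀ : ℕ} {x : Word S} {k : ℕ}
    (h : Sum.inr k ∈ unshiftWord k₀ x) : ∃ k', Sum.inr k' ∈ x ∧ k = k' - k₀ := by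
  obtain ⟨u, hu, he⟩ := List.mem_map.1 h
  rcases u with σ | k'
  · simp at he
  · exact ⟨k', hu, by simpa using he.symm⟩

lemma shiftTok_unshift {S : Type*} {N : ℕ∞} {k₀ : ℕ} {a : Token S ℕ}
    (h : ∀ k, a = .chr k → k₀ ≤ k) : shiftTok N k₀ (a.unshift k₀) = shiftTok N 0 a := by
  rcases a with _ | σ | k
  · rfl
  · rfl
  · have := h k rfl
    simp only [Token.unshift, shiftTok]
    simp only [Nat.sub_add_cancel this, Nat.add_zero]

lemma kind_unshift {S : Type*} (L D k₀ : ℕ) (a : Token S ℕ) :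
    a.kind L D = (a.unshift k₀).kind L D := by
  rcases a with _ | σ | k <;> rfl

lemma disp_unshift {S : Type*} {k₀ : ℕ} {a b : Token S ℕ} (ha : ∀ k, a = .chr k → k₀ ≤ k)
    (hb : ∀ k, b = .chr k → k₀ ≤ k) : a.disp b = (a.unshift k₀).disp (b.unshift k₀) := by
  rcases a with _ | σ | k <;> rcases b with _ | σ' | k' <;> try rfl
  have := ha k rfl
  have := hb k' rfl
  simp only [Token.unshift, Token.disp]
  omega

/-- If there are matching hypotheses of all sizes, then inputs of bounded size can be matched with
a bounded regularizer in all contexts. -/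
lemma exists_bounded_of_forall_matches
    (hm : ∀ n, ∃ G : Hypothesis S n, G.MatchesUpTo ε f n) (s : ℕ) :
    ∃ C : ℝ, ∀ n, ∃ G : Hypothesis S n, G.MatchesUpTo ε f s ∧ G.reg ≤ C := by
  -- Characters within distance `s`, moved down so that the least has index `0`, have indices at
  -- most `s` and fit into width `s + 1`. The table of `G₀` may be cut off at `s`, as no larger
  -- displacement occurs in the inputs concerned.
  obtain ⟨G₀, hG₀⟩ := hm (s + 1)
  have hdy : (G₀.T.weights.table.trunc s).Dyadic G₀.evalPrec :=
    (G₀.T.weights.dyadic_table G₀.isDyadic_eval).trunc s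
  have hmod₀ : G₀.T.weights.Models (G₀.T.weights.table.trunc s) s :=
    Weights.models_trunc (G₀.T.weights.models_table G₀.invariant s)
  obtain ⟨C, hC⟩ := exists_hypothesis_of_table (Table.localTo_trunc _ s) hdy
  refine ⟨C, fun n => ?_⟩
  obtain ⟨G, hG, W, hW, hmod⟩ := hC n
  refine ⟨G, fun x ω hx hk hkk op oc hop hoc i ω' hω' => ?_, hG⟩
  -- The role of `G₁` is to show that `f` itself is invariant: matching at all character offsets,
  -- `G₁` forces equal values of `f` on the input and on its shift. Its regularizer does not matter.
  obtain ⟨G₁, hG₁⟩ := hm n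
  obtain ⟨k₀, hk₀⟩ : ∃ k₀, ∀ k, (Sum.inr k ∈ x ∨ ω = .chr k) → k₀ ≤ k ∧ k ≤ k₀ + s := by
    classical
    by_cases hex : ∃ k, Sum.inr k ∈ x ∨ ω = .chr k
    · exact ⟨Nat.find hex, fun k h => ⟨Nat.find_min' hex h, hkk _ _ h (Nat.find_spec hex)⟩⟩
    · exact ⟨0, fun k h => absurd ⟨k, h⟩ hex⟩
  have hsym : ∀ j k, symAt x j = .chr k → k₀ ≤ k := fun j k h =>
    (hk₀ k (.inl (mem_of_symAt h))).1
  have hout : ∀ k, ω = .chr k → k₀ ≤ k := fun k h => (hk₀ k (.inr h)).1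
  have hlen := strLen_unshiftWord k₀ x
  have hmem : ∀ k, (Sum.inr k ∈ unshiftWord k₀ x ∨ ω.unshift k₀ = .chr k) →
      ∃ k', (Sum.inr k' ∈ x ∨ ω = .chr k') ∧ k + k₀ = k' := by
    rintro k (h | h)
    · obtain ⟨k', h1, h2⟩ := mem_unshiftWord h
      have := (hk₀ k' (.inl h1)).1
      exact ⟨k', .inl h1, by omega⟩
    · rcases ω with _ | σ | k'
      · simp [Token.unshift] at h
      · simp [Token.unshift] at h
      · simp only [Token.unshift, Token.chr.injEq] at h
        have := hout k' rfl
        exact ⟨k', .inr rfl, by omega⟩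
  have hsmall : ∀ k, (Sum.inr k ∈ unshiftWord k₀ x ∨ ω.unshift k₀ = .chr k) → k < s + 1 := by
    intro k h
    obtain ⟨k', h1, h2⟩ := hmem k h
    have := (hk₀ k' h1).2
    omega
  have hop₀ : strLen (unshiftWord k₀ x) + 0 ≤ s + 1 := by omega
  have hoc₀ : ∀ k, Sum.inr k ∈ unshiftWord k₀ x → k + 0 < s + 1 := fun k h => hsmall k (.inl h)
  obtain ⟨a₀, ha₀⟩ : ∃ a, shiftTok ((s + 1 : ℕ) : ℕ∞) 0 (ω.unshift k₀) = some a := by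
    rcases hω : ω.unshift k₀ with _ | σ | k
    · exact ⟨_, rfl⟩
    · exact ⟨_, rfl⟩
    · have : ((k + 0 : ℕ) : ℕ∞) < ((s + 1 : ℕ) : ℕ∞) := by exact_mod_cast hsmall k (.inr hω)
      simp only [shiftTok]
      rw [dif_pos this]
      exact ⟨_, rfl⟩
  obtain ⟨a₁, ha₁⟩ : ∃ a, shiftTok (n : ℕ∞) 0 ω = some a := by
    rcases ω with _ | σ | k
    · exact ⟨_, rfl⟩
    · exact ⟨_, rfl⟩
    · have : ((k + 0 : ℕ) : ℕ∞) < (n : ℕ∞) := by exact_mod_cast hk k (.inr rfl)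
      simp only [shiftTok]
      rw [dif_pos this]
      exact ⟨_, rfl⟩
  have e1 := logits_eq_of_models_of_shift (hmod s) hmod₀ ε hlen
    (Hypothesis.MatchesUpTo.fits hop hoc) (Hypothesis.MatchesUpTo.fits hop₀ hoc₀) hω' ha₀
    (fun j => by rw [symAt_unshiftWord]; exact kind_unshift _ _ _ _)
    (fun j j' => by
      rw [symAt_unshiftWord, symAt_unshiftWord]; exact disp_unshift (hsym j) (hsym j'))
    (kind_unshift _ _ _ _)
    (fun j => by rw [symAt_unshiftWord]; exact disp_unshift hout (hsym j)) hx hkk i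
  have e2 := hG₀ (unshiftWord k₀ x) (ω.unshift k₀) (by omega) hsmall
    (fun k k' h _ => by have := hsmall k h; omega) 0 0 hop₀ hoc₀ (Fin.cast hlen i) a₀ ha₀
  have hlt : ∀ k, (Sum.inr k ∈ unshiftWord k₀ x ∨ ω.unshift k₀ = .chr k) → k + k₀ < n := by
    intro k h
    obtain ⟨k', h1, h2⟩ := hmem k h
    have := hk k' h1
    omega
  have e3 := hG₁ (unshiftWord k₀ x) (ω.unshift k₀) (by omega)
    (fun k h => lt_of_le_of_lt (Nat.le_add_right k k₀) (hlt k h))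
    (fun k k' h _ => by have := hlt k h; omega) 0 k₀ (by omega) (fun k h => hlt k (.inl h))
    (Fin.cast hlen i) a₁ (by rw [shiftTok_unshift hout, ha₁])
  have e4 := hG₁ x ω (by omega) hk (fun k k' h _ => by have := hk k h; omega) 0 0 (by omega)
    (fun k h => hk k (.inl h)) i a₁ ha₁
  have e5 := congrFun (G₁.T.logits_cast ε hlen 0 (oc := 0) (oc' := k₀)
    (fun j => by rw [symAt_unshiftWord, shiftTok_unshift (hsym j)]) i) a₁
  -- The value passes from the realized table at `x` to `G₀` at the shifted word, hence to `f`
  -- there; `e3`, `e5` and `e4` then bring it back to `f` at `x` through `G₁`.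
  rw [hW, e1]
  refine e2.trans ?_
  rw [← e3, ← e4, e5]

/-! ### The slow training length and the theorem -/

/-- For a function that is not expressible, some training length defeats every run. -/
lemma exists_trainingLength_of_not_expressible (hf : ¬ Expressible ε f) :
    ∃ t : ℕ → ℕ, IsTrainingLength t ∧
      (∀ G : (n : ℕ) → Hypothesis S n, IsRun ε f t G →
        ∃ᶠ n in atTop, ¬ (G n).MatchesUpTo ε f n) ∧
      ((∀ n, ∃ G : Hypothesis S n, G.MatchesUpTo ε f n) →
        ∃ G : (n : ℕ) → Hypothesis S n, IsRun ε f t G) := by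
  -- If full matches are missing at some width, the training length `id` admits no run, and both
  -- claims hold vacuously.
  by_cases hm : ∀ n, 1 ≤ n → ∃ G : Hypothesis S n, G.MatchesUpTo ε f n
  swap
  · push Not at hm
    obtain ⟨n, hn, hno⟩ := hm
    exact ⟨id, ⟨tendsto_id, fun n => le_rfl⟩, fun G hG => absurd (hG n hn).1 (hno _),
      fun h => absurd (h n).choose_spec (hno _)⟩
  have hm' : ∀ n, ∃ G : Hypothesis S n, G.MatchesUpTo ε f n := by
    intro n
    obtain ⟨G, hG⟩ := hm (n + 1) (Nat.le_add_left 1 n)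
    exact ⟨G.restrict (Nat.le_succ n), (hG.mono (Nat.le_succ n)).restrict _⟩
  choose C hC using exists_bounded_of_forall_matches hm'
  choose N hN using fun s => exists_lt_reg_of_not_expressible hf (1 + C s)
  -- Size `s` is admitted only once `n ≥ N s`, that is, once every full match costs more than `1 + C
  -- s`.
  set t : ℕ → ℕ := fun n => Nat.findGreatest (fun s => N s ≤ n) n with ht
  have htle : ∀ n, t n ≤ n := fun n => Nat.findGreatest_le n
  -- `Nat.findGreatest` returns `0` when no size qualifies, so the condition on `N (t n)` is ensured
  -- only from `N 0` on.
  have hspec : ∀ n, N 0 ≤ n → N (t n) ≤ n := fun n hn =>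
    Nat.findGreatest_spec (P := fun s => N s ≤ n) (Nat.zero_le n) hn
  have htend : Tendsto t atTop atTop := by
    refine tendsto_atTop.2 fun s => ?_
    filter_upwards [eventually_ge_atTop s, eventually_ge_atTop (N s)] with n h1 h2
    exact Nat.le_findGreatest h1 h2
  refine ⟨t, ⟨htend, htle⟩, fun G hG => ?_, fun h => exists_isRun fun n => ?_⟩
  · refine Eventually.frequently ?_
    filter_upwards [eventually_ge_atTop (N 0), eventually_ge_atTop 1] with n h0 h1 hmatch
    -- A match up to `t n` of cost at most `C (t n)` exists, so `G n` costs at most `1 + C (t n)`,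
    -- too little for a full match.
    obtain ⟨G', hG', hr⟩ := hC (t n) n
    have e1 := (hG n h1).2 G' hG'
    have e2 := hN (t n) n (hspec n h0) (G n) hmatch
    have e3 : 1 / (n : ℝ) ≤ 1 := by
      rw [div_le_one (by exact_mod_cast h1)]
      exact_mod_cast h1
    linarith
  · obtain ⟨G, hG⟩ := h n
    exact ⟨G, hG.mono (htle n)⟩

end

end

theorem theoremC {S : Type*} [Finite S] (ε : ℝ) (hε : 0 < ε) (f : Target S) :
    (Expressible ε f ↔
      ∀ t : ℕ → ℕ, IsTrainingLength t →
        (∃ G : (n : ℕ) → Hypothesis S n, IsRun ε f t G) ∧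
        ∀ G : (n : ℕ) → Hypothesis S n, IsRun ε f t G →
          ∃ N₀ : ℕ, ∀ m, N₀ < m → (G m).MatchesUpTo ε f m) ∧
    (¬ Expressible ε f →
      ∃ t : ℕ → ℕ, IsTrainingLength t ∧
        (∀ G : (n : ℕ) → Hypothesis S n, IsRun ε f t G →
          ∃ᶠ n in atTop, ¬ (G n).MatchesUpTo ε f n) ∧
        ((∀ n, ∃ G : Hypothesis S n, G.MatchesUpTo ε f n) →
          ∃ G : (n : ℕ) → Hypothesis S n, IsRun ε f t G)) := by
  refine ⟨⟨fun hf t ht => ⟨?_, fun G hG => hG.generalizes hf ht⟩, fun h => ?_⟩,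
    exists_trainingLength_of_not_expressible⟩
  · obtain ⟨C, hC⟩ := hf.exists_hypothesis
    exact exists_isRun fun n => ⟨_, (hC n).choose_spec.2 (t n)⟩
  · by_contra hf
    obtain ⟨t, ht, hbad, -⟩ := exists_trainingLength_of_not_expressible hf
    obtain ⟨⟨G, hG⟩, hgen⟩ := h t ht
    obtain ⟨N₀, hN₀⟩ := hgen G hG
    obtain ⟨m, hm, hm'⟩ := frequently_atTop.1 (hbad G hG) (N₀ + 1)
    exact hm' (hN₀ m hm)
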